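/- Let $F_n$ be the free group with fixed basis $a_1,\dots,a_n$. A reduced word $x_1\cdots x_l$ in the letters $a_i^{\pm1}$ is cyclically reduced if moreover $x_1\neq x_l^{-1}$. Let $U=(u_1,\dots,u_r)$ be a list of nontrivial cyclically reduced words in $F_n$. * $U$ is *minimal* if no automorphism $\varphi$ of $F_n$ reduces the sum of the lengths of the words, where words are considered up to conjugacy: $\sum_j |u_j|\le\sum_j |v_j|$ for every $\varphi\in\mathrm{Aut}(F_n)$ and all $v_1,\dots,v_r\in F_n$ with $v_j$ conjugate to $\varphi(u_j)$ for each $j$. * $U$ is *diskbusting* if one cannot write $F_n=A*B$ with $A,B\neq\{1\}$ and each $u_j$ conjugate into $A$ or into $B$. * A *$U$-polygonal surface* consists of polygonal disks $P_1,\dots,P_m$ (disks whose boundary circle has a graph structure with at least one side), a side-pairing $\sim$ that glues their sides in pairs by homeomorphisms, giving a closed (not necessarily connected or orientable) surface $S=\coprod_i P_i/\!\sim$ with its natural cell structure, and an immersion (locally injective graph map) of the $1$-skeleton $S^{(1)}$ into the bouquet $\mathrm{Cay}(F_n)/F_n$ of $n$ oriented circles labeled $a_1,\dots,a_n$, such that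 (i) for each $i$ the composition $\partial P_i\to S^{(1)}\to\mathrm{Cay}(F_n)/F_n$, for a suitable initial vertex and orientation of $\partial P_i$, reads $u_j^{c}$ for some $j$ and some $c\ge1$, and (ii) $\chi(S)<m$. The list $U$ is *polygonal* if a $U$-polygonal surface exists. * The *Tiling Conjecture* says that for every $n>1$ every minimal and diskbusting list of nontrivial cyclically reduced words in $F_n$ is polygonal. * Given a $U$-polygonal surface and a partition $\{P_1,\dots,P_m\}=\mathcal P_1\sqcup\dots\sqcup\mathcal P_r$ such that each $P_i\in\mathcal P_j$ reads (for a suitable initial vertex and orientation of $\partial P_i$) a power $u_j^{c}$ with exponent $c\ge1$, the *positive degree* of $u_j$ with respect to the partition is the sum of these exponents over all disks in $\mathcal P_j$. **Proposition.** Let $n>1$ and let $U=(u_1,\dots,u_r)$ be a minimal and diskbusting list of nontrivial cyclically reduced words in $F_n$. Assume that the Tiling Conjecture is true or that $n=2$. Then there exist a $U$-polygonal surface, a partition $\mathcal P_1\sqcup\dots\sqcup\mathcal P_r$ of its polygonal disks as above, and an integer $d>0$ such that every word $u_j$ of $U$ has positive degree $d$ with respect to this partition. -/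

import Mathlib

/-- Letters `a_i` (as `(i, true)`) and `a_i⁻¹` (as `(i, false)`) of the free group `F_n`,
with Mathlib's convention for words representing elements of `FreeGroup (Fin n)`. -/
abbrev Letter (n : ℕ) : Type := Fin n × Bool

/-- The inverse letter. -/
def Letter.inv {n : ℕ} (x : Letter n) : Letter n := (x.1, !x.2)

/-- A list of words is minimal if no automorphism of `F_n` reduces the sum of their lengths, the
words being considered up to conjugacy: the words `φ (u i)` may be replaced by any conjugates of
them (for instance by cyclically reduced ones) before the lengths are added up. -/
def IsMinimalList {n r : ℕ} (u : Fin r → FreeGroup (Fin n)) : Prop :=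
  ∀ (φ : FreeGroup (Fin n) ≃* FreeGroup (Fin n)) (v : Fin r → FreeGroup (Fin n)),
    (∀ j, IsConj (φ (u j)) (v j)) → ∑ j, (u j).norm ≤ ∑ j, (v j).norm

/-- The group `G` is the internal free product of its subgroups `A` and `B`. -/
def IsInternalFreeProduct {G : Type*} [Group G] (A B : Subgroup G) : Prop :=
  Function.Bijective (Monoid.Coprod.lift A.subtype B.subtype)

/-- A list of words is diskbusting if there is no free splitting `F_n = A * B` with `A, B ≠ 1`
such that each word of the list is conjugate into `A` or into `B`. -/
def IsDiskbusting {n r : ℕ} (u : Fin r → FreeGroup (Fin n)) : Prop :=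
  ¬ ∃ A B : Subgroup (FreeGroup (Fin n)), A ≠ ⊥ ∧ B ≠ ⊥ ∧ IsInternalFreeProduct A B ∧
    ∀ j, ∃ v, IsConj (u j) v ∧ (v ∈ A ∨ v ∈ B)

/-- A side-pairing on finitely many polygonal disks `P_0, …, P_{m-1}`, where `P_i` is a polygon
with `len i ≥ 1` sides.

The pair `⟨i, k⟩` stands for the `k`-th side of `P_i` in the cyclic order of a fixed orientation of
the circle `∂P_i`, and also for the initial vertex of this side. The sides `s` and `pair s` are
glued; up to isotopy, the gluing homeomorphism is determined by whether it respects the chosen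
directions of the two sides (`same s = true`) or reverses them (`same s = false`). -/
structure SidePairing where
  m : ℕ
  len : Fin m → ℕ
  len_pos : ∀ i, 0 < len i
  pair : (Σ i, Fin (len i)) → (Σ i, Fin (len i))
  pair_pair : ∀ s, pair (pair s) = s
  pair_ne : ∀ s, pair s ≠ s
  same : (Σ i, Fin (len i)) → Bool
  same_pair : ∀ s, same (pair s) = same s

namespace SidePairing

/-- The sides of the polygonal disks (also used to index the vertices of the disks, a side standing
for its initial vertex). -/
abbrev Side (S : SidePairing) : Type := Σ i : Fin S.m, Fin (S.len i)

/-- The next side in the cyclic order on the boundary of the same polygonal disk. -/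
def next (S : SidePairing) (s : S.Side) : S.Side := ⟨s.1, finRotate (S.len s.1) s.2⟩

/-- Directed sides: `(s, true)` is the side `s` in its chosen direction, `(s, false)` is the
side `s` in the opposite direction. -/
abbrev Dart (S : SidePairing) : Type := S.Side × Bool

/-- The directed side to which a directed side is glued. -/
def glue (S : SidePairing) (d : S.Dart) : S.Dart := (S.pair d.1, d.2 == S.same d.1)

/-- The initial vertex (a vertex of a polygonal disk) of a directed side. -/
def origin (S : SidePairing) (d : S.Dart) : S.Side := if d.2 then d.1 else S.next d.1

/-- The vertices of the closed surface `S = ∐ P_i / ∼`: the vertices of the polygonal disks, modulo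
the equivalence relation generated by the gluing of the sides. -/
def Vertex (S : SidePairing) : Type :=
  Quot fun p q : S.Side => ∃ d : S.Dart, S.origin d = p ∧ S.origin (S.glue d) = q

/-- The vertex of the surface given by a vertex of a polygonal disk. -/
def vertex (S : SidePairing) (p : S.Side) : S.Vertex := Quot.mk _ p

/-- The edges of the closed surface: the sides of the polygonal disks, modulo the pairing. -/
def Edge (S : SidePairing) : Type := Quot fun s t : S.Side => S.pair s = t

/-- The Euler characteristic of the closed surface, from its CW-structure. -/
noncomputable def eulerChar (S : SidePairing) : ℤ :=
  (Nat.card S.Vertex : ℤ) - (Nat.card S.Edge : ℤ) + (S.m : ℤ)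

/-- An immersion (locally injective graph map) of the `1`-skeleton of the surface into the bouquet
of circles `Cay(F_n) / F_n`. A graph map to the bouquet gives to each side, in its chosen
direction, a letter; sides that are glued get the same letter, or inverse ones if the gluing
reverses directions. It is locally injective if different directed edges of the surface
issuing from the same vertex never have the same letter. -/
structure Immersion (S : SidePairing) (n : ℕ) where
  label : S.Side → Letter n
  label_pair : ∀ s, label (S.pair s) = if S.same s then label s else (label s).inv
  locally_injective : ∀ d e : S.Dart,
    S.vertex (S.origin d) = S.vertex (S.origin e) →
    (if d.2 then label d.1 else (label d.1).inv) = (if e.2 then label e.1 else (label e.1).inv) →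
    e = d ∨ e = S.glue d

/-- The word read along the boundary of the polygonal disk `P_i`, from its vertex `⟨i, 0⟩` and in
the chosen orientation of `∂P_i`. -/
def Immersion.boundaryWord {S : SidePairing} {n : ℕ} (f : S.Immersion n) (i : Fin S.m) :
    List (Letter n) :=
  List.ofFn fun k => f.label ⟨i, k⟩

/-- For one of the two orientations of the circle `∂P_i` and some initial vertex on it, the boundary
of `P_i` reads the word `w ^ c`, where `c` is positive. Equivalently, in the chosen orientation it
reads `w ^ c` or `w ^ (-c)` up to cyclic permutation. -/
def Immersion.ReadsPower {S : SidePairing} {n : ℕ} (f : S.Immersion n) (i : Fin S.m)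
    (w : FreeGroup (Fin n)) (c : ℕ) : Prop :=
  0 < c ∧ (f.boundaryWord i ~r (w ^ c).toWord ∨
    FreeGroup.invRev (f.boundaryWord i) ~r (w ^ c).toWord)

end SidePairing

/-- A `U`-polygonal surface, for a list `U` of (cyclically reduced) words `u j`. -/
structure PolygonalSurface {n r : ℕ} (u : Fin r → FreeGroup (Fin n)) where
  surface : SidePairing
  immersion : surface.Immersion n
  reads : ∀ i, ∃ j c, immersion.ReadsPower i (u j) c
  eulerChar_lt : surface.eulerChar < surface.m

/-- A list of (cyclically reduced) words is polygonal if it has a polygonal surface. -/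
def IsPolygonal {n r : ℕ} (u : Fin r → FreeGroup (Fin n)) : Prop :=
  Nonempty (PolygonalSurface u)

/-- The Tiling Conjecture: for `n > 1`, every minimal and diskbusting list of (nontrivial)
cyclically reduced words in `F_n` is polygonal. -/
def TilingConjecture : Prop :=
  ∀ (n r : ℕ) (u : Fin r → FreeGroup (Fin n)), 1 < n → (∀ j, u j ≠ 1) →
    (∀ j, FreeGroup.IsCyclicallyReduced (u j).toWord) →
    IsMinimalList u → IsDiskbusting u → IsPolygonal u

/-- A partition of the polygonal disks of a `U`-polygonal surface into classes indexed by the words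
of `U`, such that each disk `P_i` in the class of `u j` reads a power of `u j`; `exponent i` is the
exponent of this power, for the orientation of `∂P_i` that makes it positive. -/
structure PolygonalSurface.WordPartition {n r : ℕ} {u : Fin r → FreeGroup (Fin n)}
    (S : PolygonalSurface u) where
  part : Fin S.surface.m → Fin r
  exponent : Fin S.surface.m → ℕ
  reads : ∀ i, S.immersion.ReadsPower i (u (part i)) (exponent i)

/-- The positive degree of the word `u j` with respect to a partition of the polygonal disks: the
sum of the exponents over the disks in the class of `u j`. -/
def PolygonalSurface.WordPartition.positiveDegree {n r : ℕ} {u : Fin r → FreeGroup (Fin n)}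
    {S : PolygonalSurface u} (Q : S.WordPartition) (j : Fin r) : ℕ :=
  ∑ i with Q.part i = j, Q.exponent i

/-! Two copies of a disk reading u_j, glued along their boundaries, form a sphere with two disks and
Euler characteristic two. Adding it to a polygonal surface keeps χ(S) < m and raises the degree of
u_j by two. Take two copies of a polygonal surface with degrees d_j, put D = ∑ d_j, and add D - d_j
such spheres for each j: all degrees become 2D (`IsPolygonal.exists_equal_degrees`). It remains to
find one polygonal surface. The Tiling Conjecture provides it; for n = 2 it is constructed.

The construction starts from the links of the vertices. A corner of a cyclic word, between two
consecutive letters, is an edge of the Whitehead graph, whose vertices are the directions a⁺, a⁻,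
b⁺, b⁻. A link meets each direction in no corner or in two, as local injectivity demands. A finite
family of such sets can be glued to a surface if, for any two letters of a generator g, as many
links turn at g⁺ through their initial corners as turn at g⁻ through their final corners
(`isPolygonal_of_cycleSets`). By clearing denominators, nonnegative rational weights serve as well.
Since χ(S) < m means that there are fewer vertices than edges, a single vertex with three corners is
enough for strictness.

Let p, q, x, y be the numbers of corners joining a⁺ to a⁻, b⁺ to b⁻, a⁺ to b⁺ (as many as a⁻ to b⁻)
and a⁺ to b⁻ (as many as a⁻ to b⁺). Minimality under the automorphisms multiplying a by b or b⁻¹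
gives x ≤ p + y and y ≤ p + x; diskbusting gives x + y > 0; by symmetry p ≤ q. All turns at b⁺ and
b⁻ get weight 1. Weight 1 would also do at a⁺ and a⁻ if p = q. In general the turn between two
letters s, t of the generator a gets weight 1 + μ η(s, t), where η ≥ 0 is symmetric, compatible with
the types of the corners, and has constant positive row sums, and where μ absorbs q - p. The two
inequalities are what allows such an η (`LetterTurns.exists_perturbation`). Bigons, triangles and
quadrilaterals then realize the turns (`TurnWeights.weight`). -/

namespace SidePairing

/-! ### The Euler characteristic from counts of corners -/

theorem two_mul_card_edge (S : SidePairing) : 2 * Nat.card S.Edge = Fintype.card S.Side := by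
  classical
  have : Finite S.Edge := Quot.finite _
  have := Fintype.ofFinite S.Edge
  let q : S.Side → S.Edge := Quot.mk _
  have key : ∀ s t : S.Side, q s = q t ↔ t = s ∨ t = S.pair s := by
    intro s t
    constructor
    · intro h
      -- An edge determines the set of its two sides, because the pairing is an involution.
      let F : S.Edge → Finset S.Side := Quot.lift (fun s => {s, S.pair s}) (by
        rintro a _ rfl
        rw [S.pair_pair, Finset.pair_comm])
      have h2 : F (q s) = F (q t) := by rw [h]
      have h3 : t ∈ F (q t) := Finset.mem_insert_self _ _
      rw [← h2] at h3
      simpa [F, q] using h3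
    · rintro (rfl | rfl)
      · rfl
      · exact Quot.sound rfl
  have h1 : Fintype.card S.Side = ∑ e : S.Edge, (Finset.univ.filter fun s => q s = e).card :=
    Finset.card_eq_sum_card_fiberwise (fun s _ => Finset.mem_univ (q s))
  have h2 : ∀ e : S.Edge, (Finset.univ.filter fun s => q s = e).card = 2 := by
    intro e
    obtain ⟨s, rfl⟩ := Quot.exists_rep e
    have : (Finset.univ.filter fun t => q t = Quot.mk _ s) = {s, S.pair s} := by
      ext t
      have := key s t
      simp only [Finset.mem_filter, Finset.mem_univ, true_and, Finset.mem_insert,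
        Finset.mem_singleton]
      rw [← this, eq_comm]
    rw [this, Finset.card_pair (S.pair_ne s).symm]
  rw [h1, Finset.sum_congr rfl fun e _ => h2 e, Finset.sum_const, Finset.card_univ,
    Nat.card_eq_fintype_card, smul_eq_mul, mul_comm]

instance (S : SidePairing) : Finite S.Vertex := Quot.finite _

/-- The disks cancel, so the condition compares vertices with edges, and each edge consists of two
sides. -/
theorem eulerChar_lt_iff (S : SidePairing) :
    S.eulerChar < S.m ↔ 2 * Nat.card S.Vertex < Fintype.card S.Side := by
  rw [← S.two_mul_card_edge, eulerChar]
  omega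

/-- Sides also index the corners of the disks, so the sides are distributed over the vertices of the
surface, at least two to each. -/
theorem two_mul_card_vertex_le (S : SidePairing)
    (h : ∀ p : S.Side, ∃ q, q ≠ p ∧ S.vertex q = S.vertex p) :
    2 * Nat.card S.Vertex ≤ Fintype.card S.Side := by
  classical
  have := Fintype.ofFinite S.Vertex
  have h1 : Fintype.card S.Side =
      ∑ v : S.Vertex, (Finset.univ.filter fun s => S.vertex s = v).card :=
    Finset.card_eq_sum_card_fiberwise (fun s _ => Finset.mem_univ (S.vertex s))
  rw [h1, Nat.card_eq_fintype_card, ← Finset.card_univ, mul_comm, ← smul_eq_mul]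
  refine Finset.card_nsmul_le_sum _ _ _ fun v _ => ?_
  obtain ⟨p, rfl⟩ := Quot.exists_rep v
  obtain ⟨q, hq, hv⟩ := h p
  exact Finset.one_lt_card.2 ⟨p, Finset.mem_filter.2 ⟨Finset.mem_univ _, rfl⟩, q,
      Finset.mem_filter.2 ⟨Finset.mem_univ _, hv⟩, hq.symm⟩

theorem two_mul_card_vertex_lt (S : SidePairing)
    (h : ∀ p : S.Side, ∃ q, q ≠ p ∧ S.vertex q = S.vertex p)
    (h3 : ∃ p q r : S.Side, p ≠ q ∧ p ≠ r ∧ q ≠ r ∧ S.vertex q = S.vertex p ∧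
      S.vertex r = S.vertex p) :
    2 * Nat.card S.Vertex < Fintype.card S.Side := by
  classical
  have := Fintype.ofFinite S.Vertex
  have h1 : Fintype.card S.Side =
      ∑ v : S.Vertex, (Finset.univ.filter fun s => S.vertex s = v).card :=
    Finset.card_eq_sum_card_fiberwise (fun s _ => Finset.mem_univ (S.vertex s))
  rw [h1, Nat.card_eq_fintype_card, ← Finset.card_univ, mul_comm, ← smul_eq_mul,
    ← Finset.sum_const]
  refine Finset.sum_lt_sum (fun v _ => ?_) ?_
  · obtain ⟨p, rfl⟩ := Quot.exists_rep v
    obtain ⟨q, hq, hv⟩ := h p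
    exact Finset.one_lt_card.2 ⟨p, Finset.mem_filter.2 ⟨Finset.mem_univ _, rfl⟩, q,
      Finset.mem_filter.2 ⟨Finset.mem_univ _, hv⟩, hq.symm⟩
  · obtain ⟨p, q, r, hpq, hpr, hqr, hq, hr⟩ := h3
    exact ⟨S.vertex p, Finset.mem_univ _, Finset.two_lt_card.2
      ⟨p, by simp, q, by simpa using hq, r, by simpa using hr, hpq, hpr, hqr⟩⟩

end SidePairing

/-! ### Labelled gluings with arbitrary index types -/

/-- A labelled side-pairing on polygonal disks whose sides are indexed by an arbitrary type. -/
structure GluingData (n : ℕ) where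
  m : ℕ
  len : Fin m → ℕ
  len_pos : ∀ i, 0 < len i
  Sd : Type
  equiv : (Σ i, Fin (len i)) ≃ Sd
  next : Sd → Sd
  equiv_rotate : ∀ i k, equiv ⟨i, finRotate _ k⟩ = next (equiv ⟨i, k⟩)
  pair : Sd → Sd
  pair_pair : ∀ s, pair (pair s) = s
  pair_ne : ∀ s, pair s ≠ s
  same : Sd → Bool
  same_pair : ∀ s, same (pair s) = same s
  label : Sd → Letter n
  label_pair : ∀ s, label (pair s) = if same s then label s else (label s).inv

namespace GluingData

variable {n : ℕ} (G : GluingData n)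

/-- The initial vertex of a directed side. -/
def origin (d : G.Sd × Bool) : G.Sd := if d.2 then d.1 else G.next d.1

/-- The directed side to which a directed side is glued. -/
def glue (d : G.Sd × Bool) : G.Sd × Bool := (G.pair d.1, d.2 == G.same d.1)

/-- The letter of a directed side. -/
def outLabel (d : G.Sd × Bool) : Letter n := if d.2 then G.label d.1 else (G.label d.1).inv

/-- The underlying side-pairing. -/
def toSidePairing : SidePairing where
  m := G.m
  len := G.len
  len_pos := G.len_pos
  pair s := G.equiv.symm (G.pair (G.equiv s))
  pair_pair s := by simp [G.pair_pair]
  pair_ne s h := G.pair_ne (G.equiv s) (by simpa using congrArg G.equiv h)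
  same s := G.same (G.equiv s)
  same_pair s := by simp [G.same_pair]

/-- The sides of the underlying side-pairing. -/
def sideEquiv : G.toSidePairing.Side ≃ G.Sd := G.equiv

theorem sideEquiv_pair (s : G.toSidePairing.Side) :
    G.sideEquiv (G.toSidePairing.pair s) = G.pair (G.sideEquiv s) :=
  G.equiv.apply_symm_apply _

theorem equiv_next (s : G.toSidePairing.Side) :
    G.sideEquiv (G.toSidePairing.next s) = G.next (G.sideEquiv s) :=
  G.equiv_rotate s.1 s.2

theorem equiv_origin (d : G.toSidePairing.Dart) :
    G.sideEquiv (G.toSidePairing.origin d) = G.origin (G.sideEquiv d.1, d.2) := by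
  rcases d with ⟨s, _ | _⟩
  · exact G.equiv_next s
  · rfl

theorem equiv_glue (d : G.toSidePairing.Dart) :
    (G.sideEquiv (G.toSidePairing.glue d).1, (G.toSidePairing.glue d).2) =
      G.glue (G.sideEquiv d.1, d.2) :=
  Prod.ext (G.sideEquiv_pair d.1) rfl

theorem vertex_eq_of_glue (d : G.Sd × Bool) :
    G.toSidePairing.vertex (G.sideEquiv.symm (G.origin d)) =
      G.toSidePairing.vertex (G.sideEquiv.symm (G.origin (G.glue d))) := by
  refine Quot.sound ⟨(G.sideEquiv.symm d.1, d.2), ?_, ?_⟩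
  · rw [← G.sideEquiv.apply_eq_iff_eq, G.equiv_origin]
    simp
  · rw [← G.sideEquiv.apply_eq_iff_eq, G.equiv_origin, G.equiv_glue]
    simp

/-- Only invariance under single gluings has to be checked; the generated equivalence relation need
not be described in order to tell vertices apart. -/
theorem invariant_eq_of_vertex_eq {V : Type*} (vtx : G.Sd → V)
    (hglue : ∀ d, vtx (G.origin d) = vtx (G.origin (G.glue d))) {s t : G.toSidePairing.Side}
    (h : G.toSidePairing.vertex s = G.toSidePairing.vertex t) :
    vtx (G.sideEquiv s) = vtx (G.sideEquiv t) := by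
  let F : G.toSidePairing.Vertex → V := Quot.lift (fun s => vtx (G.sideEquiv s)) (by
    rintro a b ⟨d, rfl, rfl⟩
    rw [G.equiv_origin, G.equiv_origin, G.equiv_glue]
    exact hglue _)
  exact congrArg F h

/-- An immersion, from a vertex invariant that separates the directed sides with the same
letter. -/
def toImmersion {V : Type*} (vtx : G.Sd → V)
    (hglue : ∀ d, vtx (G.origin d) = vtx (G.origin (G.glue d)))
    (hinj : ∀ d e, vtx (G.origin d) = vtx (G.origin e) → G.outLabel d = G.outLabel e →
      e = d ∨ e = G.glue d) : G.toSidePairing.Immersion n where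
  label s := G.label (G.sideEquiv s)
  label_pair s := by
    change G.label (G.equiv (G.equiv.symm _)) = _
    rw [Equiv.apply_symm_apply, G.label_pair]
    rfl
  locally_injective d e h hl := by
    have h1 := G.invariant_eq_of_vertex_eq vtx hglue h
    rw [G.equiv_origin, G.equiv_origin] at h1
    have inj : ∀ d e : G.toSidePairing.Dart,
        (G.sideEquiv d.1, d.2) = (G.sideEquiv e.1, e.2) → d = e := by
      intro d e h
      simp only [Prod.mk.injEq, EmbeddingLike.apply_eq_iff_eq] at h
      exact Prod.ext h.1 h.2
    rcases hinj _ _ h1 hl with h2 | h2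
    · exact Or.inl (inj _ _ h2)
    · right
      apply inj
      rw [h2, G.equiv_glue]

end GluingData

theorem val_finRotate {n : ℕ} (k : Fin n) : (finRotate n k : ℕ) = (k + 1) % n := by
  have := k.neZero
  rw [finRotate_apply, Fin.val_add]
  simp

/-- The cycles of a permutation of a finite type, as polygons. -/
theorem Equiv.Perm.exists_polygon_decomposition {T : Type} [Finite T] (ν : Equiv.Perm T) :
    ∃ (m : ℕ) (len : Fin m → ℕ) (φ : (Σ i, Fin (len i)) ≃ T), (∀ i, 0 < len i) ∧
      ∀ i k, φ ⟨i, finRotate _ k⟩ = ν (φ ⟨i, k⟩) := by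
  classical
  let Q := Quotient (Equiv.Perm.SameCycle.setoid ν)
  have : Finite Q := Quotient.finite _
  let e := Finite.equivFin Q
  let rep : Fin (Nat.card Q) → T := fun i => (e.symm i).out
  have hper : ∀ t : T, 0 < Function.minimalPeriod ν t := fun t =>
    Function.minimalPeriod_pos_of_mem_periodicPts
      (Function.Injective.mem_periodicPts ν.injective t)
  let f : (Σ i : Fin (Nat.card Q), Fin (Function.minimalPeriod ν (rep i))) → T :=
    fun s => ν^[s.2] (rep s.1)
  have hsame : ∀ (k : ℕ) (t : T), ν.SameCycle t (ν^[k] t) := fun k t =>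
    ⟨k, by rw [zpow_natCast, Equiv.Perm.iterate_eq_pow]⟩
  have hf : Function.Bijective f := by
    constructor
    · rintro ⟨i, k⟩ ⟨j, l⟩ h
      have hij : i = j := by
        have h1 : ν.SameCycle (rep i) (rep j) :=
          (hsame k (rep i)).trans (by
            rw [show ν^[k] (rep i) = ν^[l] (rep j) from h]; exact (hsame l (rep j)).symm)
        have h2 : (Quotient.mk _ (rep i) : Q) = Quotient.mk _ (rep j) := Quotient.sound h1
        simp only [rep, Quotient.out_eq] at h2
        exact e.symm.injective h2
      subst hij
      have := Function.iterate_injOn_Iio_minimalPeriod (f := ν) (x := rep i)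
        (show (k : ℕ) ∈ Set.Iio _ from k.2) (show (l : ℕ) ∈ Set.Iio _ from l.2) h
      rw [Fin.ext this]
    · intro t
      let i := e (Quotient.mk _ t)
      have h1 : ν.SameCycle (rep i) t := by
        have : (Quotient.mk _ (rep i) : Q) = Quotient.mk _ t := by simp [rep, i]
        exact Quotient.exact this
      obtain ⟨k, -, hk⟩ := h1.exists_pow_eq'
      refine ⟨⟨i, k % Function.minimalPeriod ν (rep i), Nat.mod_lt _ (hper _)⟩, ?_⟩
      simp only [f]
      rw [Function.iterate_mod_minimalPeriod_eq, Equiv.Perm.iterate_eq_pow, hk]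
  refine ⟨_, _, Equiv.ofBijective f hf, fun i => hper _, fun i k => ?_⟩
  simp only [Equiv.ofBijective_apply, f]
  rw [val_finRotate, Function.iterate_mod_minimalPeriod_eq, Function.iterate_succ_apply']

/-! ### Degrees under disjoint union -/

/-- There is a labelled surface of disks reading powers of the words `u j`, with the given positive
degrees and with a bound on the number of vertices. -/
def RealizesDegrees {n r : ℕ} (u : Fin r → FreeGroup (Fin n)) (R : ℕ → ℕ → Prop)
    (deg : Fin r → ℕ) : Prop :=
  ∃ (S : SidePairing) (f : S.Immersion n) (part : Fin S.m → Fin r) (exponent : Fin S.m → ℕ),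
    (∀ i, f.ReadsPower i (u (part i)) (exponent i)) ∧
    (∀ j, ∑ i with part i = j, exponent i = deg j) ∧
    R (2 * Nat.card S.Vertex) (Fintype.card S.Side)

section Union

variable {n : ℕ} {S T : SidePairing} (f : S.Immersion n) (g : T.Immersion n)

/-- The disjoint union of two labelled side-pairings. -/
def unionData : GluingData n where
  m := S.m + T.m
  len i := Sum.elim S.len T.len (finSumFinEquiv.symm i)
  len_pos i := by
    rcases finSumFinEquiv.symm i with a | a
    · exact S.len_pos a
    · exact T.len_pos a
  Sd := S.Side ⊕ T.Side
  equiv := (Equiv.sigmaCongrLeft (β := fun z => Fin (Sum.elim S.len T.len z))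
    finSumFinEquiv.symm).trans (Equiv.sumSigmaDistrib _)
  next := Sum.map S.next T.next
  equiv_rotate i k := by
    let e := Equiv.sumSigmaDistrib fun z => Fin (Sum.elim S.len T.len z)
    change e ⟨finSumFinEquiv.symm i, finRotate _ k⟩ =
      Sum.map S.next T.next (e ⟨finSumFinEquiv.symm i, k⟩)
    generalize finSumFinEquiv.symm i = z at k
    rcases z with a | a <;> rfl
  pair := Sum.map S.pair T.pair
  pair_pair := by rintro (s | s) <;> simp [S.pair_pair, T.pair_pair]
  pair_ne := by rintro (s | s) <;> simp [S.pair_ne, T.pair_ne]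
  same := Sum.elim S.same T.same
  same_pair := by rintro (s | s) <;> simp [S.same_pair, T.same_pair]
  label := Sum.elim f.label g.label
  label_pair := by 
    rintro (s | s)
    · exact f.label_pair s
    · exact g.label_pair s

/-- A directed side of the first summand of a disjoint union. -/
def inlDart (d : S.Dart) : (unionData f g).Sd × Bool := (Sum.inl d.1, d.2)

/-- A directed side of the second summand of a disjoint union. -/
def inrDart (d : T.Dart) : (unionData f g).Sd × Bool := (Sum.inr d.1, d.2)

theorem dart_cases (d : (unionData f g).Sd × Bool) :
    (∃ e, d = inlDart f g e) ∨ ∃ e, d = inrDart f g e := by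
  rcases d with ⟨s | s, b⟩
  · exact Or.inl ⟨(s, b), rfl⟩
  · exact Or.inr ⟨(s, b), rfl⟩

theorem origin_inlDart (d : S.Dart) :
    (unionData f g).origin (inlDart f g d) = Sum.inl (S.origin d) := by
  rcases d with ⟨s, _ | _⟩ <;> rfl

theorem origin_inrDart (d : T.Dart) :
    (unionData f g).origin (inrDart f g d) = Sum.inr (T.origin d) := by
  rcases d with ⟨s, _ | _⟩ <;> rfl

theorem glue_inlDart (d : S.Dart) :
    (unionData f g).glue (inlDart f g d) = inlDart f g (S.glue d) := rfl

theorem glue_inrDart (d : T.Dart) :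
    (unionData f g).glue (inrDart f g d) = inrDart f g (T.glue d) := rfl

/-- The vertex of the disjoint union given by a side. -/
def unionVertex : (unionData f g).Sd → S.Vertex ⊕ T.Vertex := Sum.map S.vertex T.vertex

theorem unionVertex_inlDart (d : S.Dart) :
    unionVertex f g ((unionData f g).origin (inlDart f g d)) =
      Sum.inl (S.vertex (S.origin d)) := by
  rw [origin_inlDart]
  rfl

theorem unionVertex_inrDart (d : T.Dart) :
    unionVertex f g ((unionData f g).origin (inrDart f g d)) =
      Sum.inr (T.vertex (T.origin d)) := by
  rw [origin_inrDart]
  rfl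

/-- The immersion of a disjoint union. -/
def unionImmersion : (unionData f g).toSidePairing.Immersion n :=
  (unionData f g).toImmersion (unionVertex f g)
    (fun d => by
      rcases dart_cases f g d with ⟨e, rfl⟩ | ⟨e, rfl⟩
      · rw [glue_inlDart, unionVertex_inlDart, unionVertex_inlDart]
        exact congrArg Sum.inl (Quot.sound ⟨e, rfl, rfl⟩)
      · rw [glue_inrDart, unionVertex_inrDart, unionVertex_inrDart]
        exact congrArg Sum.inr (Quot.sound ⟨e, rfl, rfl⟩))
    (fun d e h hl => by
      rcases dart_cases f g d with ⟨d, rfl⟩ | ⟨d, rfl⟩ <;>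
      rcases dart_cases f g e with ⟨e, rfl⟩ | ⟨e, rfl⟩ <;>
      simp only [unionVertex_inlDart, unionVertex_inrDart, Sum.inl.injEq, Sum.inr.injEq,
        reduceCtorEq] at h
      · rw [glue_inlDart]
        exact (f.locally_injective d e h hl).imp (congrArg _) (congrArg _)
      · rw [glue_inrDart]
        exact (g.locally_injective d e h hl).imp (congrArg _) (congrArg _))

theorem unionImmersion_boundaryWord (i : Fin (S.m + T.m)) :
    (unionImmersion f g).boundaryWord i =
      Sum.elim f.boundaryWord g.boundaryWord (finSumFinEquiv.symm i) := by
  change (List.ofFn fun k : Fin (Sum.elim S.len T.len (finSumFinEquiv.symm i)) =>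
    Sum.elim f.label g.label (Equiv.sumSigmaDistrib (fun z => Fin (Sum.elim S.len T.len z))
      ⟨finSumFinEquiv.symm i, k⟩)) = _
  generalize finSumFinEquiv.symm i = z
  rcases z with a | a <;> rfl

theorem unionImmersion_readsPower (i : Fin (S.m + T.m)) (w : FreeGroup (Fin n)) (k : ℕ) :
    (unionImmersion f g).ReadsPower i w k ↔
      Sum.elim (fun a => f.ReadsPower a w k) (fun a => g.ReadsPower a w k)
        (finSumFinEquiv.symm i) := by
  have h := unionImmersion_boundaryWord f g i
  generalize finSumFinEquiv.symm i = z at h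
  rcases z with a | a
  · exact iff_of_eq (congrArg (fun l : List (Letter n) => 0 < k ∧
      (l ~r (w ^ k).toWord ∨ FreeGroup.invRev l ~r (w ^ k).toWord)) h)
  · exact iff_of_eq (congrArg (fun l : List (Letter n) => 0 < k ∧
      (l ~r (w ^ k).toWord ∨ FreeGroup.invRev l ~r (w ^ k).toWord)) h)

/-- The vertices of the summands map onto those of the union. An upper bound is all that the Euler
characteristic estimate needs. -/
theorem card_vertex_union_le :
    Nat.card (unionData f g).toSidePairing.Vertex ≤ Nat.card S.Vertex + Nat.card T.Vertex := by
  rw [← Nat.card_sum]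
  let F : S.Vertex ⊕ T.Vertex → (unionData f g).toSidePairing.Vertex :=
    Sum.elim
      (Quot.lift (fun s => (unionData f g).toSidePairing.vertex
          ((unionData f g).sideEquiv.symm (Sum.inl s))) (by
        rintro _ _ ⟨d, rfl, rfl⟩
        rw [← origin_inlDart f g, ← origin_inlDart f g]
        exact (unionData f g).vertex_eq_of_glue (inlDart f g d)))
      (Quot.lift (fun s => (unionData f g).toSidePairing.vertex
          ((unionData f g).sideEquiv.symm (Sum.inr s))) (by
        rintro _ _ ⟨d, rfl, rfl⟩
        rw [← origin_inrDart f g, ← origin_inrDart f g]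
        exact (unionData f g).vertex_eq_of_glue (inrDart f g d)))
  refine Nat.card_le_card_of_surjective F fun v => ?_
  obtain ⟨s, rfl⟩ := Quot.exists_rep v
  obtain ⟨z, rfl⟩ := (unionData f g).sideEquiv.symm.surjective s
  rcases z with s | s
  · exact ⟨Sum.inl (S.vertex s), rfl⟩
  · exact ⟨Sum.inr (T.vertex s), rfl⟩

theorem card_side_union :
    Fintype.card (unionData f g).toSidePairing.Side =
      Fintype.card S.Side + Fintype.card T.Side := by
  rw [← Fintype.card_sum]
  exact Fintype.card_congr (unionData f g).sideEquiv

end Union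

/-- Vertices and sides are counted additively, so one strict summand makes the union strict, and the
other may be a sphere with equality. -/
theorem RealizesDegrees.add {n r : ℕ} {u : Fin r → FreeGroup (Fin n)} {d e : Fin r → ℕ}
    (hd : RealizesDegrees u (· < ·) d) (he : RealizesDegrees u (· ≤ ·) e) :
    RealizesDegrees u (· < ·) (d + e) := by
  obtain ⟨S, f, p, c, hr, hs, hv⟩ := hd
  obtain ⟨T, g, p', c', hr', hs', hv'⟩ := he
  refine ⟨_, unionImmersion f g, fun i => Sum.elim p p' (finSumFinEquiv.symm i),
    fun i => Sum.elim c c' (finSumFinEquiv.symm i), fun i => ?_, fun j => ?_, ?_⟩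
  · have key : ∀ z, Sum.elim (fun a => f.ReadsPower a (u (Sum.elim p p' z)) (Sum.elim c c' z))
        (fun a => g.ReadsPower a (u (Sum.elim p p' z)) (Sum.elim c c' z)) z := by
      rintro (a | a)
      · exact hr a
      · exact hr' a
    exact (unionImmersion_readsPower f g i _ _).2 (key _)
  · rw [Pi.add_apply, ← hs, ← hs', Finset.sum_filter, Finset.sum_filter, Finset.sum_filter]
    refine (Equiv.sum_comp finSumFinEquiv.symm
      (fun z => if Sum.elim p p' z = j then Sum.elim c c' z else 0)).trans ?_
    rw [Fintype.sum_sum_type]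
    rfl
  · have h1 := card_vertex_union_le f g
    have h2 := card_side_union f g
    simp only at hv hv' ⊢
    omega

theorem RealizesDegrees.le {n r : ℕ} {u : Fin r → FreeGroup (Fin n)} {d : Fin r → ℕ}
    (hd : RealizesDegrees u (· < ·) d) : RealizesDegrees u (· ≤ ·) d := by
  obtain ⟨S, f, p, c, hr, hs, hv⟩ := hd
  exact ⟨S, f, p, c, hr, hs, hv.le⟩

/-! ### Cyclic words and their corners -/

theorem Letter.inv_inv {n : ℕ} (x : Letter n) : x.inv.inv = x := by
  simp [Letter.inv]

theorem Letter.inv_ne {n : ℕ} (x : Letter n) : x.inv ≠ x := fun h => by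
  simpa [Letter.inv] using congrArg Prod.snd h

theorem List.getElem_flatten_replicate {α : Type*} (W : List α) (c i : ℕ)
    (h : i < (List.replicate c W).flatten.length) (h' : i % W.length < W.length) :
    (List.replicate c W).flatten[i] = W[i % W.length] := by
  induction c generalizing i with
  | zero => simp at h
  | succ c ih =>
    simp only [List.replicate_succ, List.flatten_cons] at h ⊢
    rw [List.getElem_append]
    split_ifs with hi
    · simp only [Nat.mod_eq_of_lt hi]
    · rw [ih _ _ (Nat.mod_lt _ (by omega))]
      simp only [Nat.mod_eq_sub_mod (not_lt.1 hi)]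

theorem List.ofFn_isRotated_flatten_replicate {α : Type*} (W : List α) (hW : 0 < W.length)
    (a l c : ℕ) (hl : c * W.length = l) :
    (List.ofFn fun k : Fin l => W[(a + k) % W.length]'(Nat.mod_lt _ hW)) ~r
      (List.replicate c W).flatten := by
  refine List.IsRotated.symm ⟨a, ?_⟩
  have hlen : (List.replicate c W).flatten.length = l := by simp [hl]
  refine List.ext_getElem (by simp [hl]) fun i h1 h2 => ?_
  rw [List.getElem_rotate, List.getElem_flatten_replicate _ _ _ _ (Nat.mod_lt _ hW),
    List.getElem_ofFn]
  congr 1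
  rw [hlen, Nat.mod_mod_of_dvd _ ⟨c, by rw [mul_comm, hl]⟩, add_comm]

section Positions

variable {n r : ℕ} (u : Fin r → FreeGroup (Fin n))

/-- The positions in the words of the list, a position standing for its letter and also for the
corner before this letter. -/
abbrev Pos : Type := Σ j, Fin (u j).toWord.length

/-- The letter at a position. -/
def letterAt (c : Pos u) : Letter n := (u c.1).toWord.get c.2

/-- The next position in the cyclic order of the same word. -/
def nextPos : Equiv.Perm (Pos u) := Equiv.sigmaCongrRight fun _ => finRotate _

variable {u}

theorem nextPos_apply (j : Fin r) (k : Fin (u j).toWord.length) :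
    nextPos u ⟨j, k⟩ = ⟨j, finRotate _ k⟩ := rfl

theorem nextPos_iterate (c : Pos u) (k : ℕ) :
    (nextPos u)^[k] c = ⟨c.1, (c.2 + k) % (u c.1).toWord.length, Nat.mod_lt _ c.2.pos⟩ := by
  induction k with
  | zero => exact Sigma.ext rfl (heq_of_eq (Fin.ext (Nat.mod_eq_of_lt c.2.2).symm))
  | succ k ih =>
    rw [Function.iterate_succ_apply', ih, nextPos_apply]
    refine Sigma.ext rfl (heq_of_eq (Fin.ext ?_))
    rw [val_finRotate]
    simp [add_assoc]

/-- Reducedness handles neighbours inside a word, cyclic reducedness the passage from the last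
letter to the first. It follows that the two directions at a corner are different. -/
theorem letterAt_nextPos_ne (hcyc : ∀ j, FreeGroup.IsCyclicallyReduced (u j).toWord)
    (c : Pos u) : letterAt u (nextPos u c) ≠ (letterAt u c).inv := by
  obtain ⟨j, k⟩ := c
  have key : (letterAt u ⟨j, k⟩).1 = (letterAt u (nextPos u ⟨j, k⟩)).1 →
      (letterAt u ⟨j, k⟩).2 = (letterAt u (nextPos u ⟨j, k⟩)).2 := by
    obtain ⟨hr, he⟩ := hcyc j
    rw [nextPos_apply]
    have hv := val_finRotate k
    by_cases hk : (k : ℕ) + 1 < (u j).toWord.length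
    · rw [Nat.mod_eq_of_lt hk] at hv
      have := List.isChain_iff_getElem.1 hr k hk
      simp only [letterAt, List.get_eq_getElem, hv]
      exact this
    · have hk' : (k : ℕ) + 1 = (u j).toWord.length := by have := k.2; omega
      rw [hk', Nat.mod_self] at hv
      have hne : (u j).toWord ≠ [] := List.ne_nil_of_length_pos k.pos
      have := he _ (List.getLast?_eq_getLast_of_ne_nil hne) _
        (List.head?_eq_some_head hne)
      simp only [letterAt, List.get_eq_getElem, hv]
      rw [List.getLast_eq_getElem, List.head_eq_getElem] at this
      have hk2 : (u j).toWord.length - 1 = k := by omega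
      simpa [hk2] using this
  intro h
  rw [h] at key
  have := key rfl
  simp [Letter.inv] at this

/-- A boundary circle covering a cyclic word reads a power of it. -/
theorem GluingData.readsPower_of_covering
    (hcyc : ∀ j, FreeGroup.IsCyclicallyReduced (u j).toWord) (G : GluingData n)
    (f : G.toSidePairing.Immersion n) (pos : G.Sd → Pos u)
    (hnext : ∀ s, pos (G.next s) = nextPos u (pos s))
    (hlabel : ∀ s, f.label s = letterAt u (pos (G.sideEquiv s))) (i : Fin G.m)
    (j : Fin r) (hj : (pos (G.equiv ⟨i, ⟨0, G.len_pos i⟩⟩)).1 = j) :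
    ∃ c, f.ReadsPower i (u j) c ∧ c * (u j).toWord.length = G.len i := by
  set s₀ := G.equiv ⟨i, ⟨0, G.len_pos i⟩⟩ with hs₀
  subst hj
  have h1 : ∀ k (hk : k < G.len i), G.equiv ⟨i, ⟨k, hk⟩⟩ = G.next^[k] s₀ := by
    intro k
    induction k with
    | zero => intro hk; rfl
    | succ k ih =>
      intro hk
      rw [Function.iterate_succ_apply', ← ih (by omega), ← G.equiv_rotate]
      congr 2
      exact Fin.ext (by rw [val_finRotate, Nat.mod_eq_of_lt hk])
  have h2 : G.next^[G.len i] s₀ = s₀ := by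
    obtain ⟨L, hL⟩ : ∃ L, G.len i = L + 1 := Nat.exists_eq_succ_of_ne_zero (G.len_pos i).ne'
    rw [hL, Function.iterate_succ_apply', ← h1 L (by omega), ← G.equiv_rotate, hs₀]
    congr 2
    exact Fin.ext (by rw [val_finRotate]; simp [hL])
  have h3 : ∀ k, pos (G.next^[k] s₀) = (nextPos u)^[k] (pos s₀) := fun k =>
    (Function.Semiconj.iterate_right hnext k).eq s₀
  have hL := (pos s₀).2.pos
  -- One tour of the boundary returns to the same position of the word, so the number of sides is a
  -- multiple of the word length. The quotient is the exponent.
  have hdvd : (u (pos s₀).1).toWord.length ∣ G.len i := by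
    have h4 := h3 (G.len i)
    rw [h2, nextPos_iterate] at h4
    have h5 : (((pos s₀).2 : ℕ) + G.len i) % (u (pos s₀).1).toWord.length = (pos s₀).2 := by
      have := congrArg (fun c : Pos u => (c.2 : ℕ)) h4
      exact this.symm
    have h6 : (((pos s₀).2 : ℕ) + G.len i) ≡ (pos s₀).2 + 0
        [MOD (u (pos s₀).1).toWord.length] := by
      rw [Nat.ModEq, h5, add_zero, Nat.mod_eq_of_lt (pos s₀).2.2]
    exact (Nat.modEq_zero_iff_dvd).1 (Nat.ModEq.add_left_cancel' _ h6)
  obtain ⟨c, hc⟩ := hdvd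
  rw [mul_comm] at hc
  refine ⟨c, ⟨?_, Or.inl ?_⟩, hc.symm⟩
  · rcases Nat.eq_zero_or_pos c with rfl | h
    · have := G.len_pos i
      omega
    · exact h
  -- Powers of a cyclically reduced word are plain concatenations, without cancellation.
  · have hw : (u (pos s₀).1 ^ c).toWord =
        (List.replicate c (u (pos s₀).1).toWord).flatten := by
      rw [FreeGroup.toWord_pow, ((hcyc _).flatten_replicate c).isReduced.reduce_eq]
    rw [hw]
    convert List.ofFn_isRotated_flatten_replicate _ hL (pos s₀).2 _ _ hc.symm using 1
    refine congrArg List.ofFn (funext fun k => ?_)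
    rw [hlabel]
    have h7 : pos (G.sideEquiv ⟨i, k⟩) = (nextPos u)^[k] (pos s₀) :=
      (congrArg pos (h1 k.1 k.2)).trans (h3 k)
    rw [h7, nextPos_iterate]
    rfl

end Positions

/-! ### Doubled disks and equal degrees -/

section Disks

variable {n r : ℕ} (u : Fin r → FreeGroup (Fin n))

/-- Two disks with the same boundary word, glued along their boundary. -/
def doubleDiskData (j : Fin r) (hj : u j ≠ 1) : GluingData n where
  m := 2
  len _ := (u j).toWord.length
  len_pos _ := List.length_pos_iff.2 (mt FreeGroup.toWord_eq_nil_iff.1 hj)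
  Sd := Σ _ : Fin 2, Fin (u j).toWord.length
  equiv := Equiv.refl _
  next s := ⟨s.1, finRotate _ s.2⟩
  equiv_rotate _ _ := rfl
  pair s := ⟨s.1.rev, s.2⟩
  pair_pair s := by simp
  pair_ne s h := by
    have := congrArg (fun t : (Σ _ : Fin 2, Fin (u j).toWord.length) => t.1) h
    revert this
    simp only
    generalize s.1 = i
    revert i
    decide
  same _ := true
  same_pair _ := rfl
  label s := letterAt u ⟨j, s.2⟩
  label_pair _ := rfl

/-- The immersion of the double of a disk. -/
def doubleDiskImmersion (hcyc : ∀ j, FreeGroup.IsCyclicallyReduced (u j).toWord) (j : Fin r)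
    (hj : u j ≠ 1) : (doubleDiskData u j hj).toSidePairing.Immersion n :=
  (doubleDiskData u j hj).toImmersion (fun s => s.2)
    (by rintro ⟨s, _ | _⟩ <;> rfl)
    (by
      have hfin : ∀ i k : Fin 2, k = i ∨ k = i.rev := by decide
      have aux : ∀ (s t : Σ _ : Fin 2, Fin (u j).toWord.length) (b : Bool), s.2 = t.2 →
          ((t, b) = (s, b) ∨
            (t, b) = ((⟨s.1.rev, s.2⟩ : Σ _ : Fin 2, Fin (u j).toWord.length), b)) := by
        rintro ⟨i, k⟩ ⟨i', k'⟩ b h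
        obtain rfl : k = k' := h
        rcases hfin i i' with rfl | rfl
        · exact Or.inl rfl
        · exact Or.inr rfl
      rintro ⟨s, _ | _⟩ ⟨t, _ | _⟩ h hl
      · exact aux s t false ((finRotate _).injective h)
      · have h' : finRotate _ s.2 = t.2 := h
        have hl' : (letterAt u ⟨j, s.2⟩).inv = letterAt u ⟨j, t.2⟩ := hl
        rw [← h'] at hl'
        exact absurd hl'.symm (letterAt_nextPos_ne hcyc ⟨j, s.2⟩)
      · have h' : s.2 = finRotate _ t.2 := h
        have hl' : letterAt u ⟨j, s.2⟩ = (letterAt u ⟨j, t.2⟩).inv := hl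
        rw [h'] at hl'
        exact absurd hl' (letterAt_nextPos_ne hcyc ⟨j, t.2⟩)
      · exact aux s t true h)

/-- The double is a sphere. Each corner is identified with its copy in the other disk, whence the
weak inequality; each of the two disks contributes exponent one. -/
theorem realizesDegrees_doubleDisk (hcyc : ∀ j, FreeGroup.IsCyclicallyReduced (u j).toWord)
    (j : Fin r) (hj : u j ≠ 1) : RealizesDegrees u (· ≤ ·) (Pi.single j 2) := by
  let G := doubleDiskData u j hj
  have hlen : 0 < (u j).toWord.length :=
    List.length_pos_iff.2 (mt FreeGroup.toWord_eq_nil_iff.1 hj)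
  refine ⟨_, doubleDiskImmersion u hcyc j hj, fun _ => j, fun _ => 1, fun i => ?_, fun k => ?_, ?_⟩
  · obtain ⟨c, hc, hl⟩ := G.readsPower_of_covering hcyc (doubleDiskImmersion u hcyc j hj)
      (fun s => ⟨j, s.2⟩) (fun _ => rfl) (fun _ => rfl) i j rfl
    obtain rfl : c = 1 := Nat.eq_of_mul_eq_mul_right hlen (hl.trans (one_mul _).symm)
    exact hc
  · have : (Finset.univ : Finset (Fin G.toSidePairing.m)).card = 2 := Finset.card_fin 2
    by_cases h : j = k
    · subst h
      rw [Finset.filter_true_of_mem fun _ _ => rfl, Finset.sum_const, this]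
      simp
    · rw [Finset.filter_false_of_mem fun _ _ => h]
      simp [Ne.symm h]
  · refine SidePairing.two_mul_card_vertex_le _ fun p =>
      ⟨G.toSidePairing.pair p, G.toSidePairing.pair_ne p, ?_⟩
    exact (Quot.sound ⟨(p, true), rfl, rfl⟩ : G.toSidePairing.vertex p = _).symm

/-- Doubled disks raise degrees only by even amounts, so the given surface is taken twice: 2 deg j +
2 (D - deg j) = 2 D, where D is the sum of all degrees. -/
theorem IsPolygonal.exists_equal_degrees
    (hnontriv : ∀ j, u j ≠ 1) (hcyc : ∀ j, FreeGroup.IsCyclicallyReduced (u j).toWord)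
    (h : IsPolygonal u) :
    ∃ (S : PolygonalSurface u) (Q : S.WordPartition) (d : ℕ),
      0 < d ∧ ∀ j, Q.positiveDegree j = d := by
  obtain ⟨S⟩ := h
  choose part exponent hreads using S.reads
  let deg : Fin r → ℕ := fun j => ∑ i with part i = j, exponent i
  have hS : RealizesDegrees u (· < ·) deg :=
    ⟨S.surface, S.immersion, part, exponent, hreads, fun _ => rfl,
      S.surface.eulerChar_lt_iff.1 S.eulerChar_lt⟩
  -- Without disks there are no sides and the strict inequality fails. One disk makes D positive.
  have hm : 0 < S.surface.m := by
    by_contra h0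
    have h1 := S.surface.eulerChar_lt_iff.1 S.eulerChar_lt
    have : IsEmpty S.surface.Side := ⟨fun s => by have := s.1.2; omega⟩
    rw [Fintype.card_eq_zero] at h1
    omega
  have hadd : ∀ k : Fin r → ℕ, ∀ d, RealizesDegrees u (· < ·) d →
      RealizesDegrees u (· < ·) (d + 2 • k) := by
    intro k
    induction k using Pi.single_induction with
    | zero => intro d hd; simpa using hd
    | add f g hf hg => intro d hd; rw [smul_add, ← add_assoc]; exact hg _ (hf _ hd)
    | single j m =>
      intro d hd
      induction m with
      | zero => simpa using hd
      | succ m ih =>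
        have := ih.add (realizesDegrees_doubleDisk u hcyc j (hnontriv j))
        convert this using 1
        rw [add_assoc]
        congr 1
        ext i
        by_cases hi : i = j
        · subst hi; simp; ring
        · simp [hi]
  let D := ∑ j, deg j
  have hD : ∀ j, deg j ≤ D := fun j =>
    Finset.single_le_sum (f := deg) (fun _ _ => Nat.zero_le _) (Finset.mem_univ j)
  obtain ⟨T, f, p, c, hr, hs, hv⟩ := hadd (fun j => D - deg j) _ (hS.add hS.le)
  refine ⟨⟨T, f, fun i => ⟨_, _, hr i⟩, T.eulerChar_lt_iff.2 hv⟩, ⟨p, c, hr⟩, 2 * D, ?_,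
    fun j => ?_⟩
  · have h1 : exponent ⟨0, hm⟩ ≤ deg (part ⟨0, hm⟩) :=
      Finset.single_le_sum (f := exponent) (fun _ _ => Nat.zero_le _) (by simp)
    have h2 := (hreads ⟨0, hm⟩).1
    have h3 := hD (part ⟨0, hm⟩)
    omega
  · refine (hs j).trans ?_
    have := hD j
    simp only [Pi.add_apply, Pi.smul_apply, smul_eq_mul]
    omega

end Disks

/-! ### Surfaces built from the links of their vertices -/

section CycleSystems

variable {n r : ℕ} {u : Fin r → FreeGroup (Fin n)}

/-- The corner before the position `c` is incident with the direction `d`: one of the two directed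
edges issuing from it along the word has the letter `d`. -/
def Inc (c : Pos u) (d : Letter n) : Prop :=
  letterAt u c = d ∨ letterAt u ((nextPos u).symm c) = d.inv

theorem inc_letterAt (c : Pos u) : Inc c (letterAt u c) := Or.inl rfl

theorem inc_nextPos (c : Pos u) : Inc (nextPos u c) (letterAt u c).inv :=
  Or.inr (by rw [Equiv.symm_apply_apply, Letter.inv_inv])

/-- The links of the vertices of a surface: `H i` is the set of corners around the vertex `i`, and
`Θ d i` is the other end of the edge issuing from `i` in the direction `d`. -/
structure CycleSystem (u : Fin r → FreeGroup (Fin n)) where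
  ι : Type
  finite : Finite ι
  H : ι → Set (Pos u)
  Θ : Letter n → Equiv.Perm ι
  Θ_inv : ∀ d i, Θ d.inv (Θ d i) = i
  mem_iff : ∀ i c, c ∈ H i ↔ nextPos u c ∈ H (Θ (letterAt u c) i)
  mate : ι → Letter n → Pos u → Pos u
  mate_mem : ∀ {i d c}, c ∈ H i → Inc c d → mate i d c ∈ H i
  mate_inc : ∀ {i d c}, c ∈ H i → Inc c d → Inc (mate i d c) d
  mate_ne : ∀ {i d c}, c ∈ H i → Inc c d → mate i d c ≠ c
  mate_unique : ∀ {i d c c'}, c ∈ H i → Inc c d → c' ∈ H i → Inc c' d → c' ≠ c → c' = mate i d c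

namespace CycleSystem

variable (C : CycleSystem u)

/-- The sides of the disks: pairs of a vertex and a corner around it. -/
abbrev Sd : Type := {s : C.ι × Pos u // s.2 ∈ C.H s.1}

variable {C}

theorem mate_mate {i : C.ι} {d : Letter n} {c : Pos u} (h : c ∈ C.H i) (hd : Inc c d) :
    C.mate i d (C.mate i d c) = c :=
  (C.mate_unique (C.mate_mem h hd) (C.mate_inc h hd) h hd (C.mate_ne h hd).symm).symm

theorem prev_mem {i : C.ι} {d : Letter n} {c : Pos u} (h : c ∈ C.H i)
    (hd : letterAt u ((nextPos u).symm c) = d.inv) : (nextPos u).symm c ∈ C.H (C.Θ d i) := by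
  rw [C.mem_iff, hd, C.Θ_inv, Equiv.apply_symm_apply]
  exact h

theorem Θ_inv' (d : Letter n) (i : C.ι) : C.Θ d (C.Θ d.inv i) = i := by
  have := C.Θ_inv d.inv i
  rwa [Letter.inv_inv] at this

variable (C)

/-- The next side of the same disk. -/
def next : Equiv.Perm C.Sd where
  toFun s := ⟨(C.Θ (letterAt u s.1.2) s.1.1, nextPos u s.1.2), (C.mem_iff _ _).1 s.2⟩
  invFun s := ⟨(C.Θ (letterAt u ((nextPos u).symm s.1.2)).inv s.1.1, (nextPos u).symm s.1.2),
    prev_mem s.2 (Letter.inv_inv _).symm⟩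
  left_inv s := Subtype.ext (Prod.ext
    (by simp only [Equiv.symm_apply_apply]; exact C.Θ_inv _ _) (by simp))
  right_inv s := Subtype.ext (Prod.ext (Θ_inv' _ _) (by simp))

/-- The corner opposite to a side across the beginning of its edge. -/
def opp (s : C.Sd) : Pos u := C.mate s.1.1 (letterAt u s.1.2) s.1.2

theorem opp_mem (s : C.Sd) : C.opp s ∈ C.H s.1.1 := C.mate_mem s.2 (inc_letterAt _)

theorem opp_inc (s : C.Sd) : Inc (C.opp s) (letterAt u s.1.2) := C.mate_inc s.2 (inc_letterAt _)

theorem opp_ne (s : C.Sd) : C.opp s ≠ s.1.2 := C.mate_ne s.2 (inc_letterAt _)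

open Classical in
/-- The side glued to a side. -/
def pair (s : C.Sd) : C.Sd :=
  if h : letterAt u (C.opp s) = letterAt u s.1.2 then ⟨(s.1.1, C.opp s), C.opp_mem s⟩
  else ⟨(C.Θ (letterAt u s.1.2) s.1.1, (nextPos u).symm (C.opp s)),
    prev_mem (C.opp_mem s) ((C.opp_inc s).resolve_left h)⟩

open Classical in
/-- Whether a side is glued in the same direction. -/
def same (s : C.Sd) : Bool := decide (letterAt u (C.opp s) = letterAt u s.1.2)

theorem pair_of_same {s : C.Sd} (h : letterAt u (C.opp s) = letterAt u s.1.2) :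
    C.pair s = ⟨(s.1.1, C.opp s), C.opp_mem s⟩ := dif_pos h

theorem pair_of_not_same {s : C.Sd} (h : letterAt u (C.opp s) ≠ letterAt u s.1.2) :
    C.pair s = ⟨(C.Θ (letterAt u s.1.2) s.1.1, (nextPos u).symm (C.opp s)),
      prev_mem (C.opp_mem s) ((C.opp_inc s).resolve_left h)⟩ := dif_neg h

theorem letterAt_prev_opp {s : C.Sd} (h : letterAt u (C.opp s) ≠ letterAt u s.1.2) :
    letterAt u ((nextPos u).symm (C.opp s)) = (letterAt u s.1.2).inv :=
  (C.opp_inc s).resolve_left h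

theorem opp_pair_of_same {s : C.Sd} (h : letterAt u (C.opp s) = letterAt u s.1.2) :
    C.opp (C.pair s) = s.1.2 := by
  rw [C.pair_of_same h, opp]
  simp only
  rw [h]
  exact mate_mate s.2 (inc_letterAt _)

/-- At the far end of the edge, the two corners adjacent to it are the one after `s` and the one
where the paired side starts. They differ because consecutive letters are not inverse, so they are
mates. -/
theorem opp_pair_of_not_same (hcyc : ∀ j, FreeGroup.IsCyclicallyReduced (u j).toWord) {s : C.Sd}
    (h : letterAt u (C.opp s) ≠ letterAt u s.1.2) :
    C.opp (C.pair s) = nextPos u s.1.2 := by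
  rw [C.pair_of_not_same h, opp]
  have hl := C.letterAt_prev_opp h
  simp only
  rw [hl]
  refine (C.mate_unique (prev_mem (C.opp_mem s) hl) (Or.inl hl) ((C.mem_iff _ _).1 s.2)
    (inc_nextPos _) ?_).symm
  intro h2
  rw [← h2] at hl
  exact letterAt_nextPos_ne hcyc _ hl

theorem letterAt_pair (s : C.Sd) : letterAt u (C.pair s).1.2 =
    if C.same s then letterAt u s.1.2 else (letterAt u s.1.2).inv := by
  by_cases h : letterAt u (C.opp s) = letterAt u s.1.2
  · rw [C.pair_of_same h, same]
    simp [h]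
  · rw [C.pair_of_not_same h, same]
    simpa [h] using C.letterAt_prev_opp h

theorem pair_ne (s : C.Sd) : C.pair s ≠ s := by
  intro h2
  by_cases h : letterAt u (C.opp s) = letterAt u s.1.2
  · rw [C.pair_of_same h] at h2
    exact C.opp_ne s (congrArg (fun t : C.Sd => t.1.2) h2)
  · have := C.letterAt_pair s
    rw [h2, same] at this
    simp only [h, decide_false, Bool.false_eq_true, if_false] at this
    exact Letter.inv_ne _ this.symm

theorem same_pair (hcyc : ∀ j, FreeGroup.IsCyclicallyReduced (u j).toWord) (s : C.Sd) :
    C.same (C.pair s) = C.same s := by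
  by_cases h : letterAt u (C.opp s) = letterAt u s.1.2
  · rw [same, C.opp_pair_of_same h, C.pair_of_same h, same]
    simp [h]
  · rw [same, C.opp_pair_of_not_same hcyc h, C.pair_of_not_same h, same]
    simp only [h, decide_false, C.letterAt_prev_opp h, decide_eq_false_iff_not]
    exact letterAt_nextPos_ne hcyc _

theorem pair_pair (hcyc : ∀ j, FreeGroup.IsCyclicallyReduced (u j).toWord) (s : C.Sd) :
    C.pair (C.pair s) = s := by
  have hs := C.same_pair hcyc s
  by_cases h : letterAt u (C.opp s) = letterAt u s.1.2
  · have h' : letterAt u (C.opp (C.pair s)) = letterAt u (C.pair s).1.2 := by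
      simpa [same, h] using hs
    rw [C.pair_of_same h']
    refine Subtype.ext (Prod.ext ?_ (C.opp_pair_of_same h))
    rw [C.pair_of_same h]
  · have h' : letterAt u (C.opp (C.pair s)) ≠ letterAt u (C.pair s).1.2 := by
      simpa [same, h] using hs
    have e1 : (C.pair s).1.1 = C.Θ (letterAt u s.1.2) s.1.1 := by rw [C.pair_of_not_same h]
    have e2 : (C.pair s).1.2 = (nextPos u).symm (C.opp s) := by rw [C.pair_of_not_same h]
    rw [C.pair_of_not_same h']
    refine Subtype.ext (Prod.ext ?_ ?_)
    · change C.Θ (letterAt u (C.pair s).1.2) (C.pair s).1.1 = _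
      rw [e1, e2, C.letterAt_prev_opp h]
      exact C.Θ_inv _ _
    · change (nextPos u).symm (C.opp (C.pair s)) = _
      rw [C.opp_pair_of_not_same hcyc h, Equiv.symm_apply_apply]

/-- The gluing data of the surface of a cycle system, from a decomposition into polygons. -/
def toGluingData (hcyc : ∀ j, FreeGroup.IsCyclicallyReduced (u j).toWord) {m : ℕ}
    {len : Fin m → ℕ} (φ : (Σ i, Fin (len i)) ≃ C.Sd) (hlen : ∀ i, 0 < len i)
    (hφ : ∀ i k, φ ⟨i, finRotate _ k⟩ = C.next (φ ⟨i, k⟩)) : GluingData n where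
  m := m
  len := len
  len_pos := hlen
  Sd := C.Sd
  equiv := φ
  next := C.next
  equiv_rotate := hφ
  pair := C.pair
  pair_pair := C.pair_pair hcyc
  pair_ne := C.pair_ne
  same := C.same
  same_pair := C.same_pair hcyc
  label s := letterAt u s.1.2
  label_pair := C.letterAt_pair

section

variable (hcyc : ∀ j, FreeGroup.IsCyclicallyReduced (u j).toWord) {m : ℕ}
    {len : Fin m → ℕ} (φ : (Σ i, Fin (len i)) ≃ C.Sd) (hlen : ∀ i, 0 < len i)
    (hφ : ∀ i k, φ ⟨i, finRotate _ k⟩ = C.next (φ ⟨i, k⟩))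

theorem outLabel_inc (d : C.Sd × Bool) :
    Inc ((C.toGluingData hcyc φ hlen hφ).origin d).1.2
      ((C.toGluingData hcyc φ hlen hφ).outLabel d) := by
  rcases d with ⟨s, _ | _⟩
  · exact inc_nextPos _
  · exact inc_letterAt _

/-- The two directed sides issuing from a corner carry different letters, by cyclic reducedness. -/
theorem eq_of_origin_outLabel_eq {d e : C.Sd × Bool}
    (h : (C.toGluingData hcyc φ hlen hφ).origin d = (C.toGluingData hcyc φ hlen hφ).origin e)
    (hl : (C.toGluingData hcyc φ hlen hφ).outLabel d =
      (C.toGluingData hcyc φ hlen hφ).outLabel e) : d = e := by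
  rcases d with ⟨s, _ | _⟩ <;> rcases e with ⟨t, _ | _⟩
  · exact Prod.ext (C.next.injective h) rfl
  · have h' : C.next s = t := h
    have hl' : (letterAt u s.1.2).inv = letterAt u t.1.2 := hl
    rw [← h'] at hl'
    exact absurd hl'.symm (letterAt_nextPos_ne hcyc _)
  · have h' : s = C.next t := h
    have hl' : letterAt u s.1.2 = (letterAt u t.1.2).inv := hl
    rw [h'] at hl'
    exact absurd hl' (letterAt_nextPos_ne hcyc _)
  · exact Prod.ext h rfl

theorem outLabel_glue (d : C.Sd × Bool) :
    (C.toGluingData hcyc φ hlen hφ).outLabel ((C.toGluingData hcyc φ hlen hφ).glue d) =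
      (C.toGluingData hcyc φ hlen hφ).outLabel d := by
  rcases d with ⟨s, b⟩
  have h := C.letterAt_pair s
  change (if b == C.same s then letterAt u (C.pair s).1.2 else (letterAt u (C.pair s).1.2).inv) =
    if b then letterAt u s.1.2 else (letterAt u s.1.2).inv
  rw [h]
  cases b <;> cases C.same s <;> simp [Letter.inv_inv]

/-- Gluing fixes the index of the link and passes to the mate in the direction of the edge. Local
injectivity and the identification of corners to vertices both rest on this formula. -/
theorem origin_glue (d : C.Sd × Bool) :
    ((C.toGluingData hcyc φ hlen hφ).origin ((C.toGluingData hcyc φ hlen hφ).glue d)).1 =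
      (((C.toGluingData hcyc φ hlen hφ).origin d).1.1,
        C.mate ((C.toGluingData hcyc φ hlen hφ).origin d).1.1
          ((C.toGluingData hcyc φ hlen hφ).outLabel d)
          ((C.toGluingData hcyc φ hlen hφ).origin d).1.2) := by
  rcases d with ⟨s, b⟩
  let orig : C.Sd × Bool → C.Sd := fun d => if d.2 then d.1 else C.next d.1
  change (orig (C.pair s, b == C.same s)).1 = ((orig (s, b)).1.1,
    C.mate (orig (s, b)).1.1 (if b then letterAt u s.1.2 else (letterAt u s.1.2).inv)
      (orig (s, b)).1.2)
  have next_mate : ∀ {c' : Pos u}, c' ∈ C.H (C.next s).1.1 → Inc c' (letterAt u s.1.2).inv →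
      c' ≠ (C.next s).1.2 →
      c' = C.mate (C.next s).1.1 (letterAt u s.1.2).inv (C.next s).1.2 :=
    fun h1 h2 h3 => C.mate_unique (C.next s).2 (inc_nextPos _) h1 h2 h3
  by_cases h : letterAt u (C.opp s) = letterAt u s.1.2
  · have hs : C.same s = true := by simp [same, h]
    rw [hs]
    cases b
    · change (C.next (C.pair s)).1 = ((C.next s).1.1, C.mate (C.next s).1.1
        (letterAt u s.1.2).inv (C.next s).1.2)
      rw [C.pair_of_same h]
      refine Prod.ext ?_ (next_mate ?_ ?_ ?_)
      · change C.Θ (letterAt u (C.opp s)) _ = _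
        rw [h]
        rfl
      · change nextPos u (C.opp s) ∈ C.H (C.Θ _ _)
        rw [← h, ← C.mem_iff]
        exact C.opp_mem s
      · change Inc (nextPos u (C.opp s)) _
        rw [← h]
        exact inc_nextPos _
      · exact fun h2 => C.opp_ne s ((nextPos u).injective h2)
    · change (C.pair s).1 = _
      rw [C.pair_of_same h]
      rfl
  · have hs : C.same s = false := by simp [same, h]
    have hl := C.letterAt_prev_opp h
    rw [hs]
    cases b
    · change (C.pair s).1 = ((C.next s).1.1, C.mate (C.next s).1.1
        (letterAt u s.1.2).inv (C.next s).1.2)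
      rw [C.pair_of_not_same h]
      refine Prod.ext rfl (next_mate (prev_mem (C.opp_mem s) hl) (Or.inl hl) fun h2 => ?_)
      have h3 : (nextPos u).symm (C.opp s) = nextPos u s.1.2 := h2
      rw [h3] at hl
      exact letterAt_nextPos_ne hcyc _ hl
    · change (C.next (C.pair s)).1 = _
      rw [C.pair_of_not_same h]
      refine Prod.ext ?_ ((nextPos u).apply_symm_apply _)
      change C.Θ (letterAt u ((nextPos u).symm (C.opp s))) (C.Θ (letterAt u s.1.2) s.1.1) = s.1.1
      rw [hl]
      exact C.Θ_inv _ _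

/-- The immersion of the surface of a cycle system. -/
def toImmersion : (C.toGluingData hcyc φ hlen hφ).toSidePairing.Immersion n :=
  (C.toGluingData hcyc φ hlen hφ).toImmersion (fun s => s.1.1)
    (fun d => (congrArg Prod.fst (C.origin_glue hcyc φ hlen hφ d)).symm)
    (fun d e h hl => by
      -- Equal corners give the same directed side. Different corners at the same index and
      -- direction are mates, so their directed sides are glued.
      by_cases hde : ((C.toGluingData hcyc φ hlen hφ).origin e).1.2 =
          ((C.toGluingData hcyc φ hlen hφ).origin d).1.2
      · left
        exact C.eq_of_origin_outLabel_eq hcyc φ hlen hφ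
          (Subtype.ext (Prod.ext h.symm hde)) hl.symm
      · right
        refine C.eq_of_origin_outLabel_eq hcyc φ hlen hφ (Subtype.ext ?_)
          (hl.symm.trans (C.outLabel_glue hcyc φ hlen hφ d).symm)
        refine Eq.trans ?_ (C.origin_glue hcyc φ hlen hφ d).symm
        refine Prod.ext h.symm (C.mate_unique ((C.toGluingData hcyc φ hlen hφ).origin d).2
          (C.outLabel_inc hcyc φ hlen hφ d) ?_ ?_ hde)
        · exact (congrArg (fun i => _ ∈ C.H i) h).mpr
            ((C.toGluingData hcyc φ hlen hφ).origin e).2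
        · exact (congrArg (Inc _) hl).mpr (C.outLabel_inc hcyc φ hlen hφ e))

/-- Each direction at a corner is that of a directed side issuing from it, and the side glued to it
issues from the mate. -/
theorem vertex_mate (s : C.Sd) {d : Letter n} (hd : Inc s.1.2 d) :
    (C.toGluingData hcyc φ hlen hφ).toSidePairing.vertex
      ((C.toGluingData hcyc φ hlen hφ).sideEquiv.symm s) =
    (C.toGluingData hcyc φ hlen hφ).toSidePairing.vertex
      ((C.toGluingData hcyc φ hlen hφ).sideEquiv.symm
        ⟨(s.1.1, C.mate s.1.1 d s.1.2), C.mate_mem s.2 hd⟩) := by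
  set G := C.toGluingData hcyc φ hlen hφ
  obtain ⟨e, he, hl⟩ : ∃ e : G.Sd × Bool, G.origin e = s ∧ G.outLabel e = d := by
    rcases hd with hd | hd
    · exact ⟨(s, true), rfl, hd⟩
    · refine ⟨(C.next.symm s, false), C.next.apply_symm_apply s, ?_⟩
      change (letterAt u ((nextPos u).symm s.1.2)).inv = d
      rw [hd, Letter.inv_inv]
  have h := G.vertex_eq_of_glue e
  have h2 := C.origin_glue hcyc φ hlen hφ e
  subst hl
  subst he
  rw [show G.origin (G.glue e) = ⟨_, _⟩ from Subtype.ext h2] at h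
  exact h

end

/-- Every corner has a mate different from itself, so each vertex has at least two corners;
different mates in two directions give a vertex with three. -/
theorem isPolygonal (hcyc : ∀ j, FreeGroup.IsCyclicallyReduced (u j).toWord)
    (hlong : ∃ i c d e, c ∈ C.H i ∧ Inc c d ∧ Inc c e ∧ C.mate i d c ≠ C.mate i e c) :
    IsPolygonal u := by
  have := C.finite
  obtain ⟨m, len, φ, hlen, hφ⟩ := C.next.exists_polygon_decomposition
  set G := C.toGluingData hcyc φ hlen hφ with hG
  refine ⟨⟨G.toSidePairing, C.toImmersion hcyc φ hlen hφ, fun i => ?_, ?_⟩⟩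
  · obtain ⟨c, hc, -⟩ := G.readsPower_of_covering hcyc (C.toImmersion hcyc φ hlen hφ)
      (fun s => s.1.2) (fun _ => rfl) (fun _ => rfl) i _ rfl
    exact ⟨_, c, hc⟩
  · rw [SidePairing.eulerChar_lt_iff]
    refine SidePairing.two_mul_card_vertex_lt _ (fun p => ?_) ?_
    · have h := C.vertex_mate hcyc φ hlen hφ (G.sideEquiv p) (inc_letterAt _)
      refine ⟨_, ?_, h.symm.trans (by rw [Equiv.symm_apply_apply])⟩
      intro h2
      have h3 := (Equiv.symm_apply_eq _).1 h2
      exact C.mate_ne (G.sideEquiv p).2 (inc_letterAt _)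
        (congrArg (fun t : C.Sd => t.1.2) h3)
    · obtain ⟨i, c, d, e, hc, hd, he, hne⟩ := hlong
      refine ⟨G.sideEquiv.symm ⟨(i, c), hc⟩,
        G.sideEquiv.symm ⟨(i, C.mate i d c), C.mate_mem hc hd⟩,
        G.sideEquiv.symm ⟨(i, C.mate i e c), C.mate_mem hc he⟩, ?_, ?_, ?_,
        (C.vertex_mate hcyc φ hlen hφ ⟨(i, c), hc⟩ hd).symm,
        (C.vertex_mate hcyc φ hlen hφ ⟨(i, c), hc⟩ he).symm⟩
      · intro h
        exact C.mate_ne hc hd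
          (congrArg (fun t : C.Sd => t.1.2) (G.sideEquiv.symm.injective h)).symm
      · intro h
        exact C.mate_ne hc he
          (congrArg (fun t : C.Sd => t.1.2) (G.sideEquiv.symm.injective h)).symm
      · intro h
        exact hne (congrArg (fun t : C.Sd => t.1.2) (G.sideEquiv.symm.injective h))

end CycleSystem

end CycleSystems

/-! ### Gluing weighted families of cycles -/

theorem Equiv.Perm.exists_comp_eq_of_card_fiber_eq {ι β : Type*} [Finite ι] (f g : ι → β)
    (h : ∀ b, Nat.card {i // f i = b} = Nat.card {i // g i = b}) :
    ∃ σ : Equiv.Perm ι, ∀ i, g (σ i) = f i := by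
  have e : ∀ b, {i // f i = b} ≃ {i // g i = b} := fun b => (Finite.card_eq.1 (h b)).some
  refine ⟨(Equiv.sigmaFiberEquiv f).symm.trans
    ((Equiv.sigmaCongrRight e).trans (Equiv.sigmaFiberEquiv g)), fun i => ?_⟩
  exact (e (f i) ⟨i, rfl⟩).2

section WeightedCycles

variable {n r : ℕ} {u : Fin r → FreeGroup (Fin n)}

open Classical in
/-- The corner at the other end of the edge issuing from the corner `c` in the direction `d`. -/
def across (d : Letter n) (c : Pos u) : Pos u :=
  if letterAt u c = d then nextPos u c else (nextPos u).symm c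

theorem inc_across {d : Letter n} {c : Pos u} (h : Inc c d) : Inc (across d c) d.inv := by
  unfold across
  split_ifs with h1
  · rw [← h1]
    exact inc_nextPos c
  · exact Or.inl (h.resolve_left h1)

theorem across_letterAt (c : Pos u) : across (letterAt u c) c = nextPos u c := if_pos rfl

theorem across_across (hcyc : ∀ j, FreeGroup.IsCyclicallyReduced (u j).toWord) {d : Letter n}
    {c : Pos u} (h : Inc c d) : across d.inv (across d c) = c := by
  by_cases h1 : letterAt u c = d
  · rw [across, across, if_pos h1, if_neg, Equiv.symm_apply_apply]
    rw [← h1]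
    exact letterAt_nextPos_ne hcyc c
  · rw [across, across, if_neg h1, if_pos (h.resolve_left h1), Equiv.apply_symm_apply]

theorem across_across' (hcyc : ∀ j, FreeGroup.IsCyclicallyReduced (u j).toWord) {d : Letter n}
    {c : Pos u} (h : Inc c d.inv) : across d (across d.inv c) = c := by
  have := across_across hcyc h
  rwa [Letter.inv_inv] at this

/-- A set of corners which is empty or has two elements at every direction. -/
def IsCycleSet (H : Set (Pos u)) : Prop :=
  ∀ d, ∀ c ∈ H, Inc c d → ∃! c', c' ∈ H ∧ Inc c' d ∧ c' ≠ c

theorem IsCycleSet.setOf_inc_eq {H : Set (Pos u)} (hH : IsCycleSet H) {d : Letter n} {c c' : Pos u}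
    (hc : c ∈ H) (hc' : c' ∈ H) (hd : Inc c d) (hd' : Inc c' d) (hne : c ≠ c') :
    {x | x ∈ H ∧ Inc x d} = {c, c'} := by
  ext x
  simp only [Set.mem_ofPred_eq, Set.mem_insert_iff, Set.mem_singleton_iff]
  constructor
  · rintro ⟨h1, h2⟩
    by_cases h3 : x = c
    · exact Or.inl h3
    · exact Or.inr ((hH d c hc hd).unique ⟨h1, h2, h3⟩ ⟨hc', hd', hne.symm⟩)
  · rintro (rfl | rfl)
    exacts [⟨hc, hd⟩, ⟨hc', hd'⟩]

/-- The set `H i` may be joined along d to `H j` when `across d` carries the corners of `H i` at d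
onto those of `H j` at the inverse direction. These traces are empty or pairs, so equal numbers for
each pair give a permutation. -/
theorem exists_across_perm (hcyc : ∀ j, FreeGroup.IsCyclicallyReduced (u j).toWord)
    {ι : Type} [Finite ι] (H : ι → Set (Pos u)) (hH : ∀ i, IsCycleSet (H i)) (d : Letter n)
    (hbal : ∀ c c', c ≠ c' → Inc c d → Inc c' d →
      Nat.card {i // c ∈ H i ∧ c' ∈ H i} =
        Nat.card {i // across d c ∈ H i ∧ across d c' ∈ H i}) :
    ∃ σ : Equiv.Perm ι, ∀ i c, Inc c d → (c ∈ H i ↔ across d c ∈ H (σ i)) := by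
  classical
  let f : ι → Set (Pos u) := fun i => {c | c ∈ H i ∧ Inc c d}
  let g : ι → Set (Pos u) := fun i => {c | across d c ∈ H i ∧ Inc c d}
  have hf : ∀ T, T ≠ ∅ → Nat.card {i // f i = T} = Nat.card {i // g i = T} := by
    intro T hT
    by_cases hex : ∃ c c', c ≠ c' ∧ Inc c d ∧ Inc c' d ∧ T = {c, c'}
    · obtain ⟨c, c', hne, hc, hc', rfl⟩ := hex
      refine Eq.trans ?_ ((hbal c c' hne hc hc').trans ?_)
      · refine Nat.card_congr (Equiv.subtypeEquivRight fun i => ?_)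
        constructor
        · intro h
          have h1 : c ∈ f i := h ▸ Or.inl rfl
          have h2 : c' ∈ f i := h ▸ Or.inr rfl
          exact ⟨h1.1, h2.1⟩
        · rintro ⟨h1, h2⟩
          exact (hH i).setOf_inc_eq h1 h2 hc hc' hne
      · refine Nat.card_congr (Equiv.subtypeEquivRight fun i => ?_)
        constructor
        · rintro ⟨h1, h2⟩
          have hne' : across d c ≠ across d c' := fun h => hne (by
            rw [← across_across hcyc hc, h, across_across hcyc hc'])
          have h3 := (hH i).setOf_inc_eq h1 h2 (inc_across hc) (inc_across hc') hne'
          ext x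
          constructor
          · rintro ⟨hx, hxd⟩
            have : across d x ∈ ({across d c, across d c'} : Set (Pos u)) :=
              h3 ▸ ⟨hx, inc_across hxd⟩
            rcases this with h | h
            · exact Or.inl (by rw [← across_across hcyc hxd, h, across_across hcyc hc])
            · exact Or.inr (by
                rw [← across_across hcyc hxd, Set.mem_singleton_iff.1 h, across_across hcyc hc']
                rfl)
          · rintro (rfl | rfl)
            exacts [⟨h1, hc⟩, ⟨h2, hc'⟩]
        · intro h
          have h1 : c ∈ g i := h ▸ Or.inl rfl
          have h2 : c' ∈ g i := h ▸ Or.inr rfl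
          exact ⟨h1.1, h2.1⟩
    -- A nonempty trace consists of two different corners at d, so any other nonempty set has empty
    -- fibres on both sides.
    · have hf0 : IsEmpty {i // f i = T} := ⟨fun ⟨i, hi⟩ => hex (by
        obtain ⟨c, hc⟩ := Set.nonempty_iff_ne_empty.2 hT
        rw [← hi] at hc
        obtain ⟨c', ⟨h1, h2, h3⟩, -⟩ := hH i d c hc.1 hc.2
        exact ⟨c, c', h3.symm, hc.2, h2,
          hi.symm.trans ((hH i).setOf_inc_eq hc.1 h1 hc.2 h2 h3.symm)⟩)⟩
      have hg0 : IsEmpty {i // g i = T} := ⟨fun ⟨i, hi⟩ => hex (by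
        obtain ⟨c, hc⟩ := Set.nonempty_iff_ne_empty.2 hT
        rw [← hi] at hc
        obtain ⟨c', ⟨h1, h2, h3⟩, h4⟩ := hH i d.inv (across d c) hc.1 (inc_across hc.2)
        have h5 : Inc (across d.inv c') d := by
          have := inc_across h2
          rwa [Letter.inv_inv] at this
        have h6 := across_across' hcyc h2
        refine ⟨c, across d.inv c', ?_, hc.2, h5, hi.symm.trans ?_⟩
        · rintro h
          rw [h, h6] at h3
          exact h3 rfl
        · ext x
          constructor
          · rintro ⟨hx, hxd⟩
            by_cases hxc : x = c
            · exact Or.inl hxc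
            · right
              have := h4 (across d x) ⟨hx, inc_across hxd, fun h => hxc (by
                rw [← across_across hcyc hxd, h, across_across hcyc hc.2])⟩
              rw [Set.mem_singleton_iff, ← this, across_across hcyc hxd]
          · rintro (rfl | rfl)
            exacts [hc, ⟨h6.symm ▸ h1, h5⟩])⟩
      rw [Nat.card_of_isEmpty, Nat.card_of_isEmpty]
  -- This serves the empty trace: its two fibres are complements of sets of equal size.
  have hsum : ∀ F : ι → Set (Pos u), ∑ T, Nat.card {i // F i = T} = Nat.card ι := fun F => by
    rw [← Nat.card_sigma]
    exact Nat.card_congr (Equiv.sigmaFiberEquiv F)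
  obtain ⟨σ, hσ⟩ := Equiv.Perm.exists_comp_eq_of_card_fiber_eq f g fun T => by
    by_cases hT : T = ∅
    · subst hT
      have h := (hsum f).trans (hsum g).symm
      rw [← Finset.add_sum_erase _ _ (Finset.mem_univ ∅),
        ← Finset.add_sum_erase _ _ (Finset.mem_univ (∅ : Set (Pos u))),
        Finset.sum_congr rfl fun T hT => hf T (Finset.ne_of_mem_erase hT)] at h
      exact Nat.add_right_cancel h
    · exact hf T hT
  refine ⟨σ, fun i c hc => ?_⟩
  have h := Set.ext_iff.1 (hσ i) c
  simp only [f, g, Set.mem_ofPred_eq, hc, and_true] at h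
  exact h.symm

/-- Balance in the positive directions suffices, since the permutation for an inverse letter can be
taken to be the inverse permutation. -/
theorem isPolygonal_of_cycleSets (hcyc : ∀ j, FreeGroup.IsCyclicallyReduced (u j).toWord)
    {ι : Type} [Finite ι] (H : ι → Set (Pos u)) (hH : ∀ i, IsCycleSet (H i))
    (hbal : ∀ g c c', c ≠ c' → Inc c (g, true) → Inc c' (g, true) →
      Nat.card {i // c ∈ H i ∧ c' ∈ H i} =
        Nat.card {i // across (g, true) c ∈ H i ∧ across (g, true) c' ∈ H i})
    (hlong : ∃ i c c₁ c₂ d₁ d₂, c ∈ H i ∧ c₁ ∈ H i ∧ c₂ ∈ H i ∧ Inc c d₁ ∧ Inc c₁ d₁ ∧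
      Inc c d₂ ∧ Inc c₂ d₂ ∧ c₁ ≠ c ∧ c₂ ≠ c ∧ c₁ ≠ c₂) : IsPolygonal u := by
  classical
  choose σ hσ using fun g => exists_across_perm hcyc H hH (g, true) (hbal g)
  let Θ : Letter n → Equiv.Perm ι := fun d => if d.2 then σ d.1 else (σ d.1).symm
  have hΘ : ∀ d i c, Inc c d → (c ∈ H i ↔ across d c ∈ H (Θ d i)) := by
    rintro ⟨g, _ | _⟩ i c hc
    · have h1 := inc_across hc
      have h2 := across_across hcyc hc
      have h3 := hσ g ((σ g).symm i) _ h1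
      rw [show across (g, true) (across (g, false) c) = c from h2,
        Equiv.apply_symm_apply] at h3
      exact h3.symm
    · exact hσ g i c hc
  have hΘi : ∀ d i, Θ (Letter.inv d) (Θ d i) = i := by
    rintro ⟨g, _ | _⟩ i
    · exact (σ g).apply_symm_apply i
    · exact (σ g).symm_apply_apply i
  have hm : ∀ i d c, ∃ c', c ∈ H i → Inc c d → (c' ∈ H i ∧ Inc c' d ∧ c' ≠ c) ∧
      ∀ y, y ∈ H i ∧ Inc y d ∧ y ≠ c → y = c' := by
    intro i d c
    by_cases h : c ∈ H i ∧ Inc c d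
    · obtain ⟨c', h1, h2⟩ := hH i d c h.1 h.2
      exact ⟨c', fun _ _ => ⟨h1, h2⟩⟩
    · exact ⟨c, fun h1 h2 => absurd ⟨h1, h2⟩ h⟩
  choose mate hmate using hm
  let C : CycleSystem u :=
    { ι := ι
      finite := ‹_›
      H := H
      Θ := Θ
      Θ_inv := hΘi
      mem_iff := fun i c => by
        rw [hΘ _ i c (inc_letterAt c), across_letterAt]
      mate := mate
      mate_mem := fun h1 h2 => (hmate _ _ _ h1 h2).1.1
      mate_inc := fun h1 h2 => (hmate _ _ _ h1 h2).1.2.1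
      mate_ne := fun h1 h2 => (hmate _ _ _ h1 h2).1.2.2
      mate_unique := fun h1 h2 h3 h4 h5 => (hmate _ _ _ h1 h2).2 _ ⟨h3, h4, h5⟩ }
  obtain ⟨i, c, c₁, c₂, d₁, d₂, h0, h1, h2, i1, j1, i2, j2, n1, n2, hne⟩ := hlong
  refine C.isPolygonal hcyc ⟨i, c, d₁, d₂, h0, i1, i2, ?_⟩
  rw [← C.mate_unique h0 i1 h1 j1 n1, ← C.mate_unique h0 i2 h2 j2 n2]
  exact hne

open Classical in
/-- The weight of the sets that contain two given corners. -/
noncomputable def pairWeight {κ : Type} [Fintype κ] (w : κ → ℚ) (H : κ → Set (Pos u))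
    (c c' : Pos u) : ℚ :=
  ∑ k, if c ∈ H k ∧ c' ∈ H k then w k else 0

theorem exists_common_denominator {κ : Type} [Fintype κ] (w : κ → ℚ) (hw : ∀ k, 0 ≤ w k) :
    ∃ N : ℕ, 0 < N ∧ ∃ m : κ → ℕ, ∀ k, (m k : ℚ) = N * w k := by
  classical
  refine ⟨∏ k, (w k).den, Finset.prod_pos fun k _ => (w k).pos,
    fun k => (∏ l ∈ Finset.univ.erase k, (w l).den) * (w k).num.toNat, fun k => ?_⟩
  rw [← Finset.prod_erase_mul _ _ (Finset.mem_univ k)]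
  push_cast
  have h : ((w k).num.toNat : ℚ) = (w k).num := by
    exact_mod_cast Int.toNat_of_nonneg (Rat.num_nonneg.2 (hw k))
  rw [h, mul_assoc, Rat.den_mul_eq_num]

/-- A common denominator turns the weight of `H k` into a number of copies of `H k`. The balance
condition is linear, so it survives. -/
theorem isPolygonal_of_weights (hcyc : ∀ j, FreeGroup.IsCyclicallyReduced (u j).toWord)
    {κ : Type} [Fintype κ] (w : κ → ℚ) (hw : ∀ k, 0 ≤ w k) (H : κ → Set (Pos u))
    (hH : ∀ k, w k ≠ 0 → IsCycleSet (H k))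
    (hbal : ∀ g c c', c ≠ c' → Inc c (g, true) → Inc c' (g, true) →
      pairWeight w H c c' = pairWeight w H (across (g, true) c) (across (g, true) c'))
    (hlong : ∃ k, w k ≠ 0 ∧ ∃ c c₁ c₂ d₁ d₂, c ∈ H k ∧ c₁ ∈ H k ∧ c₂ ∈ H k ∧ Inc c d₁ ∧
      Inc c₁ d₁ ∧ Inc c d₂ ∧ Inc c₂ d₂ ∧ c₁ ≠ c ∧ c₂ ≠ c ∧ c₁ ≠ c₂) : IsPolygonal u := by
  classical
  obtain ⟨N, hN, m, hm⟩ := exists_common_denominator w hw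
  have hm0 : ∀ k, 0 < m k → w k ≠ 0 := fun k h h0 => by
    have := hm k
    rw [h0, mul_zero] at this
    exact h.ne' (by exact_mod_cast this)
  have hcard : ∀ c c', (Nat.card {i : Σ k, Fin (m k) // c ∈ H i.1 ∧ c' ∈ H i.1} : ℚ) =
      N * pairWeight w H c c' := fun c c' => by
    rw [Nat.card_eq_fintype_card, Fintype.card_subtype, Finset.card_filter, Fintype.sum_sigma,
      pairWeight, Finset.mul_sum]
    push_cast
    refine Finset.sum_congr rfl fun k _ => ?_
    split_ifs <;> simp [hm]
  refine isPolygonal_of_cycleSets hcyc (fun i : Σ k, Fin (m k) => H i.1)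
    (fun i => hH _ (hm0 _ i.2.pos)) (fun g c c' h1 h2 h3 => ?_) ?_
  · have h := hbal g c c' h1 h2 h3
    have : (Nat.card {i : Σ k, Fin (m k) // c ∈ H i.1 ∧ c' ∈ H i.1} : ℚ) =
        Nat.card {i : Σ k, Fin (m k) //
          across (g, true) c ∈ H i.1 ∧ across (g, true) c' ∈ H i.1} := by
      rw [hcard, hcard, h]
    exact_mod_cast this
  · obtain ⟨k, hk, h⟩ := hlong
    have : 0 < m k := by
      refine Nat.pos_of_ne_zero fun h0 => ?_
      have h1 := hm k
      rw [h0] at h1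
      have : (N : ℚ) ≠ 0 := by exact_mod_cast hN.ne'
      simp [this, hk] at h1
    exact ⟨⟨k, ⟨0, this⟩⟩, h⟩

end WeightedCycles

/-! ### Cycles with prescribed turns in rank two -/

/-- The corners of a link in rank two, sorted by the pair of directions that they join:
`p` joins `a⁺` and `a⁻`, `q` joins `b⁺` and `b⁻`, `x` joins `a⁺` and `b⁺`, `x'` joins `a⁻` and
`b⁻`, `y` joins `a⁺` and `b⁻`, and `y'` joins `a⁻` and `b⁺`. -/
inductive Corner (P Q X X' Y Y' : Type) : Type
  | p : P → Corner P Q X X' Y Y'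
  | q : Q → Corner P Q X X' Y Y'
  | x : X → Corner P Q X X' Y Y'
  | x' : X' → Corner P Q X X' Y Y'
  | y : Y → Corner P Q X X' Y Y'
  | y' : Y' → Corner P Q X X' Y Y'
deriving DecidableEq, Fintype

namespace Corner

variable {P Q X X' Y Y' : Type}

/-- Incidence of a corner with a direction; the generator is `a` for `false` and `b` for `true`,
the sign is positive for `true`. -/
def inc : Corner P Q X X' Y Y' → Bool → Bool → Bool
  | p _, g, _ => !g
  | q _, g, _ => g
  | x _, _, s => s
  | x' _, _, s => !s
  | y _, g, s => xor g s
  | y' _, g, s => !(xor g s)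

/-- A set of corners which is empty or has two elements at every direction. -/
def IsCycle (H : Set (Corner P Q X X' Y Y')) : Prop :=
  ∀ g s, (∀ c ∈ H, ¬ c.inc g s) ∨
    ∃ c₁ c₂, c₁ ≠ c₂ ∧ ∀ c, c ∈ H ∧ c.inc g s ↔ c = c₁ ∨ c = c₂

theorem isCycle_pair {c c' : Corner P Q X X' Y Y'} (hne : c ≠ c')
    (h : ∀ g s, c.inc g s = c'.inc g s) : IsCycle {c, c'} := by
  intro g s
  by_cases hc : c.inc g s
  · right
    refine ⟨c, c', hne, fun d => ?_⟩
    simp only [Set.mem_insert_iff, Set.mem_singleton_iff, and_iff_left_iff_imp]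
    rintro (rfl | rfl)
    exacts [hc, h g s ▸ hc]
  · left
    rintro d (rfl | rfl)
    exacts [hc, h g s ▸ hc]

theorem isCycle_xyxy (f : X) (g : Y) (f' : X') (g' : Y') :
    IsCycle ({x f, y g, x' f', y' g'} : Set (Corner P Q X X' Y Y')) := by
  intro i s
  right
  cases i <;> cases s
  · exact ⟨x' f', y' g', by simp, fun c => by cases c <;> simp [inc]⟩
  · exact ⟨x f, y g, by simp, fun c => by cases c <;> simp [inc]⟩
  · exact ⟨x' f', y g, by simp, fun c => by cases c <;> simp [inc]⟩
  · exact ⟨x f, y' g', by simp, fun c => by cases c <;> simp [inc]⟩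

theorem isCycle_pxqx (h : P) (f : X) (e : Q) (f' : X') :
    IsCycle ({p h, x f, q e, x' f'} : Set (Corner P Q X X' Y Y')) := by
  intro i s
  right
  cases i <;> cases s
  · exact ⟨p h, x' f', by simp, fun c => by cases c <;> simp [inc]⟩
  · exact ⟨p h, x f, by simp, fun c => by cases c <;> simp [inc]⟩
  · exact ⟨q e, x' f', by simp, fun c => by cases c <;> simp [inc]⟩
  · exact ⟨q e, x f, by simp, fun c => by cases c <;> simp [inc]⟩

theorem isCycle_pyqy (h : P) (g : Y) (e : Q) (g' : Y') :
    IsCycle ({p h, y g, q e, y' g'} : Set (Corner P Q X X' Y Y')) := by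
  intro i s
  right
  cases i <;> cases s
  · exact ⟨p h, y' g', by simp, fun c => by cases c <;> simp [inc]⟩
  · exact ⟨p h, y g, by simp, fun c => by cases c <;> simp [inc]⟩
  · exact ⟨q e, y g, by simp, fun c => by cases c <;> simp [inc]⟩
  · exact ⟨q e, y' g', by simp, fun c => by cases c <;> simp [inc]⟩

theorem isCycle_xyq (f : X) (g : Y) (e : Q) :
    IsCycle ({x f, y g, q e} : Set (Corner P Q X X' Y Y')) := by
  intro i s
  cases i <;> cases s
  · left
    rintro c (rfl | rfl | rfl) <;> simp [inc]
  · right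
    exact ⟨x f, y g, by simp, fun c => by cases c <;> simp [inc]⟩
  · right
    exact ⟨q e, y g, by simp, fun c => by cases c <;> simp [inc]⟩
  · right
    exact ⟨q e, x f, by simp, fun c => by cases c <;> simp [inc]⟩

theorem isCycle_xyq' (f : X') (g : Y') (e : Q) :
    IsCycle ({x' f, y' g, q e} : Set (Corner P Q X X' Y Y')) := by
  intro i s
  cases i <;> cases s
  · right
    exact ⟨x' f, y' g, by simp, fun c => by cases c <;> simp [inc]⟩
  · left
    rintro c (rfl | rfl | rfl) <;> simp [inc]
  · right
    exact ⟨q e, x' f, by simp, fun c => by cases c <;> simp [inc]⟩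
  · right
    exact ⟨q e, y' g, by simp, fun c => by cases c <;> simp [inc]⟩

variable [Fintype P] [Fintype Q] [Fintype X] [Fintype X'] [Fintype Y] [Fintype Y']

/-- The numbers of turns at `a⁺` (namely `s`) and at `a⁻` (namely `e`) that a system of cycles is
to have, when it has one turn of each kind at `b⁺` and `b⁻`. -/
structure TurnWeights (P Q X X' Y Y' : Type) [Fintype P] [Fintype Q] [Fintype X] [Fintype X']
    [Fintype Y] [Fintype Y'] where
  s : Corner P Q X X' Y Y' → Corner P Q X X' Y Y' → ℚ
  e : Corner P Q X X' Y Y' → Corner P Q X X' Y Y' → ℚ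
  s_comm : ∀ c c', s c c' = s c' c
  e_comm : ∀ c c', e c c' = e c' c
  one_le_s : ∀ c c', 1 ≤ s c c'
  one_le_e : ∀ c c', 1 ≤ e c c'
  pp : ∀ h h', h ≠ h' → s (p h) (p h') = e (p h) (p h')
  s_xx : ∀ f f', s (x f) (x f') = 1
  s_yy : ∀ g g', s (y g) (y g') = 1
  e_xx : ∀ f f', e (x' f) (x' f') = 1
  e_yy : ∀ g g', e (y' g) (y' g') = 1
  sum_x : ∀ h, ∑ f, s (p h) (x f) = ∑ f, e (p h) (x' f)
  sum_y : ∀ h, ∑ g, s (p h) (y g) = ∑ g, e (p h) (y' g)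
  row_x : ∀ f, ∑ h, s (p h) (x f) + ∑ g, (s (x f) (y g) - 1) = Fintype.card Q
  row_y : ∀ g, ∑ h, s (p h) (y g) + ∑ f, (s (x f) (y g) - 1) = Fintype.card Q
  row_x' : ∀ f, ∑ h, e (p h) (x' f) + ∑ g, (e (x' f) (y' g) - 1) = Fintype.card Q
  row_y' : ∀ g, ∑ h, e (p h) (y' g) + ∑ f, (e (x' f) (y' g) - 1) = Fintype.card Q
  card_x : Fintype.card X = Fintype.card X'
  card_y : Fintype.card Y = Fintype.card Y'

/-- The index set of a system of cycles of lengths two, four and three. -/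
abbrev CycleIndex (P Q X X' Y Y' : Type) : Type :=
  (Corner P Q X X' Y Y' × Corner P Q X X' Y Y') ⊕ (X × Y × X' × Y') ⊕ (P × X × Q × X') ⊕
    (P × Y × Q × Y') ⊕ (X × Y × Q) ⊕ (X' × Y' × Q)

/-- The cycle with a given index. -/
def cycle : CycleIndex P Q X X' Y Y' → Set (Corner P Q X X' Y Y')
  | .inl (c, c') => {c, c'}
  | .inr (.inl (f, g, f', g')) => {x f, y g, x' f', y' g'}
  | .inr (.inr (.inl (h, f, i, f'))) => {p h, x f, q i, x' f'}
  | .inr (.inr (.inr (.inl (h, g, i, g')))) => {p h, y g, q i, y' g'}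
  | .inr (.inr (.inr (.inr (.inl (f, g, i))))) => {x f, y g, q i}
  | .inr (.inr (.inr (.inr (.inr (f', g', i))))) => {x' f', y' g', q i}

namespace TurnWeights

variable (N : TurnWeights P Q X X' Y Y')

/-- The weights of cycles of length two. -/
def bigon : Corner P Q X X' Y Y' → Corner P Q X X' Y Y' → ℚ
  | p h, p h' => N.s (p h) (p h')
  | q _, q _ => 1
  | x _, x _ => 1
  | x' _, x' _ => 1
  | y _, y _ => 1
  | y' _, y' _ => 1
  | _, _ => 0

theorem bigon_nonneg (c c' : Corner P Q X X' Y Y') : 0 ≤ N.bigon c c' := by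
  have := zero_le_one.trans (N.one_le_s c c')
  cases c <;> cases c' <;> simp_all [bigon]

theorem bigon_comm (c c' : Corner P Q X X' Y Y') : N.bigon c c' = N.bigon c' c := by
  cases c <;> cases c' <;> simp [bigon, N.s_comm]

theorem sum_mul_div {α : Type*} [Fintype α] (a t c : ℚ) (b : α → ℚ) (ht : t = ∑ i, b i)
    (h0 : t ≠ 0) : ∑ i, a * b i / (t * c) = a / c := by
  rw [← Finset.sum_div, ← Finset.mul_sum, ← ht, mul_comm a, mul_div_mul_left _ _ h0]

theorem sum_mul_div' {α : Type*} [Fintype α] (a t c : ℚ) (b : α → ℚ) (ht : t = ∑ i, b i)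
    (h0 : t ≠ 0) : ∑ i, b i * a / (t * c) = a / c := by
  simp only [mul_comm _ a]
  exact sum_mul_div a t c b ht h0

theorem s_pos (c c' : Corner P Q X X' Y Y') : 0 < N.s c c' := zero_lt_one.trans_le (N.one_le_s _ _)

theorem e_pos (c c' : Corner P Q X X' Y Y') : 0 < N.e c c' := zero_lt_one.trans_le (N.one_le_e _ _)

theorem sum_s_x_ne (h : P) (f : X) : ∑ f, N.s (p h) (x f) ≠ 0 :=
  (Finset.sum_pos (fun _ _ => N.s_pos _ _) ⟨f, Finset.mem_univ _⟩).ne'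

theorem sum_s_y_ne (h : P) (g : Y) : ∑ g, N.s (p h) (y g) ≠ 0 :=
  (Finset.sum_pos (fun _ _ => N.s_pos _ _) ⟨g, Finset.mem_univ _⟩).ne'

theorem nonempty_x (N : TurnWeights P Q X X' Y Y') (f : X') : Nonempty X :=
  Fintype.card_pos_iff.1 (N.card_x ▸ Fintype.card_pos_iff.2 ⟨f⟩)

theorem nonempty_y (N : TurnWeights P Q X X' Y Y') (g : Y') : Nonempty Y :=
  Fintype.card_pos_iff.1 (N.card_y ▸ Fintype.card_pos_iff.2 ⟨g⟩)

/-- For fixed h, the weights of the quadrilaterals p x q x' couple the turns at a⁺ with those at a⁻.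
The marginal over x' is as stated because `sum_x` equates the two totals. -/
theorem inner_x (h : P) (f : X) : ∑ f', N.s (p h) (x f) * N.e (p h) (x' f') /
    ((∑ f, N.s (p h) (x f)) * Fintype.card Q) = N.s (p h) (x f) / Fintype.card Q :=
  sum_mul_div _ _ _ _ (N.sum_x h) (N.sum_s_x_ne h f)

theorem inner_y (h : P) (g : Y) : ∑ g', N.s (p h) (y g) * N.e (p h) (y' g') /
    ((∑ g, N.s (p h) (y g)) * Fintype.card Q) = N.s (p h) (y g) / Fintype.card Q :=
  sum_mul_div _ _ _ _ (N.sum_y h) (N.sum_s_y_ne h g)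

theorem inner_x' (h : P) (f' : X') : ∑ f, N.s (p h) (x f) * N.e (p h) (x' f') /
    ((∑ f, N.s (p h) (x f)) * Fintype.card Q) = N.e (p h) (x' f') / Fintype.card Q :=
  sum_mul_div' _ _ _ _ rfl (N.sum_s_x_ne h (N.nonempty_x f').some)

theorem inner_y' (h : P) (g' : Y') : ∑ g, N.s (p h) (y g) * N.e (p h) (y' g') /
    ((∑ g, N.s (p h) (y g)) * Fintype.card Q) = N.e (p h) (y' g') / Fintype.card Q :=
  sum_mul_div' _ _ _ _ rfl (N.sum_s_y_ne h (N.nonempty_y g').some)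

theorem card_q_ne_of_x (N : TurnWeights P Q X X' Y Y') (h : P) (f : X) : (Fintype.card Q : ℚ) ≠ 0 := by
  rw [← N.row_x f]
  exact (add_pos_of_pos_of_nonneg
    (Finset.sum_pos (fun _ _ => N.s_pos _ _) ⟨h, Finset.mem_univ _⟩)
    (Finset.sum_nonneg fun _ _ => sub_nonneg.2 (N.one_le_s _ _))).ne'

theorem card_q_ne_of_y (N : TurnWeights P Q X X' Y Y') (h : P) (g : Y) : (Fintype.card Q : ℚ) ≠ 0 := by
  rw [← N.row_y g]
  exact (add_pos_of_pos_of_nonneg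
    (Finset.sum_pos (fun _ _ => N.s_pos _ _) ⟨h, Finset.mem_univ _⟩)
    (Finset.sum_nonneg fun _ _ => sub_nonneg.2 (N.one_le_s _ _))).ne'

/-- If there is no q, the row equation is a vanishing sum of nonnegative terms. Thus no triangles
are needed exactly when their weights would divide by zero. -/
theorem s_xy_eq_one (hq : (Fintype.card Q : ℚ) = 0) (f : X) (g : Y) : N.s (x f) (y g) = 1 := by
  have h := N.row_x f
  rw [hq, add_eq_zero_iff_of_nonneg (Finset.sum_nonneg fun _ _ => (N.s_pos _ _).le)
    (Finset.sum_nonneg fun _ _ => sub_nonneg.2 (N.one_le_s _ _)), Finset.sum_eq_zero_iff_of_nonneg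
    (fun _ _ => sub_nonneg.2 (N.one_le_s _ _))] at h
  exact sub_eq_zero.1 (h.2 g (Finset.mem_univ _))

theorem e_xy_eq_one (hq : (Fintype.card Q : ℚ) = 0) (f : X') (g : Y') :
    N.e (x' f) (y' g) = 1 := by
  have h := N.row_x' f
  rw [hq, add_eq_zero_iff_of_nonneg (Finset.sum_nonneg fun _ _ => (N.e_pos _ _).le)
    (Finset.sum_nonneg fun _ _ => sub_nonneg.2 (N.one_le_e _ _)), Finset.sum_eq_zero_iff_of_nonneg
    (fun _ _ => sub_nonneg.2 (N.one_le_e _ _))] at h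
  exact sub_eq_zero.1 (h.2 g (Finset.mem_univ _))

theorem mul_sub_div_s (f : X) (g : Y) :
    (Fintype.card Q : ℚ) * ((N.s (x f) (y g) - 1) / Fintype.card Q) = N.s (x f) (y g) - 1 := by
  by_cases hq : (Fintype.card Q : ℚ) = 0
  · simp [N.s_xy_eq_one hq]
  · exact mul_div_cancel₀ _ hq

theorem mul_sub_div_e (f : X') (g : Y') :
    (Fintype.card Q : ℚ) * ((N.e (x' f) (y' g) - 1) / Fintype.card Q) =
      N.e (x' f) (y' g) - 1 := by
  by_cases hq : (Fintype.card Q : ℚ) = 0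
  · simp [N.e_xy_eq_one hq]
  · exact mul_div_cancel₀ _ hq

theorem cast_card_ne_zero {α : Type*} [Fintype α] (a : α) : (Fintype.card α : ℚ) ≠ 0 := by
  exact_mod_cast (Fintype.card_pos_iff.2 ⟨a⟩).ne'

variable [DecidableEq P] [DecidableEq Q] [DecidableEq X] [DecidableEq X'] [DecidableEq Y]
  [DecidableEq Y']

/-- The weights of the cycles. -/
def weight : CycleIndex P Q X X' Y Y' → ℚ
  | .inl (c, c') => if c = c' then 0 else N.bigon c c' / 2
  | .inr (.inl _) => 1 / (Fintype.card X * Fintype.card Y)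
  | .inr (.inr (.inl (h, f, _, f'))) =>
    N.s (p h) (x f) * N.e (p h) (x' f') / ((∑ f, N.s (p h) (x f)) * Fintype.card Q)
  | .inr (.inr (.inr (.inl (h, g, _, g')))) =>
    N.s (p h) (y g) * N.e (p h) (y' g') / ((∑ g, N.s (p h) (y g)) * Fintype.card Q)
  | .inr (.inr (.inr (.inr (.inl (f, g, _))))) => (N.s (x f) (y g) - 1) / Fintype.card Q
  | .inr (.inr (.inr (.inr (.inr (f', g', _))))) => (N.e (x' f') (y' g') - 1) / Fintype.card Q

theorem weight_nonneg (k : CycleIndex P Q X X' Y Y') : 0 ≤ N.weight k := by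
  have hs : ∀ c c', 0 ≤ N.s c c' := fun c c' => zero_le_one.trans (N.one_le_s c c')
  have he : ∀ c c', 0 ≤ N.e c c' := fun c c' => zero_le_one.trans (N.one_le_e c c')
  rcases k with ⟨c, c'⟩ | k | ⟨h, f, i, f'⟩ | ⟨h, f, i, f'⟩ | ⟨f, g, i⟩ | ⟨f, g, i⟩
  · have := N.bigon_nonneg c c'
    simp only [weight]
    split_ifs <;> positivity
  · simp only [weight]
    positivity
  · exact div_nonneg (mul_nonneg (hs _ _) (he _ _))
      (mul_nonneg (Finset.sum_nonneg fun _ _ => hs _ _) (Nat.cast_nonneg _))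
  · exact div_nonneg (mul_nonneg (hs _ _) (he _ _))
      (mul_nonneg (Finset.sum_nonneg fun _ _ => hs _ _) (Nat.cast_nonneg _))
  · exact div_nonneg (sub_nonneg.2 (N.one_le_s _ _)) (Nat.cast_nonneg _)
  · exact div_nonneg (sub_nonneg.2 (N.one_le_e _ _)) (Nat.cast_nonneg _)

theorem isCycle_cycle {k : CycleIndex P Q X X' Y Y'} (hk : N.weight k ≠ 0) :
    IsCycle (cycle k) := by
  rcases k with ⟨c, c'⟩ | ⟨f, g, f', g'⟩ | ⟨h, f, i, f'⟩ | ⟨h, f, i, f'⟩ | ⟨f, g, i⟩ | ⟨f, g, i⟩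
  · simp only [weight] at hk
    have hne : c ≠ c' := fun h => hk (if_pos h)
    rw [if_neg hne] at hk
    refine isCycle_pair hne fun g s => ?_
    cases c <;> cases c' <;> simp_all [bigon, inc]
  · exact isCycle_xyxy _ _ _ _
  · exact isCycle_pxqx _ _ _ _
  · exact isCycle_pyqy _ _ _ _
  · exact isCycle_xyq _ _ _
  · exact isCycle_xyq' _ _ _

open Classical in
/-- The weight of the cycles through two given corners. -/
noncomputable def total (c c' : Corner P Q X X' Y Y') : ℚ :=
  ∑ k, if c ∈ cycle k ∧ c' ∈ cycle k then N.weight k else 0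

theorem total_comm (c c' : Corner P Q X X' Y Y') : N.total c c' = N.total c' c := by
  unfold total
  refine Finset.sum_congr rfl fun k _ => ?_
  congr 1
  exact propext and_comm

/-- An unordered pair is indexed by both of its orderings, each with half of the weight; the
diagonal is excluded as it is no bigon. -/
theorem sum_bigon {α : Type*} [Fintype α] [DecidableEq α] (w : α → α → ℚ)
    (hw : ∀ a b, w a b = w b a) {a b : α} (hab : a ≠ b) :
    (∑ x, ∑ y, if (a = x ∨ a = y) ∧ (b = x ∨ b = y) then (if x = y then 0 else w x y / 2) else 0) =
      w a b := by
  have : ∀ x y, (if (a = x ∨ a = y) ∧ (b = x ∨ b = y) then (if x = y then 0 else w x y / 2) else 0)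
      = (if a = x then if b = y then w x y / 2 else 0 else 0) +
        (if b = x then if a = y then w x y / 2 else 0 else 0) := by
    intro x y
    by_cases h1 : a = x <;> by_cases h2 : b = y <;> by_cases h3 : b = x <;> by_cases h4 : a = y <;>
      simp_all
  simp only [this, Finset.sum_add_distrib]
  simp only [Finset.sum_ite_irrel, Finset.sum_ite_eq, Finset.mem_univ, if_true,
    Finset.sum_const_zero]
  rw [hw b a]
  ring

/-- There is one summand for each family of cycles. For two corners of given types most of these
vanish. -/
theorem total_eq (c c' : Corner P Q X X' Y Y') (hne : c ≠ c') : N.total c c' =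
    N.bigon c c' +
    ((∑ f, ∑ g, ∑ f', ∑ g', if (c = x f ∨ c = y g ∨ c = x' f' ∨ c = y' g') ∧
      (c' = x f ∨ c' = y g ∨ c' = x' f' ∨ c' = y' g') then
        1 / (Fintype.card X * Fintype.card Y : ℚ) else 0) +
    ((∑ h, ∑ f, ∑ i, ∑ f', if (c = p h ∨ c = x f ∨ c = q i ∨ c = x' f') ∧
      (c' = p h ∨ c' = x f ∨ c' = q i ∨ c' = x' f') then
        N.s (p h) (x f) * N.e (p h) (x' f') / ((∑ f, N.s (p h) (x f)) * Fintype.card Q) else 0) +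
    ((∑ h, ∑ g, ∑ i, ∑ g', if (c = p h ∨ c = y g ∨ c = q i ∨ c = y' g') ∧
      (c' = p h ∨ c' = y g ∨ c' = q i ∨ c' = y' g') then
        N.s (p h) (y g) * N.e (p h) (y' g') / ((∑ g, N.s (p h) (y g)) * Fintype.card Q) else 0) +
    ((∑ f, ∑ g, ∑ i, if (c = x f ∨ c = y g ∨ c = q i) ∧ (c' = x f ∨ c' = y g ∨ c' = q i) then
        (N.s (x f) (y g) - 1) / (Fintype.card Q : ℚ) else 0) +
    (∑ f, ∑ g, ∑ i, if (c = x' f ∨ c = y' g ∨ c = q i) ∧ (c' = x' f ∨ c' = y' g ∨ c' = q i) then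
        (N.e (x' f) (y' g) - 1) / (Fintype.card Q : ℚ) else 0))))) := by
  rw [← sum_bigon N.bigon N.bigon_comm hne]
  simp only [total, Fintype.sum_sum_type, Fintype.sum_prod_type, cycle, weight,
    Set.mem_insert_iff, Set.mem_singleton_iff]

theorem total_x_x {f f' : X} (hne : f ≠ f') : N.total (x f) (x f') = 1 := by
  rw [N.total_eq _ _ fun h => hne (x.inj h)]
  simp [bigon, ite_and, Finset.sum_ite_irrel, hne.symm]

theorem total_x'_x' {f f' : X'} (hne : f ≠ f') : N.total (x' f) (x' f') = 1 := by
  rw [N.total_eq _ _ fun h => hne (x'.inj h)]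
  simp [bigon, ite_and, Finset.sum_ite_irrel, hne.symm]

theorem total_y_y {f f' : Y} (hne : f ≠ f') : N.total (y f) (y f') = 1 := by
  rw [N.total_eq _ _ fun h => hne (y.inj h)]
  simp [bigon, ite_and, Finset.sum_ite_irrel, hne.symm]

theorem total_y'_y' {f f' : Y'} (hne : f ≠ f') : N.total (y' f) (y' f') = 1 := by
  rw [N.total_eq _ _ fun h => hne (y'.inj h)]
  simp [bigon, ite_and, Finset.sum_ite_irrel, hne.symm]

theorem total_q_q {f f' : Q} (hne : f ≠ f') : N.total (q f) (q f') = 1 := by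
  rw [N.total_eq _ _ fun h => hne (q.inj h)]
  simp [bigon, ite_and, Finset.sum_ite_irrel, hne.symm]

theorem total_p_p {f f' : P} (hne : f ≠ f') : N.total (p f) (p f') = N.s (p f) (p f') := by
  rw [N.total_eq _ _ fun h => hne (p.inj h)]
  simp [bigon, ite_and, Finset.sum_ite_irrel, hne.symm]

theorem total_p_x (h : P) (f : X) : N.total (p h) (x f) = N.s (p h) (x f) := by
  rw [N.total_eq _ _ (by simp)]
  simp [bigon, ite_and, Finset.sum_ite_irrel, inner_x]
  exact mul_div_cancel₀ _ (N.card_q_ne_of_x h f)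

theorem total_p_y (h : P) (f : Y) : N.total (p h) (y f) = N.s (p h) (y f) := by
  rw [N.total_eq _ _ (by simp)]
  simp [bigon, ite_and, Finset.sum_ite_irrel, inner_y]
  exact mul_div_cancel₀ _ (N.card_q_ne_of_y h f)

theorem total_p_x' (h : P) (f : X') : N.total (p h) (x' f) = N.e (p h) (x' f) := by
  rw [N.total_eq _ _ (by simp)]
  simp [bigon, ite_and, Finset.sum_ite_irrel]
  rw [← Finset.mul_sum, inner_x']
  exact mul_div_cancel₀ _ (N.card_q_ne_of_x h (N.nonempty_x f).some)

theorem total_p_y' (h : P) (f : Y') : N.total (p h) (y' f) = N.e (p h) (y' f) := by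
  rw [N.total_eq _ _ (by simp)]
  simp [bigon, ite_and, Finset.sum_ite_irrel]
  rw [← Finset.mul_sum, inner_y']
  exact mul_div_cancel₀ _ (N.card_q_ne_of_y h (N.nonempty_y f).some)

/-- The quadrilaterals x y x' y' contribute 1 for every f and g, and the triangles x y q contribute
the excess `s - 1`. -/
theorem total_x_y (f : X) (g : Y) : N.total (x f) (y g) = N.s (x f) (y g) := by
  have h1 := cast_card_ne_zero f
  have h2 := cast_card_ne_zero g
  rw [N.total_eq _ _ (by simp)]
  simp [bigon, ite_and, Finset.sum_ite_irrel, mul_sub_div_s, ← N.card_x, ← N.card_y]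
  field_simp
  ring

theorem total_x'_y' (f : X') (g : Y') : N.total (x' f) (y' g) = N.e (x' f) (y' g) := by
  have h1 := cast_card_ne_zero f
  have h2 := cast_card_ne_zero g
  rw [N.total_eq _ _ (by simp)]
  simp [bigon, ite_and, Finset.sum_ite_irrel, mul_sub_div_e, N.card_x, N.card_y]
  field_simp
  ring

theorem total_x_y' (f : X) (g : Y') : N.total (x f) (y' g) = 1 := by
  have h1 := cast_card_ne_zero f
  have h2 := cast_card_ne_zero g
  rw [N.total_eq _ _ (by simp)]
  simp [bigon, ite_and, Finset.sum_ite_irrel, ← N.card_x, N.card_y]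
  field_simp

theorem total_y_x' (g : Y) (f : X') : N.total (y g) (x' f) = 1 := by
  have h1 := cast_card_ne_zero f
  have h2 := cast_card_ne_zero g
  rw [N.total_eq _ _ (by simp)]
  simp [bigon, ite_and, Finset.sum_ite_irrel, N.card_x, ← N.card_y]
  field_simp

/-- This is the purpose of `row_x`: the quadrilaterals through p and the triangles through y that
contain x f have total weight `card Q`, before the division that spreads it evenly over the corners
q. -/
theorem total_q_x (i : Q) (f : X) : N.total (q i) (x f) = 1 := by
  rw [N.total_eq _ _ (by simp)]
  simp [bigon, ite_and, Finset.sum_ite_irrel, inner_x]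
  rw [← Finset.sum_div, ← Finset.sum_div, ← add_div, N.row_x, div_self (cast_card_ne_zero i)]

theorem total_q_y (i : Q) (f : Y) : N.total (q i) (y f) = 1 := by
  rw [N.total_eq _ _ (by simp)]
  simp [bigon, ite_and, Finset.sum_ite_irrel, inner_y]
  rw [← Finset.sum_div, ← Finset.sum_div, ← add_div, N.row_y, div_self (cast_card_ne_zero i)]

theorem total_q_x' (i : Q) (f : X') : N.total (q i) (x' f) = 1 := by
  rw [N.total_eq _ _ (by simp)]
  simp [bigon, ite_and, Finset.sum_ite_irrel, inner_x']
  rw [← Finset.sum_div, ← Finset.sum_div, ← add_div, N.row_x', div_self (cast_card_ne_zero i)]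

theorem total_q_y' (i : Q) (f : Y') : N.total (q i) (y' f) = 1 := by
  rw [N.total_eq _ _ (by simp)]
  simp [bigon, ite_and, Finset.sum_ite_irrel, inner_y']
  rw [← Finset.sum_div, ← Finset.sum_div, ← add_div, N.row_y', div_self (cast_card_ne_zero i)]

theorem total_s {c c' : Corner P Q X X' Y Y'} (hne : c ≠ c') (hc : c.inc false true)
    (hc' : c'.inc false true) : N.total c c' = N.s c c' := by
  rcases c with h₁ | i₁ | f₁ | f₁ | g₁ | g₁ <;> rcases c' with h₂ | i₂ | f₂ | f₂ | g₂ | g₂ <;>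
    first
    | exact absurd hc Bool.false_ne_true
    | exact absurd hc' Bool.false_ne_true
    | skip
  · exact N.total_p_p fun h => hne (congrArg _ h)
  · exact N.total_p_x _ _
  · exact N.total_p_y _ _
  · rw [total_comm, N.s_comm, N.total_p_x]
  · exact (N.total_x_x fun h => hne (congrArg _ h)).trans (N.s_xx _ _).symm
  · exact N.total_x_y _ _
  · rw [total_comm, N.s_comm, N.total_p_y]
  · rw [total_comm, N.s_comm, N.total_x_y]
  · exact (N.total_y_y fun h => hne (congrArg _ h)).trans (N.s_yy _ _).symm

theorem total_e {c c' : Corner P Q X X' Y Y'} (hne : c ≠ c') (hc : c.inc false false)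
    (hc' : c'.inc false false) : N.total c c' = N.e c c' := by
  rcases c with h₁ | i₁ | f₁ | f₁ | g₁ | g₁ <;> rcases c' with h₂ | i₂ | f₂ | f₂ | g₂ | g₂ <;>
    first
    | exact absurd hc Bool.false_ne_true
    | exact absurd hc' Bool.false_ne_true
    | skip
  · exact (N.total_p_p fun h => hne (congrArg _ h)).trans (N.pp _ _ fun h => hne (congrArg _ h))
  · exact N.total_p_x' _ _
  · exact N.total_p_y' _ _
  · rw [total_comm, N.e_comm, N.total_p_x']
  · exact (N.total_x'_x' fun h => hne (congrArg _ h)).trans (N.e_xx _ _).symm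
  · exact N.total_x'_y' _ _
  · rw [total_comm, N.e_comm, N.total_p_y']
  · rw [total_comm, N.e_comm, N.total_x'_y']
  · exact (N.total_y'_y' fun h => hne (congrArg _ h)).trans (N.e_yy _ _).symm

/-- Constant turns at b⁺ and b⁻ make the balance across the letters of b automatic, however these
letters connect the corners. -/
theorem total_b {s : Bool} {c c' : Corner P Q X X' Y Y'} (hne : c ≠ c') (hc : c.inc true s)
    (hc' : c'.inc true s) : N.total c c' = 1 := by
  cases s <;>
  rcases c with h₁ | i₁ | f₁ | f₁ | g₁ | g₁ <;> rcases c' with h₂ | i₂ | f₂ | f₂ | g₂ | g₂ <;>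
    first
    | exact absurd hc Bool.false_ne_true
    | exact absurd hc' Bool.false_ne_true
    | exact N.total_q_q fun h => hne (congrArg _ h)
    | exact N.total_x_x fun h => hne (congrArg _ h)
    | exact N.total_x'_x' fun h => hne (congrArg _ h)
    | exact N.total_y_y fun h => hne (congrArg _ h)
    | exact N.total_y'_y' fun h => hne (congrArg _ h)
    | simp only [N.total_q_x, N.total_q_x', N.total_q_y, N.total_q_y', N.total_y_x', N.total_x_y']
    | rw [total_comm]; simp only [N.total_q_x, N.total_q_x', N.total_q_y, N.total_q_y',
        N.total_y_x', N.total_x_y']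

theorem exists_long (h : (Nonempty X ∧ Nonempty Y) ∨
    (Nonempty P ∧ Nonempty Q ∧ (Nonempty X ∨ Nonempty Y))) :
    ∃ k, N.weight k ≠ 0 ∧ ∃ c c₁ c₂ i s j t, c ∈ cycle k ∧ c₁ ∈ cycle k ∧ c₂ ∈ cycle k ∧
      c.inc i s ∧ c₁.inc i s ∧ c.inc j t ∧ c₂.inc j t ∧ c₁ ≠ c ∧ c₂ ≠ c ∧ c₁ ≠ c₂ := by
  have hx' : Nonempty X → Nonempty X' := fun ⟨f⟩ =>
    Fintype.card_pos_iff.1 (N.card_x ▸ Fintype.card_pos_iff.2 ⟨f⟩)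
  have hy' : Nonempty Y → Nonempty Y' := fun ⟨f⟩ =>
    Fintype.card_pos_iff.1 (N.card_y ▸ Fintype.card_pos_iff.2 ⟨f⟩)
  rcases h with ⟨⟨f⟩, ⟨g⟩⟩ | ⟨⟨h⟩, ⟨i⟩, hf | hg⟩
  · obtain ⟨f'⟩ := hx' ⟨f⟩
    obtain ⟨g'⟩ := hy' ⟨g⟩
    refine ⟨.inr (.inl (f, g, f', g')), ?_, x f, y g, y' g', false, true, true, true, ?_⟩
    · have h1 := cast_card_ne_zero f
      have h2 := cast_card_ne_zero g
      simp only [weight]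
      positivity
    · simp [cycle, inc]
  · obtain ⟨f⟩ := hf
    obtain ⟨f'⟩ := hx' ⟨f⟩
    refine ⟨.inr (.inr (.inl (h, f, i, f'))), ?_, p h, x f, x' f', false, true, false, false, ?_⟩
    · exact div_ne_zero (mul_ne_zero (N.s_pos _ _).ne' (N.e_pos _ _).ne')
        (mul_ne_zero (N.sum_s_x_ne h f) (cast_card_ne_zero i))
    · simp [cycle, inc]
  · obtain ⟨g⟩ := hg
    obtain ⟨g'⟩ := hy' ⟨g⟩
    refine ⟨.inr (.inr (.inr (.inl (h, g, i, g')))), ?_, p h, y g, y' g', false, true, false,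
      false, ?_⟩
    · exact div_ne_zero (mul_ne_zero (N.s_pos _ _).ne' (N.e_pos _ _).ne')
        (mul_ne_zero (N.sum_s_y_ne h g) (cast_card_ne_zero i))
    · simp [cycle, inc]

end TurnWeights

end Corner

/-! ### Perturbing the turns between the letters of one generator -/

/-- The letters of one generator in rank two, with the `0`-`1`-valued functions that tell whether a
letter starts (`a₁`, `a₂`) or ends (`b₁`, `b₂`) at a corner of the first or the second kind
joining it to a letter of the other generator; every other corner `h` is between the
letter `hm h` ending there and the letter `hp h` starting there. -/
structure LetterTurns (L P : Type) [Fintype L] [DecidableEq L] [Fintype P] where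
  a₁ : L → ℚ
  a₂ : L → ℚ
  b₁ : L → ℚ
  b₂ : L → ℚ
  hm : P → L
  hp : P → L
  a₁_cases : ∀ l, a₁ l = 0 ∨ a₁ l = 1
  a₂_cases : ∀ l, a₂ l = 0 ∨ a₂ l = 1
  b₁_cases : ∀ l, b₁ l = 0 ∨ b₁ l = 1
  b₂_cases : ∀ l, b₂ l = 0 ∨ b₂ l = 1
  a_mul : ∀ l, a₁ l * a₂ l = 0
  b_mul : ∀ l, b₁ l * b₂ l = 0
  b₁_hm : ∀ h, b₁ (hm h) = 0
  b₂_hm : ∀ h, b₂ (hm h) = 0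
  a₁_hp : ∀ h, a₁ (hp h) = 0
  a₂_hp : ∀ h, a₂ (hp h) = 0
  hm_injective : Function.Injective hm
  hp_injective : Function.Injective hp
  sum_hm : ∀ l, (∑ h, if l = hm h then (1 : ℚ) else 0) = 1 - b₁ l - b₂ l
  sum_hp : ∀ l, (∑ h, if l = hp h then (1 : ℚ) else 0) = 1 - a₁ l - a₂ l
  sum₁ : ∑ l, a₁ l = ∑ l, b₁ l
  sum₂ : ∑ l, a₂ l = ∑ l, b₂ l

namespace LetterTurns

variable {L P : Type} [Fintype L] [DecidableEq L] [Fintype P] (D : LetterTurns L P)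

/-- The same letters with the two kinds of corners interchanged. -/
def swap : LetterTurns L P where
  a₁ := D.a₂
  a₂ := D.a₁
  b₁ := D.b₂
  b₂ := D.b₁
  hm := D.hm
  hp := D.hp
  a₁_cases := D.a₂_cases
  a₂_cases := D.a₁_cases
  b₁_cases := D.b₂_cases
  b₂_cases := D.b₁_cases
  a_mul l := by rw [mul_comm, D.a_mul]
  b_mul l := by rw [mul_comm, D.b_mul]
  b₁_hm := D.b₂_hm
  b₂_hm := D.b₁_hm
  a₁_hp := D.a₂_hp
  a₂_hp := D.a₁_hp
  hm_injective := D.hm_injective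
  hp_injective := D.hp_injective
  sum_hm l := by rw [D.sum_hm, sub_right_comm]
  sum_hp l := by rw [D.sum_hp, sub_right_comm]
  sum₁ := D.sum₂
  sum₂ := D.sum₁

/-- The symmetric functions on pairs of letters by which the constant numbers of turns may
be changed. -/
structure IsPerturbation (η : L → L → ℚ) : Prop where
  comm : ∀ s t, η s t = η t s
  nonneg : ∀ s t, 0 ≤ η s t
  a₁_zero : ∀ s t, D.a₁ s = 1 → D.a₁ t = 1 → η s t = 0
  a₂_zero : ∀ s t, D.a₂ s = 1 → D.a₂ t = 1 → η s t = 0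
  b₁_zero : ∀ s t, D.b₁ s = 1 → D.b₁ t = 1 → η s t = 0
  b₂_zero : ∀ s t, D.b₂ s = 1 → D.b₂ t = 1 → η s t = 0
  sum₁ : ∀ h, ∑ l, D.b₁ l * η l (D.hm h) = ∑ l, D.a₁ l * η l (D.hp h)
  sum₂ : ∀ h, ∑ l, D.b₂ l * η l (D.hm h) = ∑ l, D.a₂ l * η l (D.hp h)
  pp : ∀ h h', h ≠ h' → η (D.hm h) (D.hm h') = η (D.hp h) (D.hp h')

namespace IsPerturbation

variable {D}

theorem of_swap {η : L → L → ℚ} (h : D.swap.IsPerturbation η) : D.IsPerturbation η :=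
  ⟨h.comm, h.nonneg, h.a₂_zero, h.a₁_zero, h.b₂_zero, h.b₁_zero, h.sum₂, h.sum₁, h.pp⟩

theorem add {η θ : L → L → ℚ} (h : D.IsPerturbation η) (h' : D.IsPerturbation θ) :
    D.IsPerturbation fun s t => η s t + θ s t where
  comm s t := by rw [h.comm, h'.comm]
  nonneg s t := add_nonneg (h.nonneg s t) (h'.nonneg s t)
  a₁_zero s t hs ht := by rw [h.a₁_zero s t hs ht, h'.a₁_zero s t hs ht, add_zero]
  a₂_zero s t hs ht := by rw [h.a₂_zero s t hs ht, h'.a₂_zero s t hs ht, add_zero]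
  b₁_zero s t hs ht := by rw [h.b₁_zero s t hs ht, h'.b₁_zero s t hs ht, add_zero]
  b₂_zero s t hs ht := by rw [h.b₂_zero s t hs ht, h'.b₂_zero s t hs ht, add_zero]
  sum₁ i := by simp only [mul_add, Finset.sum_add_distrib, h.sum₁, h'.sum₁]
  sum₂ i := by simp only [mul_add, Finset.sum_add_distrib, h.sum₂, h'.sum₂]
  pp i j hij := by rw [h.pp i j hij, h'.pp i j hij]

theorem smul {η : L → L → ℚ} (h : D.IsPerturbation η) {c : ℚ} (hc : 0 ≤ c) :
    D.IsPerturbation fun s t => c * η s t where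
  comm s t := by rw [h.comm]
  nonneg s t := mul_nonneg hc (h.nonneg s t)
  a₁_zero s t hs ht := by rw [h.a₁_zero s t hs ht, mul_zero]
  a₂_zero s t hs ht := by rw [h.a₂_zero s t hs ht, mul_zero]
  b₁_zero s t hs ht := by rw [h.b₁_zero s t hs ht, mul_zero]
  b₂_zero s t hs ht := by rw [h.b₂_zero s t hs ht, mul_zero]
  sum₁ i := by simp only [mul_left_comm _ c, ← Finset.mul_sum, h.sum₁]
  sum₂ i := by simp only [mul_left_comm _ c, ← Finset.mul_sum, h.sum₂]
  pp i j hij := by rw [h.pp i j hij]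

end IsPerturbation

/-- The number of letters that start and end at corners of the first kind. -/
def both : ℚ := ∑ l, D.a₁ l * D.b₁ l

/-- The number of letters that neither start nor end at corners of the first kind. -/
def neither : ℚ := ∑ l, (1 - D.a₁ l) * (1 - D.b₁ l)

/-- The number of letters that start but do not end at corners of the first kind. -/
def half : ℚ := ∑ l, D.a₁ l * (1 - D.b₁ l)

/-- As many letters start as end at corners of the first kind; removing those that do both leaves
equal numbers. -/
theorem half_eq : ∑ l, (1 - D.a₁ l) * D.b₁ l = D.half := by
  have h := D.sum₁
  simp only [half, sub_mul, mul_sub, one_mul, mul_one, Finset.sum_sub_distrib, h]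

/-- This is how minimality enters: x ≤ p + y becomes `both ≤ neither`. -/
theorem neither_eq : D.neither = Fintype.card L - 2 * ∑ l, D.a₁ l + D.both := by
  have h := D.sum₁
  simp only [neither, both, sub_mul, mul_sub, one_mul, mul_one, Finset.sum_sub_distrib, ← h,
    Finset.sum_const, Finset.card_univ, nsmul_eq_mul]
  ring

theorem a₁_nonneg (l : L) : 0 ≤ D.a₁ l := by rcases D.a₁_cases l with h | h <;> simp [h]

theorem b₁_nonneg (l : L) : 0 ≤ D.b₁ l := by rcases D.b₁_cases l with h | h <;> simp [h]

theorem one_sub_a₁_nonneg (l : L) : 0 ≤ 1 - D.a₁ l := by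
  rcases D.a₁_cases l with h | h <;> simp [h]

theorem one_sub_b₁_nonneg (l : L) : 0 ≤ 1 - D.b₁ l := by
  rcases D.b₁_cases l with h | h <;> simp [h]

theorem both_nonneg : 0 ≤ D.both :=
  Finset.sum_nonneg fun l _ => mul_nonneg (D.a₁_nonneg l) (D.b₁_nonneg l)

theorem half_nonneg : 0 ≤ D.half :=
  Finset.sum_nonneg fun l _ => mul_nonneg (D.a₁_nonneg l) (D.one_sub_b₁_nonneg l)

/-- The turns between the letters that only start and those that only end at corners of the first
kind, normalized. -/
def cross (s t : L) : ℚ :=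
  (D.a₁ s * (1 - D.b₁ s) * ((1 - D.a₁ t) * D.b₁ t) +
    (1 - D.a₁ s) * D.b₁ s * (D.a₁ t * (1 - D.b₁ t))) / D.half

/-- The turns between the letters that start and end and those that neither start nor end at
corners of the first kind. -/
def full (s t : L) : ℚ :=
  D.a₁ s * D.b₁ s * ((1 - D.a₁ t) * (1 - D.b₁ t)) +
    (1 - D.a₁ s) * (1 - D.b₁ s) * (D.a₁ t * D.b₁ t)

/-- If `half` vanishes, so do all its nonnegative summands, and dividing by zero does no harm. -/
theorem half_mul_div (l : L) : D.a₁ l * (1 - D.b₁ l) * D.half / D.half = D.a₁ l * (1 - D.b₁ l) := by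
  by_cases h : D.half = 0
  · have h1 := (Finset.sum_eq_zero_iff_of_nonneg fun l _ =>
      mul_nonneg (D.a₁_nonneg l) (D.one_sub_b₁_nonneg l)).1 h l (Finset.mem_univ l)
    rw [h1]
    simp
  · exact mul_div_cancel_right₀ _ h

theorem half_mul_div' (l : L) :
    (1 - D.a₁ l) * D.b₁ l * D.half / D.half = (1 - D.a₁ l) * D.b₁ l := by
  by_cases h : D.half = 0
  · have h1 := (Finset.sum_eq_zero_iff_of_nonneg fun l _ =>
      mul_nonneg (D.one_sub_a₁_nonneg l) (D.b₁_nonneg l)).1 (D.half_eq.trans h) l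
        (Finset.mem_univ l)
    rw [h1]
    simp
  · exact mul_div_cancel_right₀ _ h

/-- A complete bipartite graph with parts of equal size `half`; the normalization gives each letter
of either part row sum one. -/
theorem sum_cross (s : L) :
    ∑ t, D.cross s t = D.a₁ s * (1 - D.b₁ s) + (1 - D.a₁ s) * D.b₁ s := by
  simp only [cross, ← Finset.sum_div, Finset.sum_add_distrib, ← Finset.mul_sum, half_eq]
  rw [← half, add_div, half_mul_div, half_mul_div']

theorem sum_full (s : L) : ∑ t, D.full s t =
    D.a₁ s * D.b₁ s * D.neither + (1 - D.a₁ s) * (1 - D.b₁ s) * D.both := by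
  simp only [full, Finset.sum_add_distrib, ← Finset.mul_sum]
  rfl

/-- The letter `hm h` does not end at a corner of the first kind, so `cross` can only pair it, as
one that merely starts there, with those that merely end there. -/
theorem sum_b₁_cross (h : P) : ∑ l, D.b₁ l * D.cross l (D.hm h) = D.a₁ (D.hm h) := by
  have h1 : ∀ l, D.b₁ l * D.cross l (D.hm h) =
      (1 - D.a₁ l) * D.b₁ l * D.a₁ (D.hm h) / D.half := fun l => by
    rw [cross, D.b₁_hm]
    rcases D.b₁_cases l with h | h <;> rw [h] <;> ring
  rw [Finset.sum_congr rfl fun l _ => h1 l, ← Finset.sum_div, ← Finset.sum_mul, half_eq]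
  have h2 := D.half_mul_div (D.hm h)
  rw [D.b₁_hm] at h2
  rw [mul_comm]
  simpa using h2

theorem sum_a₁_cross (h : P) : ∑ l, D.a₁ l * D.cross l (D.hp h) = D.b₁ (D.hp h) := by
  have h1 : ∀ l, D.a₁ l * D.cross l (D.hp h) =
      D.a₁ l * (1 - D.b₁ l) * D.b₁ (D.hp h) / D.half := fun l => by
    rw [cross, D.a₁_hp]
    rcases D.a₁_cases l with h | h <;> rw [h] <;> ring
  rw [Finset.sum_congr rfl fun l _ => h1 l, ← Finset.sum_div, ← Finset.sum_mul, ← half]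
  have h2 := D.half_mul_div' (D.hp h)
  rw [D.a₁_hp] at h2
  rw [mul_comm]
  simpa using h2

theorem b₂_mul_cross (l : L) (h : P) : D.b₂ l * D.cross l (D.hm h) = 0 := by
  have h1 := D.b_mul l
  rw [cross, D.b₁_hm]
  rcases D.b₁_cases l with h | h <;> rw [h] at h1 ⊢
  · simp
  · rw [one_mul] at h1
    rw [h1, zero_mul]

theorem a₂_mul_cross (l : L) (h : P) : D.a₂ l * D.cross l (D.hp h) = 0 := by
  have h1 := D.a_mul l
  rw [cross, D.a₁_hp]
  rcases D.a₁_cases l with h | h <;> rw [h] at h1 ⊢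
  · simp
  · rw [one_mul] at h1
    rw [h1, zero_mul]

theorem a₁_eq_zero {l : L} (h : D.a₂ l = 1) : D.a₁ l = 0 := by simpa [h] using D.a_mul l

theorem b₁_eq_zero {l : L} (h : D.b₂ l = 1) : D.b₁ l = 0 := by simpa [h] using D.b_mul l

theorem cross_comm (s t : L) : D.cross s t = D.cross t s := by
  simp only [cross]
  ring

theorem cross_nonneg (s t : L) : 0 ≤ D.cross s t := by
  have := D.a₁_nonneg
  have := D.b₁_nonneg
  have := D.one_sub_a₁_nonneg
  have := D.one_sub_b₁_nonneg
  have := D.half_nonneg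
  rw [cross]
  refine div_nonneg (add_nonneg ?_ ?_) (D.half_nonneg) <;> apply_rules [mul_nonneg]

theorem full_nonneg (s t : L) : 0 ≤ D.full s t := by
  have := D.a₁_nonneg
  have := D.b₁_nonneg
  have := D.one_sub_a₁_nonneg
  have := D.one_sub_b₁_nonneg
  rw [full]
  refine add_nonneg ?_ ?_ <;> apply_rules [mul_nonneg]

/-- By itself `full` violates `sum₁`, with sides `both * (1 - a₁ (hm h))` and `both * (1 - b₁ (hp
h))`. The multiple of `cross` adds the missing terms and brings both sides to `both`. -/
theorem isPerturbation_full : D.IsPerturbation fun s t => D.full s t + D.both * D.cross s t where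
  comm s t := by
    rw [D.cross_comm]
    simp only [full]
    ring
  nonneg s t := add_nonneg (D.full_nonneg s t) (mul_nonneg D.both_nonneg (D.cross_nonneg s t))
  a₁_zero s t hs ht := by simp [full, cross, hs, ht]
  a₂_zero s t hs ht := by simp [full, cross, D.a₁_eq_zero hs, D.a₁_eq_zero ht]
  b₁_zero s t hs ht := by simp [full, cross, hs, ht]
  b₂_zero s t hs ht := by simp [full, cross, D.b₁_eq_zero hs, D.b₁_eq_zero ht]
  sum₁ h := by
    have h1 : ∑ l, D.b₁ l * D.full l (D.hm h) = D.both * (1 - D.a₁ (D.hm h)) := by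
      rw [both, Finset.sum_mul]
      refine Finset.sum_congr rfl fun l _ => ?_
      rw [full, D.b₁_hm]
      rcases D.b₁_cases l with h | h <;> rw [h] <;> ring
    have h2 : ∑ l, D.a₁ l * D.full l (D.hp h) = D.both * (1 - D.b₁ (D.hp h)) := by
      rw [both, Finset.sum_mul]
      refine Finset.sum_congr rfl fun l _ => ?_
      rw [full, D.a₁_hp]
      rcases D.a₁_cases l with h | h <;> rw [h] <;> ring
    simp only [mul_add, Finset.sum_add_distrib, h1, h2, mul_left_comm _ D.both, ← Finset.mul_sum,
      sum_b₁_cross, sum_a₁_cross]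
    ring
  sum₂ h := by
    rw [Finset.sum_eq_zero, Finset.sum_eq_zero]
    · intro l _
      have h1 := D.a_mul l
      rw [mul_add, mul_left_comm, a₂_mul_cross, full, D.a₁_hp]
      linear_combination D.b₁ l * (1 - D.b₁ (D.hp h)) * h1
    · intro l _
      have h1 := D.b_mul l
      rw [mul_add, mul_left_comm, b₂_mul_cross, full, D.b₁_hm]
      linear_combination D.a₁ l * (1 - D.a₁ (D.hm h)) * h1
  pp h h' _ := by simp [full, cross, D.b₁_hm, D.a₁_hp]

/-- The turns between the two letters at a corner which is not of the first or the second kind. -/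
def straight (s t : L) : ℚ :=
  ∑ h, ((if s = D.hm h then if t = D.hp h then 1 else 0 else 0) +
    (if s = D.hp h then if t = D.hm h then 1 else 0 else 0))

theorem sum_straight (s : L) :
    ∑ t, D.straight s t = 2 - D.a₁ s - D.a₂ s - D.b₁ s - D.b₂ s := by
  simp only [straight]
  rw [Finset.sum_comm]
  simp only [Finset.sum_add_distrib, Finset.sum_ite_irrel, Finset.sum_ite_eq', Finset.mem_univ,
    if_true, Finset.sum_const_zero, sum_hm, sum_hp]
  ring

theorem straight_nonneg (s t : L) : 0 ≤ D.straight s t := by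
  refine Finset.sum_nonneg fun h _ => ?_
  split_ifs <;> norm_num

theorem straight_comm (s t : L) : D.straight s t = D.straight t s := by
  refine Finset.sum_congr rfl fun h _ => ?_
  rw [add_comm]
  simp only [← ite_and, and_comm]

theorem straight_eq_zero {s t : L} (h1 : ∀ h, s = D.hm h → t ≠ D.hp h)
    (h2 : ∀ h, s = D.hp h → t ≠ D.hm h) : D.straight s t = 0 := by
  refine Finset.sum_eq_zero fun h _ => ?_
  rw [← ite_and, ← ite_and, if_neg fun h3 => h1 h h3.1 h3.2, if_neg fun h3 => h2 h h3.1 h3.2,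
    add_zero]

theorem sum_mul_straight (w : L → ℚ) (t : L) : ∑ l, w l * D.straight l t =
    ∑ h, ((if t = D.hp h then w (D.hm h) else 0) + (if t = D.hm h then w (D.hp h) else 0)) := by
  simp only [straight, Finset.mul_sum]
  rw [Finset.sum_comm]
  refine Finset.sum_congr rfl fun h _ => ?_
  simp only [mul_add, Finset.sum_add_distrib, mul_ite, mul_one, mul_zero, Finset.sum_ite_eq',
    Finset.mem_univ, if_true]

/-- In `straight`, the letter `hm h` is adjacent to `hp h` across h, and across a corner h' where it
starts, if there is one, to `hm h'`, at which w vanishes. -/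
theorem sum_mul_straight_hm (w : L → ℚ) (hw : ∀ h, w (D.hm h) = 0) (h : P) :
    ∑ l, w l * D.straight l (D.hm h) = w (D.hp h) := by
  classical
  simp [sum_mul_straight, hw, D.hm_injective.eq_iff]

theorem sum_mul_straight_hp (w : L → ℚ) (hw : ∀ h, w (D.hp h) = 0) (h : P) :
    ∑ l, w l * D.straight l (D.hp h) = w (D.hm h) := by
  classical
  simp [sum_mul_straight, hw, D.hp_injective.eq_iff]

/-- By injectivity, both sides count how often a single letter leads from one of the two corners to
the other. -/
theorem straight_pp (h h' : P) :
    D.straight (D.hm h) (D.hm h') = D.straight (D.hp h) (D.hp h') := by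
  classical
  have h1 : ∀ i, (D.hm h = D.hm i) = (h = i) := fun i => propext D.hm_injective.eq_iff
  have h2 : ∀ i, (D.hm h' = D.hm i) = (h' = i) := fun i => propext D.hm_injective.eq_iff
  have h3 : ∀ i, (D.hp h = D.hp i) = (h = i) := fun i => propext D.hp_injective.eq_iff
  have h4 : ∀ i, (D.hp h' = D.hp i) = (h' = i) := fun i => propext D.hp_injective.eq_iff
  have h5 : ∀ (i : P) (p : P → Prop) [DecidablePred p],
      (∑ j, if p j then if i = j then (1 : ℚ) else 0 else 0) = if p i then 1 else 0 := by
    intro i p _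
    rw [Finset.sum_eq_single i (fun j _ hj => by simp [hj.symm]) (by simp), if_pos rfl]
  simp only [straight, Finset.sum_add_distrib, h1, h2, h3, h4, Finset.sum_ite_eq,
    Finset.mem_univ, if_true, h5]
  simp only [eq_comm]

/-- The sum of all the turns in `straight` and in both kinds of `cross`. -/
def even (s t : L) : ℚ := D.straight s t + (D.cross s t + D.swap.cross s t)

/-- In `sum₁`, `straight` contributes `b₁ (hp h)` on the left and `a₁ (hm h)` on the right, and
`cross` contributes the same terms the other way round, so only their sum is balanced. The second
`cross` does this for `sum₂` and is invisible in `sum₁`. -/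
theorem isPerturbation_even : D.IsPerturbation D.even where
  comm s t := by rw [even, even, D.straight_comm, D.cross_comm, D.swap.cross_comm]
  nonneg s t := add_nonneg (D.straight_nonneg s t)
    (add_nonneg (D.cross_nonneg s t) (D.swap.cross_nonneg s t))
  a₁_zero s t hs ht := by
    have h1 : D.straight s t = 0 := D.straight_eq_zero
      (fun h _ h2 => by simp [h2, D.a₁_hp] at ht) (fun h h2 => by simp [h2, D.a₁_hp] at hs)
    have h2 := D.swap.a₁_eq_zero hs
    have h3 := D.swap.a₁_eq_zero ht
    simp [even, h1, cross, hs, ht, h2, h3]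
  a₂_zero s t hs ht := by
    have h1 : D.straight s t = 0 := D.straight_eq_zero
      (fun h _ h2 => by simp [h2, D.a₂_hp] at ht) (fun h h2 => by simp [h2, D.a₂_hp] at hs)
    have h2 := D.a₁_eq_zero hs
    have h3 := D.a₁_eq_zero ht
    have h4 : D.swap.a₁ s = 1 := hs
    have h5 : D.swap.a₁ t = 1 := ht
    simp [even, h1, cross, h4, h5, h2, h3]
  b₁_zero s t hs ht := by
    have h1 : D.straight s t = 0 := D.straight_eq_zero
      (fun h h2 => by simp [h2, D.b₁_hm] at hs) (fun h _ h2 => by simp [h2, D.b₁_hm] at ht)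
    have h2 := D.swap.b₁_eq_zero hs
    have h3 := D.swap.b₁_eq_zero ht
    simp [even, h1, cross, hs, ht, h2, h3]
  b₂_zero s t hs ht := by
    have h1 : D.straight s t = 0 := D.straight_eq_zero
      (fun h h2 => by simp [h2, D.b₂_hm] at hs) (fun h _ h2 => by simp [h2, D.b₂_hm] at ht)
    have h2 := D.b₁_eq_zero hs
    have h3 := D.b₁_eq_zero ht
    have h4 : D.swap.b₁ s = 1 := hs
    have h5 : D.swap.b₁ t = 1 := ht
    simp [even, h1, cross, h4, h5, h2, h3]
  sum₁ h := by
    simp only [even, mul_add, Finset.sum_add_distrib]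
    have h1 : ∑ l, D.b₁ l * D.swap.cross l (D.hm h) = 0 :=
      Finset.sum_eq_zero fun l _ => D.swap.b₂_mul_cross l h
    have h2 : ∑ l, D.a₁ l * D.swap.cross l (D.hp h) = 0 :=
      Finset.sum_eq_zero fun l _ => D.swap.a₂_mul_cross l h
    rw [D.sum_mul_straight_hm _ D.b₁_hm, D.sum_mul_straight_hp _ D.a₁_hp, D.sum_b₁_cross,
      D.sum_a₁_cross, h1, h2]
    ring
  sum₂ h := by
    simp only [even, mul_add, Finset.sum_add_distrib]
    have h1 : ∑ l, D.b₂ l * D.swap.cross l (D.hm h) = D.a₂ (D.hm h) := D.swap.sum_b₁_cross h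
    have h2 : ∑ l, D.a₂ l * D.swap.cross l (D.hp h) = D.b₂ (D.hp h) := D.swap.sum_a₁_cross h
    rw [D.sum_mul_straight_hm _ D.b₂_hm, D.sum_mul_straight_hp _ D.a₂_hp, h1, h2,
      Finset.sum_eq_zero fun l _ => D.b₂_mul_cross l h,
      Finset.sum_eq_zero fun l _ => D.a₂_mul_cross l h]
    ring
  pp h h' _ := by
    have h1 : ∀ h, D.swap.b₁ (D.hm h) = 0 := D.b₂_hm
    have h2 : ∀ h, D.swap.a₁ (D.hp h) = 0 := D.a₂_hp
    simp [even, D.straight_pp h h', cross, D.b₁_hm, D.a₁_hp, h1, h2]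

theorem sum_even (s : L) : ∑ t, D.even s t =
    2 - 2 * (D.a₁ s * D.b₁ s) - 2 * (D.swap.a₁ s * D.swap.b₁ s) := by
  simp only [even, Finset.sum_add_distrib, sum_straight, sum_cross]
  have h1 : D.swap.a₁ s = D.a₂ s := rfl
  have h2 : D.swap.b₁ s = D.b₂ s := rfl
  rw [h1, h2]
  ring

/-- The row sums are constant up to an excess `neither - both` at the letters that start and end at
corners of the first kind. At these letters `even` has a deficit of 2, so a combination can cancel
the two. -/
theorem sum_full_add (s : L) : ∑ t, (D.full s t + D.both * D.cross s t) =
    D.both + D.a₁ s * D.b₁ s * (D.neither - D.both) := by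
  simp only [Finset.sum_add_distrib, ← Finset.mul_sum, sum_full, sum_cross]
  ring

theorem both_mul_eq_zero {x : ℚ} (h : D.both * x = 0) (s : L) : D.a₁ s * D.b₁ s * x = 0 := by
  rcases mul_eq_zero.1 h with h | h
  · have h1 := (Finset.sum_eq_zero_iff_of_nonneg fun l _ =>
      mul_nonneg (D.a₁_nonneg l) (D.b₁_nonneg l)).1 h s (Finset.mem_univ s)
    rw [h1, zero_mul]
  · rw [h, mul_zero]

/-- Here k and d stand for `both` and `neither - both` for the first kind, m and e for the second.
The equations say that excess and deficit cancel wherever such letters exist, and the last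
expression is the resulting row sum. -/
theorem exists_coefficients (k m d e : ℚ) (hk : 0 ≤ k) (hm : 0 ≤ m) (hd : 0 ≤ d) (he : 0 ≤ e) :
    ∃ c₁ c₂ c₃ : ℚ, 0 ≤ c₁ ∧ 0 ≤ c₂ ∧ 0 ≤ c₃ ∧ k * (c₁ * d - 2 * c₃) = 0 ∧
      m * (c₂ * e - 2 * c₃) = 0 ∧ 0 < c₁ * k + c₂ * m + 2 * c₃ := by
  by_cases h1 : k ≠ 0 ∧ d = 0
  · refine ⟨1, 0, 0, zero_le_one, le_rfl, le_rfl, by simp [h1.2], by simp, ?_⟩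
    have := hk.lt_of_ne' h1.1
    linarith
  by_cases h2 : m ≠ 0 ∧ e = 0
  · refine ⟨0, 1, 0, le_rfl, zero_le_one, le_rfl, by simp, by simp [h2.2], ?_⟩
    have := hm.lt_of_ne' h2.1
    linarith
  -- If d = 0 then k = 0 in this case, and the default value 2 / 0 = 0 is harmless; likewise for e
  -- and m.
  · refine ⟨2 / d, 2 / e, 1, by positivity, by positivity, zero_le_one, ?_, ?_, by positivity⟩
    · by_cases hk : k = 0
      · simp [hk]
      · rw [div_mul_cancel₀ _ fun h => h1 ⟨hk, h⟩]
        ring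
    · by_cases hk : m = 0
      · simp [hk]
      · rw [div_mul_cancel₀ _ fun h => h2 ⟨hk, h⟩]
        ring

theorem exists_perturbation (h₁ : 2 * ∑ l, D.a₁ l ≤ Fintype.card L)
    (h₂ : 2 * ∑ l, D.a₂ l ≤ Fintype.card L) :
    ∃ η, D.IsPerturbation η ∧ ∃ z, 0 < z ∧ ∀ s, ∑ t, η s t = z := by
  obtain ⟨c₁, c₂, c₃, p1, p2, p3, e1, e2, hz⟩ := exists_coefficients D.both D.swap.both
    (D.neither - D.both) (D.swap.neither - D.swap.both) D.both_nonneg D.swap.both_nonneg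
    (by rw [neither_eq]; linarith)
    (by rw [neither_eq]; change 0 ≤ _ - 2 * ∑ l, D.a₂ l + _ - _; linarith)
  refine ⟨_, ((D.isPerturbation_full.smul p1).add
    ((IsPerturbation.of_swap D.swap.isPerturbation_full).smul p2)).add
      (D.isPerturbation_even.smul p3), _, hz, fun s => ?_⟩
  have h1 := D.both_mul_eq_zero e1 s
  have h2 := D.swap.both_mul_eq_zero e2 s
  rw [Finset.sum_add_distrib, Finset.sum_add_distrib, ← Finset.mul_sum, ← Finset.mul_sum,
    ← Finset.mul_sum, sum_full_add, sum_full_add, sum_even]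
  linear_combination h1 + h2

end LetterTurns

/-! ### From perturbations to turn weights -/

section LetterTurns

variable {L P Q X X' Y Y' : Type}

/-- The indicator function of the elements corresponding to the second summand. -/
def indX (σ : L ≃ P ⊕ X ⊕ Y) (l : L) : ℚ :=
  Sum.elim (fun _ => 0) (Sum.elim (fun _ => 1) fun _ => 0) (σ l)

/-- The indicator function of the elements corresponding to the third summand. -/
def indY (σ : L ≃ P ⊕ X ⊕ Y) (l : L) : ℚ :=
  Sum.elim (fun _ => 0) (Sum.elim (fun _ => 0) fun _ => 1) (σ l)

theorem indX_cases (σ : L ≃ P ⊕ X ⊕ Y) (l : L) : indX σ l = 0 ∨ indX σ l = 1 := by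
  unfold indX
  rcases σ l with h | h | h <;> simp

theorem indY_cases (σ : L ≃ P ⊕ X ⊕ Y) (l : L) : indY σ l = 0 ∨ indY σ l = 1 := by
  unfold indY
  rcases σ l with h | h | h <;> simp

theorem indX_mul_indY (σ : L ≃ P ⊕ X ⊕ Y) (l : L) : indX σ l * indY σ l = 0 := by
  unfold indX indY
  rcases σ l with h | h | h <;> simp

theorem sum_eq_symm_inl [Fintype P] [DecidableEq L] (σ : L ≃ P ⊕ X ⊕ Y) (l : L) :
    (∑ h, if l = σ.symm (.inl h) then (1 : ℚ) else 0) = 1 - indX σ l - indY σ l := by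
  classical
  simp only [Equiv.eq_symm_apply]
  unfold indX indY
  rcases σ l with h | h | h <;> simp

namespace Corner

/-- The corners at `a⁺`. -/
def start : P ⊕ X ⊕ Y → Corner P Q X X' Y Y' := Sum.elim p (Sum.elim x y)

/-- The corners at `a⁻`. -/
def finish : P ⊕ X' ⊕ Y' → Corner P Q X X' Y Y' := Sum.elim p (Sum.elim x' y')

/-- The corner at `a⁺` as an element of the sum type. -/
def toStart : Corner P Q X X' Y Y' → Option (P ⊕ X ⊕ Y)
  | p h => some (.inl h)
  | x f => some (.inr (.inl f))
  | y g => some (.inr (.inr g))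
  | _ => none

/-- The corner at `a⁻` as an element of the sum type. -/
def toFinish : Corner P Q X X' Y Y' → Option (P ⊕ X' ⊕ Y')
  | p h => some (.inl h)
  | x' f => some (.inr (.inl f))
  | y' g => some (.inr (.inr g))
  | _ => none

theorem toStart_start (i : P ⊕ X ⊕ Y) :
    (start i : Corner P Q X X' Y Y').toStart = some i := by
  rcases i with h | f | g <;> rfl

theorem toFinish_finish (i : P ⊕ X' ⊕ Y') :
    (finish i : Corner P Q X X' Y Y').toFinish = some i := by
  rcases i with h | f | g <;> rfl

end Corner

/-- A function on pairs of optional elements, which is constantly one if one of them is missing. -/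
def optionTurn {A : Type} (F : A → A → ℚ) : Option A → Option A → ℚ
  | some i, some j => F i j
  | _, _ => 1

theorem optionTurn_comm {A : Type} {F : A → A → ℚ} (h : ∀ i j, F i j = F j i) (i j : Option A) :
    optionTurn F i j = optionTurn F j i := by
  cases i <;> cases j <;> simp [optionTurn, h]

theorem one_le_optionTurn {A : Type} {F : A → A → ℚ} (h : ∀ i j, 1 ≤ F i j) (i j : Option A) :
    1 ≤ optionTurn F i j := by
  cases i <;> cases j <;> simp [optionTurn, h]

variable [Fintype L] [Fintype P] [Fintype X] [Fintype Y]

theorem sum_indX_mul (σ : L ≃ P ⊕ X ⊕ Y) (F : L → ℚ) :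
    ∑ l, indX σ l * F l = ∑ f, F (σ.symm (.inr (.inl f))) := by
  rw [← σ.symm.sum_comp]
  simp [indX, Fintype.sum_sum_type]

theorem sum_indY_mul (σ : L ≃ P ⊕ X ⊕ Y) (F : L → ℚ) :
    ∑ l, indY σ l * F l = ∑ f, F (σ.symm (.inr (.inr f))) := by
  rw [← σ.symm.sum_comp]
  simp [indY, Fintype.sum_sum_type]

theorem sum_indX (σ : L ≃ P ⊕ X ⊕ Y) : ∑ l, indX σ l = Fintype.card X := by
  simpa using sum_indX_mul σ fun _ => 1

theorem sum_indY (σ : L ≃ P ⊕ X ⊕ Y) : ∑ l, indY σ l = Fintype.card Y := by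
  simpa using sum_indY_mul σ fun _ => 1

/-- The turns of the letters that start and end at the corners given by two equivalences. -/
def LetterTurns.ofEquiv [DecidableEq L] [Fintype X'] [Fintype Y'] (σ : L ≃ P ⊕ X ⊕ Y) (τ : L ≃ P ⊕ X' ⊕ Y')
    (hX : Fintype.card X = Fintype.card X') (hY : Fintype.card Y = Fintype.card Y') :
    LetterTurns L P where
  a₁ := indX σ
  a₂ := indY σ
  b₁ := indX τ
  b₂ := indY τ
  hm h := τ.symm (.inl h)
  hp h := σ.symm (.inl h)
  a₁_cases := indX_cases σ
  a₂_cases := indY_cases σ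
  b₁_cases := indX_cases τ
  b₂_cases := indY_cases τ
  a_mul := indX_mul_indY σ
  b_mul := indX_mul_indY τ
  b₁_hm h := by simp [indX]
  b₂_hm h := by simp [indY]
  a₁_hp h := by simp [indX]
  a₂_hp h := by simp [indY]
  hm_injective := τ.symm.injective.comp Sum.inl_injective
  hp_injective := σ.symm.injective.comp Sum.inl_injective
  sum_hm := sum_eq_symm_inl τ
  sum_hp := sum_eq_symm_inl σ
  sum₁ := by rw [sum_indX, sum_indX, hX]
  sum₂ := by rw [sum_indY, sum_indY, hY]

open Corner

/-- In the row of x f the entries at X vanish, so those at P and Y add up to z. The constant 1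
survives only in the turns with p, giving `card P`. -/
theorem row_eq_of_sum_eq (σ : L ≃ P ⊕ X ⊕ Y) (η : L → L → ℚ) (μ z : ℚ)
    (hz : ∀ s, ∑ t, η s t = z) (hcomm : ∀ s t, η s t = η t s)
    (h0 : ∀ s t, indX σ s = 1 → indX σ t = 1 → η s t = 0) (f : X) :
    ∑ h, (1 + μ * η (σ.symm (.inl h)) (σ.symm (.inr (.inl f)))) +
      ∑ g, (1 + μ * η (σ.symm (.inr (.inl f))) (σ.symm (.inr (.inr g))) - 1) =
      Fintype.card P + μ * z := by
  have h1 := hz (σ.symm (.inr (.inl f)))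
  rw [← σ.symm.sum_comp, Fintype.sum_sum_type, Fintype.sum_sum_type, Finset.sum_eq_zero (s :=
    (Finset.univ : Finset X)) fun f' _ => h0 _ _ (by simp [indX]) (by simp [indX]), zero_add] at h1
  simp only [add_sub_cancel_left, Finset.sum_add_distrib, ← Finset.mul_sum, Finset.sum_const,
    Finset.card_univ, nsmul_eq_mul, mul_one]
  rw [← h1, mul_add, add_assoc]
  simp only [hcomm (σ.symm (.inl _))]

theorem row_eq_of_sum_eq' (σ : L ≃ P ⊕ X ⊕ Y) (η : L → L → ℚ) (μ z : ℚ)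
    (hz : ∀ s, ∑ t, η s t = z) (hcomm : ∀ s t, η s t = η t s)
    (h0 : ∀ s t, indY σ s = 1 → indY σ t = 1 → η s t = 0) (g : Y) :
    ∑ h, (1 + μ * η (σ.symm (.inl h)) (σ.symm (.inr (.inr g)))) +
      ∑ f, (1 + μ * η (σ.symm (.inr (.inl f))) (σ.symm (.inr (.inr g))) - 1) =
      Fintype.card P + μ * z := by
  have h1 := hz (σ.symm (.inr (.inr g)))
  rw [← σ.symm.sum_comp, Fintype.sum_sum_type, Fintype.sum_sum_type, Finset.sum_eq_zero (s :=
    (Finset.univ : Finset Y)) fun f' _ => h0 _ _ (by simp [indY]) (by simp [indY]), add_zero] at h1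
  simp only [add_sub_cancel_left, Finset.sum_add_distrib, ← Finset.mul_sum, Finset.sum_const,
    Finset.card_univ, nsmul_eq_mul, mul_one]
  rw [← h1, mul_add, add_assoc]
  simp only [hcomm _ (σ.symm (.inr (.inr g)))]

/-- All turns are 1 + μη, with μ = (card Q - card P) / z chosen to bring the rows from `card P` up
to `card Q`. A letter l is seen through its initial corner σ l in `s` and its final corner τ l in
`e`, so both are given by the same η. -/
theorem exists_turnWeights [DecidableEq L] [Fintype Q] [Fintype X'] [Fintype Y'] (σ : L ≃ P ⊕ X ⊕ Y) (τ : L ≃ P ⊕ X' ⊕ Y')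
    (hX : Fintype.card X = Fintype.card X') (hY : Fintype.card Y = Fintype.card Y')
    (hx : Fintype.card X ≤ Fintype.card P + Fintype.card Y)
    (hy : Fintype.card Y ≤ Fintype.card P + Fintype.card X)
    (hpq : Fintype.card P ≤ Fintype.card Q) :
    ∃ N : TurnWeights P Q X X' Y Y', ∀ l l',
      N.s (start (σ l)) (start (σ l')) = N.e (finish (τ l)) (finish (τ l')) := by
  have hL : Fintype.card L = Fintype.card P + (Fintype.card X + Fintype.card Y) := by
    rw [Fintype.card_congr σ, Fintype.card_sum, Fintype.card_sum]
  obtain ⟨η, hη, z, hz, hsum⟩ := (LetterTurns.ofEquiv σ τ hX hY).exists_perturbation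
    (by
      change 2 * ∑ l, indX σ l ≤ _
      rw [sum_indX]
      exact_mod_cast (by omega))
    (by
      change 2 * ∑ l, indY σ l ≤ _
      rw [sum_indY]
      exact_mod_cast (by omega))
  obtain ⟨μ, hμ, hμz⟩ : ∃ μ : ℚ, 0 ≤ μ ∧ (Fintype.card P : ℚ) + μ * z = Fintype.card Q := by
    refine ⟨(Fintype.card Q - Fintype.card P) / z, div_nonneg (sub_nonneg.2 ?_) hz.le, ?_⟩
    · exact_mod_cast hpq
    · rw [div_mul_cancel₀ _ hz.ne']
      ring
  have h1 : ∀ s t, 1 ≤ 1 + μ * η s t := fun s t =>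
    le_add_of_nonneg_right (mul_nonneg hμ (hη.nonneg s t))
  have h2 : ∀ s t, 1 + μ * η s t = 1 + μ * η t s := fun s t => by rw [hη.comm]
  refine ⟨{
    s := fun c c' => optionTurn (fun i j => 1 + μ * η (σ.symm i) (σ.symm j)) c.toStart c'.toStart
    e := fun c c' => optionTurn (fun i j => 1 + μ * η (τ.symm i) (τ.symm j)) c.toFinish c'.toFinish
    s_comm := fun c c' => optionTurn_comm (fun _ _ => h2 _ _) _ _
    e_comm := fun c c' => optionTurn_comm (fun _ _ => h2 _ _) _ _
    one_le_s := fun c c' => one_le_optionTurn (fun _ _ => h1 _ _) _ _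
    one_le_e := fun c c' => one_le_optionTurn (fun _ _ => h1 _ _) _ _
    pp := fun h h' hne => (congrArg (fun x => 1 + μ * x) (hη.pp h h' hne)).symm
    s_xx := fun f f' => ?_
    s_yy := fun f f' => ?_
    e_xx := fun f f' => ?_
    e_yy := fun f f' => ?_
    sum_x := fun h => ?_
    sum_y := fun h => ?_
    row_x := fun f => (row_eq_of_sum_eq σ η μ z hsum hη.comm hη.a₁_zero f).trans hμz
    row_y := fun f => (row_eq_of_sum_eq' σ η μ z hsum hη.comm hη.a₂_zero f).trans hμz
    row_x' := fun f => (row_eq_of_sum_eq τ η μ z hsum hη.comm hη.b₁_zero f).trans hμz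
    row_y' := fun f => (row_eq_of_sum_eq' τ η μ z hsum hη.comm hη.b₂_zero f).trans hμz
    card_x := hX
    card_y := hY }, fun l l' => ?_⟩
  · change 1 + μ * η _ _ = 1
    rw [hη.a₁_zero _ _ (by simp [LetterTurns.ofEquiv, indX]) (by simp [LetterTurns.ofEquiv, indX]),
      mul_zero, add_zero]
  · change 1 + μ * η _ _ = 1
    rw [hη.a₂_zero _ _ (by simp [LetterTurns.ofEquiv, indY]) (by simp [LetterTurns.ofEquiv, indY]),
      mul_zero, add_zero]
  · change 1 + μ * η _ _ = 1
    rw [hη.b₁_zero _ _ (by simp [LetterTurns.ofEquiv, indX]) (by simp [LetterTurns.ofEquiv, indX]),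
      mul_zero, add_zero]
  · change 1 + μ * η _ _ = 1
    rw [hη.b₂_zero _ _ (by simp [LetterTurns.ofEquiv, indY]) (by simp [LetterTurns.ofEquiv, indY]),
      mul_zero, add_zero]
  · change ∑ f, (1 + μ * η (σ.symm (.inl h)) (σ.symm (.inr (.inl f)))) =
      ∑ f, (1 + μ * η (τ.symm (.inl h)) (τ.symm (.inr (.inl f))))
    have h3 : ∑ l, indX τ l * η l (τ.symm (.inl h)) = ∑ l, indX σ l * η l (σ.symm (.inl h)) :=
      hη.sum₁ h
    rw [sum_indX_mul, sum_indX_mul] at h3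
    simp only [Finset.sum_add_distrib, ← Finset.mul_sum, hη.comm (σ.symm (.inl h)),
      hη.comm (τ.symm (.inl h)), h3]
    simp [hX]
  · change ∑ f, (1 + μ * η (σ.symm (.inl h)) (σ.symm (.inr (.inr f)))) =
      ∑ f, (1 + μ * η (τ.symm (.inl h)) (τ.symm (.inr (.inr f))))
    have h3 : ∑ l, indY τ l * η l (τ.symm (.inl h)) = ∑ l, indY σ l * η l (σ.symm (.inl h)) :=
      hη.sum₂ h
    rw [sum_indY_mul, sum_indY_mul] at h3
    simp only [Finset.sum_add_distrib, ← Finset.mul_sum, hη.comm (σ.symm (.inl h)),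
      hη.comm (τ.symm (.inl h)), h3]
    simp [hY]
  · simp [toStart_start, toFinish_finish, optionTurn]

end LetterTurns

/-! ### Corners of words in two generators -/

section RankTwo

variable {n r : ℕ} {u : Fin r → FreeGroup (Fin n)}

theorem eq_or_eq_of_inc {c : Pos u} {d d' d'' : Letter n} (hd : Inc c d) (hd' : Inc c d')
    (hne : d ≠ d') (hd'' : Inc c d'') : d'' = d ∨ d'' = d' := by
  have h : ∀ e, Inc c e → e = letterAt u c ∨ e = (letterAt u ((nextPos u).symm c)).inv := by
    rintro e (h | h)
    · exact Or.inl h.symm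
    · exact Or.inr (by rw [h, Letter.inv_inv])
  rcases h d hd with h1 | h1 <;> rcases h d' hd' with h2 | h2 <;> rcases h d'' hd'' with h3 | h3 <;>
    simp_all

theorem exists_inc_inc (hcyc : ∀ j, FreeGroup.IsCyclicallyReduced (u j).toWord) (c : Pos u) :
    ∃ d d', d ≠ d' ∧ Inc c d ∧ Inc c d' := by
  refine ⟨letterAt u c, (letterAt u ((nextPos u).symm c)).inv, ?_, Or.inl rfl,
    Or.inr (Letter.inv_inv _).symm⟩
  have := letterAt_nextPos_ne hcyc ((nextPos u).symm c)
  rwa [Equiv.apply_symm_apply] at this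

/-- The corners that join two given directions. -/
abbrev Joining (u : Fin r → FreeGroup (Fin n)) (d d' : Letter n) : Type :=
  {c : Pos u // Inc c d ∧ Inc c d'}

/-- The corners of a list of words in two generators, sorted by the directions that they join. -/
abbrev WordCorner (u : Fin r → FreeGroup (Fin n)) (gen : Bool ≃ Fin n) : Type :=
  Corner (Joining u (gen false, true) (gen false, false))
    (Joining u (gen true, true) (gen true, false)) (Joining u (gen false, true) (gen true, true))
    (Joining u (gen false, false) (gen true, false))
    (Joining u (gen false, true) (gen true, false)) (Joining u (gen false, false) (gen true, true))

variable (gen : Bool ≃ Fin n)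

/-- The position of a corner. -/
def cornerPos : WordCorner u gen → Pos u
  | .p c => c.1
  | .q c => c.1
  | .x c => c.1
  | .x' c => c.1
  | .y c => c.1
  | .y' c => c.1

theorem inc_iff_of_inc {c : Pos u} {i j : Bool} {s t : Bool} (h : Inc c (gen i, s))
    (h' : Inc c (gen j, t)) (hne : ¬ (i = j ∧ s = t)) (g v : Bool) :
    Inc c (gen g, v) ↔ (g = i ∧ v = s) ∨ (g = j ∧ v = t) := by
  constructor
  · intro h1
    have := eq_or_eq_of_inc h h' (fun h2 => hne ⟨gen.injective (Prod.ext_iff.1 h2).1,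
      (Prod.ext_iff.1 h2).2⟩) h1
    simpa [Prod.ext_iff, gen.injective.eq_iff] using this
  · rintro (⟨rfl, rfl⟩ | ⟨rfl, rfl⟩)
    exacts [h, h']

theorem inc_cornerPos (k : WordCorner u gen) (g s : Bool) :
    Inc (cornerPos gen k) (gen g, s) ↔ k.inc g s := by
  rcases k with c | c | c | c | c | c <;>
    refine (inc_iff_of_inc gen c.2.1 c.2.2 (by simp) g s).trans ?_ <;>
    cases g <;> cases s <;> simp [Corner.inc]

/-- A corner joins exactly two of the four directions, and the six types are the six pairs of
directions. -/
theorem cornerPos_bijective (hcyc : ∀ j, FreeGroup.IsCyclicallyReduced (u j).toWord) :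
    Function.Bijective (cornerPos (u := u) gen) := by
  constructor
  · intro k k' h
    have h1 : ∀ g s, k.inc g s = k'.inc g s := fun g s => by
      rw [Bool.eq_iff_iff, ← inc_cornerPos, ← inc_cornerPos, h]
    have h2 := h1 false false
    have h3 := h1 true true
    have h4 := h1 false true
    clear h1
    cases k <;> cases k' <;> first
      | exact congrArg _ (Subtype.ext h)
      | (clear h; simp [Corner.inc] at h2 h3 h4)
  · intro c
    obtain ⟨⟨g, s⟩, ⟨g', s'⟩, hne, h, h'⟩ := exists_inc_inc hcyc c
    obtain ⟨g, rfl⟩ := gen.surjective g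
    obtain ⟨g', rfl⟩ := gen.surjective g'
    cases g <;> cases s <;> cases g' <;> cases s' <;> first
      | exact absurd rfl hne
      | exact ⟨.p ⟨c, h, h'⟩, rfl⟩
      | exact ⟨.p ⟨c, h', h⟩, rfl⟩
      | exact ⟨.q ⟨c, h, h'⟩, rfl⟩
      | exact ⟨.q ⟨c, h', h⟩, rfl⟩
      | exact ⟨.x ⟨c, h, h'⟩, rfl⟩
      | exact ⟨.x ⟨c, h', h⟩, rfl⟩
      | exact ⟨.x' ⟨c, h, h'⟩, rfl⟩
      | exact ⟨.x' ⟨c, h', h⟩, rfl⟩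
      | exact ⟨.y ⟨c, h, h'⟩, rfl⟩
      | exact ⟨.y ⟨c, h', h⟩, rfl⟩
      | exact ⟨.y' ⟨c, h, h'⟩, rfl⟩
      | exact ⟨.y' ⟨c, h', h⟩, rfl⟩

/-- The corners correspond to the positions. -/
noncomputable def cornerEquiv (hcyc : ∀ j, FreeGroup.IsCyclicallyReduced (u j).toWord) :
    WordCorner u gen ≃ Pos u := Equiv.ofBijective _ (cornerPos_bijective gen hcyc)

theorem inc_cornerEquiv (hcyc : ∀ j, FreeGroup.IsCyclicallyReduced (u j).toWord)
    (k : WordCorner u gen) (g s : Bool) :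
    Inc (cornerEquiv gen hcyc k) (gen g, s) ↔ k.inc g s := inc_cornerPos gen k g s

theorem inc_cornerEquiv_symm (hcyc : ∀ j, FreeGroup.IsCyclicallyReduced (u j).toWord)
    (c : Pos u) (g s : Bool) :
    ((cornerEquiv gen hcyc).symm c).inc g s ↔ Inc c (gen g, s) := by
  rw [← inc_cornerEquiv gen hcyc, Equiv.apply_symm_apply]

/-- The corners at the beginnings and at the ends of the letters of a generator correspond. -/
noncomputable def acrossEquiv (hcyc : ∀ j, FreeGroup.IsCyclicallyReduced (u j).toWord) (g : Bool) :
    {k : WordCorner u gen // k.inc g true} ≃ {k : WordCorner u gen // k.inc g false} where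
  toFun k := ⟨(cornerEquiv gen hcyc).symm (across (gen g, true) (cornerEquiv gen hcyc k.1)),
    (inc_cornerEquiv_symm gen hcyc _ g false).2
      (inc_across ((inc_cornerEquiv gen hcyc _ g true).2 k.2))⟩
  invFun k := ⟨(cornerEquiv gen hcyc).symm (across (gen g, false) (cornerEquiv gen hcyc k.1)),
    (inc_cornerEquiv_symm gen hcyc _ g true).2
      (inc_across ((inc_cornerEquiv gen hcyc _ g false).2 k.2))⟩
  left_inv k := Subtype.ext (by
    have := across_across hcyc ((inc_cornerEquiv gen hcyc _ g true).2 k.2)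
    change (cornerEquiv gen hcyc).symm (across (gen g, false) (cornerEquiv gen hcyc
      ((cornerEquiv gen hcyc).symm (across (gen g, true) (cornerEquiv gen hcyc k.1))))) = k.1
    rw [Equiv.apply_symm_apply, Equiv.symm_apply_eq]
    exact this)
  right_inv k := Subtype.ext (by
    have := across_across hcyc ((inc_cornerEquiv gen hcyc _ g false).2 k.2)
    change (cornerEquiv gen hcyc).symm (across (gen g, true) (cornerEquiv gen hcyc
      ((cornerEquiv gen hcyc).symm (across (gen g, false) (cornerEquiv gen hcyc k.1))))) = k.1
    rw [Equiv.apply_symm_apply, Equiv.symm_apply_eq]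
    exact this)

end RankTwo

namespace Corner

variable {P Q X X' Y Y' : Type}

/-- The corners at `b⁺`. -/
def startB : Q ⊕ X ⊕ Y' → Corner P Q X X' Y Y' := Sum.elim q (Sum.elim x y')

/-- The corners at `b⁻`. -/
def finishB : Q ⊕ X' ⊕ Y → Corner P Q X X' Y Y' := Sum.elim q (Sum.elim x' y)

theorem range_start : Set.range (start : _ → Corner P Q X X' Y Y') = {c | c.inc false true} := by
  ext c
  cases c <;> simp [start, inc]

theorem range_finish : Set.range (finish : _ → Corner P Q X X' Y Y') = {c | c.inc false false} := by
  ext c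
  cases c <;> simp [finish, inc]

theorem range_startB : Set.range (startB : _ → Corner P Q X X' Y Y') = {c | c.inc true true} := by
  ext c
  cases c <;> simp [startB, inc]

theorem range_finishB : Set.range (finishB : _ → Corner P Q X X' Y Y') = {c | c.inc true false} := by
  ext c
  cases c <;> simp [finishB, inc]

theorem start_injective : Function.Injective (start : _ → Corner P Q X X' Y Y') := by
  rintro (h | h | h) (h' | h' | h') <;> simp [start]

theorem finish_injective : Function.Injective (finish : _ → Corner P Q X X' Y Y') := by
  rintro (h | h | h) (h' | h' | h') <;> simp [finish]

theorem startB_injective : Function.Injective (startB : _ → Corner P Q X X' Y Y') := by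
  rintro (h | h | h) (h' | h' | h') <;> simp [startB]

theorem finishB_injective : Function.Injective (finishB : _ → Corner P Q X X' Y Y') := by
  rintro (h | h | h) (h' | h' | h') <;> simp [finishB]

/-- The corners at a direction, given by an injective function with the right range. -/
noncomputable def equivOfRange {A : Type} {F : A → Corner P Q X X' Y Y'}
    (hF : Function.Injective F) {g s : Bool} (h : Set.range F = {c | c.inc g s}) :
    A ≃ {c : Corner P Q X X' Y Y' // c.inc g s} :=
  (Equiv.ofInjective F hF).trans (Equiv.setCongr h)

theorem equivOfRange_symm {A : Type} {F : A → Corner P Q X X' Y Y'}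
    (hF : Function.Injective F) {g s : Bool} (h : Set.range F = {c | c.inc g s})
    (c : {c : Corner P Q X X' Y Y' // c.inc g s}) : F ((equivOfRange hF h).symm c) = c.1 :=
  congrArg Subtype.val ((equivOfRange hF h).apply_symm_apply c)

end Corner

section RankTwo

variable {n r : ℕ} {u : Fin r → FreeGroup (Fin n)} (gen : Bool ≃ Fin n)

open Corner

theorem isCycleSet_of_isCycle (hcyc : ∀ j, FreeGroup.IsCyclicallyReduced (u j).toWord)
    {H : Set (WordCorner u gen)} (hH : IsCycle H) :
    IsCycleSet {c | (cornerEquiv gen hcyc).symm c ∈ H} := by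
  rintro ⟨g, s⟩ c hc hd
  obtain ⟨g, rfl⟩ := gen.surjective g
  rcases hH g s with h | ⟨c₁, c₂, hne, h⟩
  · exact absurd ((inc_cornerEquiv_symm gen hcyc c g s).2 hd) (h _ hc)
  · have key : ∀ c', (c' ∈ {c | (cornerEquiv gen hcyc).symm c ∈ H} ∧ Inc c' (gen g, s)) ↔
        c' = cornerEquiv gen hcyc c₁ ∨ c' = cornerEquiv gen hcyc c₂ := fun c' => by
      rw [← Equiv.symm_apply_eq, ← Equiv.symm_apply_eq, ← h,
        ← inc_cornerEquiv_symm gen hcyc c' g s]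
      rfl
    have hne' : cornerEquiv gen hcyc c₁ ≠ cornerEquiv gen hcyc c₂ :=
      fun h => hne ((cornerEquiv gen hcyc).injective h)
    simp only [← and_assoc, key]
    rcases (key c).1 ⟨hc, hd⟩ with rfl | rfl
    · exact ⟨_, ⟨Or.inr rfl, hne'.symm⟩, fun y hy => hy.1.resolve_left hy.2⟩
    · exact ⟨_, ⟨Or.inl rfl, hne'⟩, fun y hy => hy.1.resolve_right hy.2⟩

theorem isPolygonal_of_card_le (hcyc : ∀ j, FreeGroup.IsCyclicallyReduced (u j).toWord)
    (hx : Nat.card (Joining u (gen false, true) (gen true, true)) ≤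
      Nat.card (Joining u (gen false, true) (gen false, false)) +
      Nat.card (Joining u (gen false, true) (gen true, false)))
    (hy : Nat.card (Joining u (gen false, true) (gen true, false)) ≤
      Nat.card (Joining u (gen false, true) (gen false, false)) +
      Nat.card (Joining u (gen false, true) (gen true, true)))
    (hpq : Nat.card (Joining u (gen false, true) (gen false, false)) ≤
      Nat.card (Joining u (gen true, true) (gen true, false)))
    (hpos : 0 < Nat.card (Joining u (gen false, true) (gen true, true)) +
      Nat.card (Joining u (gen false, true) (gen true, false))) : IsPolygonal u := by
  let _ : ∀ d d', Fintype (Joining u d d') := fun _ _ => Fintype.ofFinite _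
  let _ : ∀ d d', DecidableEq (Joining u d d') := fun _ _ => Classical.decEq _
  let _ : DecidableEq (WordCorner u gen) := instDecidableEqCorner
  simp only [Nat.card_eq_fintype_card] at hx hy hpq hpos
  let S := equivOfRange start_injective (range_start (P := Joining u (gen false, true)
    (gen false, false)) (Q := Joining u (gen true, true) (gen true, false))
    (X := Joining u (gen false, true) (gen true, true))
    (X' := Joining u (gen false, false) (gen true, false))
    (Y := Joining u (gen false, true) (gen true, false))
    (Y' := Joining u (gen false, false) (gen true, true)))
  let E := equivOfRange finish_injective (range_finish (P := Joining u (gen false, true)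
    (gen false, false)) (Q := Joining u (gen true, true) (gen true, false))
    (X := Joining u (gen false, true) (gen true, true))
    (X' := Joining u (gen false, false) (gen true, false))
    (Y := Joining u (gen false, true) (gen true, false))
    (Y' := Joining u (gen false, false) (gen true, true)))
  let SB := equivOfRange startB_injective (range_startB (P := Joining u (gen false, true)
    (gen false, false)) (Q := Joining u (gen true, true) (gen true, false))
    (X := Joining u (gen false, true) (gen true, true))
    (X' := Joining u (gen false, false) (gen true, false))
    (Y := Joining u (gen false, true) (gen true, false))
    (Y' := Joining u (gen false, false) (gen true, true)))
  let EB := equivOfRange finishB_injective (range_finishB (P := Joining u (gen false, true)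
    (gen false, false)) (Q := Joining u (gen true, true) (gen true, false))
    (X := Joining u (gen false, true) (gen true, true))
    (X' := Joining u (gen false, false) (gen true, false))
    (Y := Joining u (gen false, true) (gen true, false))
    (Y' := Joining u (gen false, false) (gen true, true)))
  have e1 : ∀ c, start (S.symm c) = c.1 := equivOfRange_symm _ _
  have e2 : ∀ c, finish (E.symm c) = c.1 := equivOfRange_symm _ _
  -- Comparing the two ends of the letters of a, and likewise of b, gives X + Y = X' + Y' and X + Y'
  -- = X' + Y for the cardinalities. Hence X = X' and Y = Y'.
  have cA := Fintype.card_congr (S.trans ((acrossEquiv gen hcyc false).trans E.symm))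
  have cB := Fintype.card_congr (SB.trans ((acrossEquiv gen hcyc true).trans EB.symm))
  simp only [Fintype.card_sum] at cA cB
  obtain ⟨N, hN⟩ := exists_turnWeights S.symm ((acrossEquiv gen hcyc false).trans E.symm)
    (by omega) (by omega) hx hy hpq
  have hpair : ∀ c c', pairWeight N.weight
      (fun k => {c | (cornerEquiv gen hcyc).symm c ∈ cycle k}) c c' =
      N.total ((cornerEquiv gen hcyc).symm c) ((cornerEquiv gen hcyc).symm c') := fun c c' => rfl
  refine isPolygonal_of_weights hcyc N.weight N.weight_nonneg
    (fun k => {c | (cornerEquiv gen hcyc).symm c ∈ cycle k})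
    (fun k hk => isCycleSet_of_isCycle gen hcyc (N.isCycle_cycle hk)) ?_ ?_
  · intro g c c' hne hc hc'
    obtain ⟨g, rfl⟩ := gen.surjective g
    have hne' : across (gen g, true) c ≠ across (gen g, true) c' := fun h => hne (by
      rw [← across_across hcyc hc, h, across_across hcyc hc'])
    have h1 := (inc_cornerEquiv_symm gen hcyc c g true).2 hc
    have h2 := (inc_cornerEquiv_symm gen hcyc c' g true).2 hc'
    have h3 := (inc_cornerEquiv_symm gen hcyc _ g false).2 (inc_across hc)
    have h4 := (inc_cornerEquiv_symm gen hcyc _ g false).2 (inc_across hc')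
    have n1 := fun h => hne ((cornerEquiv gen hcyc).symm.injective h)
    have n2 := fun h => hne' ((cornerEquiv gen hcyc).symm.injective h)
    rw [hpair, hpair]
    cases g
    · rw [N.total_s n1 h1 h2, N.total_e n2 h3 h4]
      have h5 := hN ⟨_, h1⟩ ⟨_, h2⟩
      rw [e1, e1] at h5
      refine h5.trans ?_
      simp only [Equiv.trans_apply]
      rw [e2, e2]
      simp [acrossEquiv]
    · rw [N.total_b n1 h1 h2, N.total_b n2 h3 h4]
  -- If only one of X and Y is nonempty, then `hx` or `hy` provides a corner p, and `hpq` a corner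
  -- q.
  · obtain ⟨k, hk, c, c₁, c₂, i, s, j, t, m0, m1, m2, i1, i2, i3, i4, d1, d2, d3⟩ :=
      N.exists_long (by
        simp only [← Fintype.card_pos_iff]
        omega)
    refine ⟨k, hk, cornerEquiv gen hcyc c, cornerEquiv gen hcyc c₁, cornerEquiv gen hcyc c₂,
      (gen i, s), (gen j, t), ?_⟩
    simpa [inc_cornerEquiv, m0, m1, m2, i1, i2, i3, i4, d1, d2] using d3

end RankTwo

/-! ### Whitehead automorphisms and minimality -/

section Whitehead

variable {n : ℕ}

/-- The element of the free group given by a letter. -/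
def Letter.elem (x : Letter n) : FreeGroup (Fin n) := FreeGroup.mk [x]

theorem Letter.elem_inv (x : Letter n) : x.inv.elem = x.elem⁻¹ := by
  simp [Letter.elem, Letter.inv, FreeGroup.invRev]

theorem Letter.elem_true (g : Fin n) : Letter.elem (g, true) = FreeGroup.of g := rfl

theorem Letter.elem_false (g : Fin n) : Letter.elem (g, false) = (FreeGroup.of g)⁻¹ :=
  Letter.elem_inv (g, true)

theorem Letter.norm_elem (x : Letter n) : x.elem.norm = 1 := by
  simp [Letter.elem, FreeGroup.norm]

theorem FreeGroup.mk_eq_prod_elem (L : List (Letter n)) :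
    FreeGroup.mk L = (L.map Letter.elem).prod := by
  induction L with
  | nil => rfl
  | cons x L ih =>
    rw [List.map_cons, List.prod_cons, ← ih, Letter.elem, FreeGroup.mul_mk]
    rfl

theorem FreeGroup.eq_prod_ofFn (w : FreeGroup (Fin n)) :
    w = (List.ofFn fun k : Fin w.toWord.length => Letter.elem (w.toWord.get k)).prod := by
  conv_lhs => rw [← FreeGroup.mk_toWord (x := w), FreeGroup.mk_eq_prod_elem]
  congr 1
  exact List.ext_getElem (by simp) fun i h1 h2 => by simp

theorem FreeGroup.norm_prod_le (L : List (FreeGroup (Fin n))) :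
    L.prod.norm ≤ (L.map FreeGroup.norm).sum := by
  induction L with
  | nil => simp
  | cons x L ih =>
    rw [List.prod_cons, List.map_cons, List.sum_cons]
    exact (FreeGroup.norm_mul_le _ _).trans (Nat.add_le_add_left ih _)

theorem List.prod_ofFn_telescope {G : Type*} [Group G] (l : ℕ) (F : Fin l → G) (D : ℕ → G) :
    (List.ofFn fun k : Fin l => (D k)⁻¹ * F k * D (k + 1)).prod =
      (D 0)⁻¹ * (List.ofFn F).prod * D l := by
  induction l generalizing D with
  | zero => simp
  | succ l ih =>
    have h := ih (fun k => F k.succ) fun k => D (k + 1)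
    simp only [List.ofFn_succ, List.prod_cons, Fin.val_zero, Fin.val_succ] at h ⊢
    rw [h]
    group

/-- The factors D telescope round the circle, leaving one conjugation. In this way cancellations in
the image of a cyclic word can be shared out among its letters. -/
theorem isConj_prod_ofFn {G : Type*} [Group G] {l : ℕ} (F D : Fin l → G) :
    IsConj (List.ofFn F).prod
      (List.ofFn fun k => (D k)⁻¹ * F k * D (finRotate l k)).prod := by
  rcases Nat.eq_zero_or_pos l with rfl | hl
  · simp
  · have h := List.prod_ofFn_telescope l F fun k => D ⟨k % l, Nat.mod_lt _ hl⟩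
    have h1 : ∀ k : Fin l, D ⟨k % l, Nat.mod_lt _ hl⟩ = D k := fun k =>
      congrArg D (Fin.ext (Nat.mod_eq_of_lt k.2))
    have h2 : ∀ k : Fin l, D ⟨(k + 1) % l, Nat.mod_lt _ hl⟩ = D (finRotate l k) := fun k =>
      congrArg D (Fin.ext (val_finRotate k).symm)
    simp only [h1, h2, Nat.mod_self, Nat.zero_mod] at h
    rw [h, isConj_iff]
    exact ⟨(D ⟨0, hl⟩)⁻¹, by group⟩

/-- The endomorphism of the free group which multiplies the generator `g` by `w` on the left. -/
def leftTransvection (g : Fin n) (w : FreeGroup (Fin n)) :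
    FreeGroup (Fin n) →* FreeGroup (Fin n) :=
  FreeGroup.lift fun i => if i = g then w * FreeGroup.of g else FreeGroup.of i

theorem leftTransvection_elem {g : Fin n} (w : FreeGroup (Fin n)) {z : Letter n} (hz : z.1 ≠ g) :
    leftTransvection g w z.elem = z.elem := by
  rcases z with ⟨i, _ | _⟩
  · rw [Letter.elem_false, map_inv, leftTransvection, FreeGroup.lift_apply_of, if_neg hz]
  · rw [Letter.elem_true, leftTransvection, FreeGroup.lift_apply_of, if_neg hz]

theorem leftTransvection_of (g : Fin n) (w : FreeGroup (Fin n)) :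
    leftTransvection g w (FreeGroup.of g) = w * FreeGroup.of g := by
  rw [leftTransvection, FreeGroup.lift_apply_of, if_pos rfl]

theorem leftTransvection_comp {g : Fin n} {v w : FreeGroup (Fin n)}
    (hw : leftTransvection g v w = w) (hvw : w * v = 1) :
    (leftTransvection g v).comp (leftTransvection g w) = MonoidHom.id _ := by
  refine FreeGroup.ext_hom _ _ fun i => ?_
  by_cases hi : i = g
  · subst hi
    rw [MonoidHom.comp_apply, leftTransvection_of, map_mul, leftTransvection_of, hw, ← mul_assoc,
      hvw, one_mul, MonoidHom.id_apply]
  · rw [MonoidHom.comp_apply, ← Letter.elem_true, leftTransvection_elem _ hi,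
      leftTransvection_elem _ hi, MonoidHom.id_apply]

/-- The automorphism of the free group which multiplies the generator `g` by a letter of another
generator on the left. -/
def transvection (g : Fin n) (z : Letter n) (hz : z.1 ≠ g) :
    FreeGroup (Fin n) ≃* FreeGroup (Fin n) :=
  MonoidHom.toMulEquiv (leftTransvection g z.elem) (leftTransvection g z.elem⁻¹)
    (leftTransvection_comp (leftTransvection_elem _ hz) (mul_inv_cancel _))
    (leftTransvection_comp (by rw [map_inv, leftTransvection_elem _ hz]) (inv_mul_cancel _))

section

variable {g : Fin n} {z : Letter n} (hz : z.1 ≠ g)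

theorem transvection_elem {x : Letter n} (hx : x.1 ≠ g) : transvection g z hz x.elem = x.elem :=
  leftTransvection_elem _ hx

theorem transvection_elem_true :
    transvection g z hz (Letter.elem (g, true)) = z.elem * Letter.elem (g, true) :=
  leftTransvection_of g _

theorem transvection_elem_false :
    transvection g z hz (Letter.elem (g, false)) = Letter.elem (g, false) * z.elem⁻¹ := by
  rw [show Letter.elem (g, false) = (Letter.elem (g, true))⁻¹ from Letter.elem_false g, map_inv,
    transvection_elem_true, mul_inv_rev]

/-- The element by which the images of two consecutive letters are separated. -/
def separator (g : Fin n) (z x y : Letter n) : FreeGroup (Fin n) :=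
  if x = (g, false) ∨ x = z.inv ∧ y = (g, true) then z.elem else 1

/-- Let w, x, y be consecutive letters. Under g ↦ z g, the separator hands the z⁻¹ arising after g⁻¹
on to the next letter, and the z arising before g back to a preceding z⁻¹. Cancellation at a corner
g⁻¹ z saves two at the letter z; at a corner z⁻¹ g it saves one at each of the two letters. -/
theorem norm_separated_le {w x y : Letter n} (hx : x ≠ w.inv) (hy : y ≠ x.inv) :
    ((separator g z w x)⁻¹ * transvection g z hz x.elem * separator g z x y).norm +
      (if w = z.inv ∧ x = (g, true) then 1 else 0) + (if x = z.inv ∧ y = (g, true) then 1 else 0) +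
      2 * (if w = (g, false) ∧ x = z then 1 else 0) ≤
    1 + (if x = (g, true) then 1 else 0) + (if w = (g, false) then 1 else 0) := by
  have hzg : ∀ s, z ≠ (g, s) := fun s h => hz (congrArg Prod.fst h)
  have hzg' : ∀ s, z.inv ≠ (g, s) := fun s h => hz (congrArg Prod.fst h)
  have n1 : ∀ a b : Letter n, (a.elem⁻¹ * b.elem).norm ≤ 2 := fun a b =>
    (FreeGroup.norm_mul_le _ _).trans (by
      rw [FreeGroup.norm_inv_eq, Letter.norm_elem, Letter.norm_elem])
  have n2 : ∀ a b : Letter n, (a.elem * b.elem).norm ≤ 2 := fun a b =>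
    (FreeGroup.norm_mul_le _ _).trans (by rw [Letter.norm_elem, Letter.norm_elem])
  have n3 : ∀ a : Letter n, (a.elem).norm ≤ 1 := fun a => (Letter.norm_elem a).le
  rcases x with ⟨i, s⟩
  by_cases hg : i = g
  · subst hg
    cases s
    · have h1 : separator i z (i, false) y = z.elem := if_pos (Or.inl rfl)
      rw [h1, transvection_elem_false]
      by_cases hw : w = (i, false)
      · subst hw
        have h2 : separator i z (i, false) (i, false) = z.elem := if_pos (Or.inl rfl)
        have := n1 z (i, false)
        simpa [h2, mul_assoc, (hzg _).symm, (hzg' _).symm] using this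
      · have h2 : separator i z w (i, false) = 1 := if_neg (by simp [hw])
        have := n3 (i, false)
        simpa [h2, hw, mul_assoc, (hzg' _).symm] using this
    · have hw : w ≠ (i, false) := fun h => hx (by rw [h]; rfl)
      have h1 : separator i z (i, true) y = 1 := if_neg (by simp [(hzg' _).symm])
      rw [h1, transvection_elem_true]
      by_cases hw' : w = z.inv
      · subst hw'
        have h2 : separator i z z.inv (i, true) = z.elem := if_pos (Or.inr ⟨rfl, rfl⟩)
        have := n3 (i, true)
        simpa [h2, hw, (hzg' _), (hzg' _).symm] using this
      · have h2 : separator i z w (i, true) = 1 := if_neg (by simp [hw, hw'])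
        have := n2 z (i, true)
        simpa [h2, hw, hw', (hzg' _).symm] using this
  · have hxg : ∀ s', ((i, s) : Letter n) ≠ (g, s') := fun s' h => hg (congrArg Prod.fst h)
    rw [transvection_elem hz hg]
    generalize ((i, s) : Letter n) = x at hxg hx hy
    have h0 : separator g z w x = if w = (g, false) then z.elem else 1 := by
      simp [separator, hxg]
    have h0' : separator g z x y = if x = z.inv ∧ y = (g, true) then z.elem else 1 := by
      simp [separator, hxg]
    rw [h0, h0']
    by_cases hxz : x = z
    · subst hxz
      by_cases hw : w = (g, false)
      · simp [hw, hzg, (Letter.inv_ne x).symm]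
      · simp [hw, hzg, (Letter.inv_ne x).symm, n3]
    · by_cases hxz' : x = z.inv
      · by_cases hyg : y = (g, true)
        · by_cases hw : w = (g, false)
          · simp [hw, hyg, hxz', hzg', Letter.elem_inv, FreeGroup.norm_inv_eq, n3, Letter.inv_ne]
          · simp [hw, hyg, hxz', hzg', Letter.elem_inv]
        · by_cases hw : w = (g, false)
          · simpa [hw, hyg, hxz', hzg', Letter.inv_ne] using n1 z z.inv
          · simp [hw, hyg, hxz', hzg', n3]
      · by_cases hw : w = (g, false)
        · simpa [hw, hxz, hxz', hxg] using n1 z x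
        · simp [hw, hxz', hxg, n3]

end

variable {r : ℕ} {u : Fin r → FreeGroup (Fin n)}

theorem card_pos_eq_sum_norm : Fintype.card (Pos u) = ∑ j, (u j).norm := by
  simp [FreeGroup.norm]

/-- Summing over all positions, g ↦ z g lengthens the list by at most the number of corners at g⁺
minus twice the number joining g⁺ to z. By minimality this is nonnegative. -/
theorem two_mul_card_joining_le (hcyc : ∀ j, FreeGroup.IsCyclicallyReduced (u j).toWord)
    (hmin : IsMinimalList u) {g : Fin n} {z : Letter n} (hz : z.1 ≠ g) :
    2 * Nat.card (Joining u (g, true) z) ≤ Nat.card {c : Pos u // Inc c (g, true)} := by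
  classical
  let D : Pos u → FreeGroup (Fin n) := fun c =>
    separator g z (letterAt u ((nextPos u).symm c)) (letterAt u c)
  let F : Pos u → FreeGroup (Fin n) := fun c => transvection g z hz (letterAt u c).elem
  let v : Fin r → FreeGroup (Fin n) := fun j =>
    (List.ofFn fun k => (D ⟨j, k⟩)⁻¹ * F ⟨j, k⟩ * D ⟨j, finRotate _ k⟩).prod
  have h1 : ∑ j, (u j).norm ≤ ∑ j, (v j).norm := by
    refine hmin (transvection g z hz) v fun j => ?_
    have h := isConj_prod_ofFn (fun k => F ⟨j, k⟩) fun k => D ⟨j, k⟩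
    convert h using 1
    conv_lhs => rw [FreeGroup.eq_prod_ofFn (u j), map_list_prod, List.map_ofFn]
    rfl
  have h2 : ∑ j, (v j).norm ≤ ∑ c, ((D c)⁻¹ * F c * D (nextPos u c)).norm := by
    rw [Fintype.sum_sigma]
    refine Finset.sum_le_sum fun j _ => (FreeGroup.norm_prod_le _).trans (le_of_eq ?_)
    rw [List.map_ofFn, List.sum_ofFn]
    rfl
  have h3 := Finset.sum_le_sum fun (c : Pos u) (_ : c ∈ Finset.univ) =>
    norm_separated_le hz (w := letterAt u ((nextPos u).symm c)) (x := letterAt u c)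
      (y := letterAt u (nextPos u c)) (by
        have := letterAt_nextPos_ne hcyc ((nextPos u).symm c)
        rwa [Equiv.apply_symm_apply] at this) (letterAt_nextPos_ne hcyc c)
  have h4 : ∀ c, D (nextPos u c) = separator g z (letterAt u c) (letterAt u (nextPos u c)) :=
    fun c => by simp only [D, Equiv.symm_apply_apply]
  simp only [h4] at h2
  simp only [Finset.sum_add_distrib, ← Finset.mul_sum] at h3
  -- The two halves of the saving at a corner z⁻¹ g are recorded at consecutive positions; a cyclic
  -- shift identifies the sums.
  have h5 : ∑ c : Pos u, (if letterAt u c = z.inv ∧ letterAt u (nextPos u c) = (g, true)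
      then 1 else 0) = ∑ c : Pos u, (if letterAt u ((nextPos u).symm c) = z.inv ∧
      letterAt u c = (g, true) then 1 else 0) := by
    rw [← Equiv.sum_comp (nextPos u) fun c => if letterAt u ((nextPos u).symm c) = z.inv ∧
      letterAt u c = (g, true) then 1 else 0]
    simp only [Equiv.symm_apply_apply]
  have hne : ∀ c : Pos u, letterAt u c = (g, true) →
      letterAt u ((nextPos u).symm c) ≠ (g, false) := fun c h h' => by
    have := letterAt_nextPos_ne hcyc ((nextPos u).symm c)
    rw [Equiv.apply_symm_apply, h, h'] at this
    exact this rfl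
  have hzg : ∀ s, ((g, s) : Letter n) ≠ z := fun s h => hz (congrArg Prod.fst h).symm
  have hzg' : ∀ s, ((g, s) : Letter n) ≠ z.inv := fun s h => hz (congrArg Prod.fst h).symm
  have hinv : Letter.inv (g, true) = (g, false) := rfl
  have h6 : Nat.card (Joining u (g, true) z) =
      ∑ c : Pos u, (if letterAt u ((nextPos u).symm c) = z.inv ∧ letterAt u c = (g, true)
        then 1 else 0) +
      ∑ c : Pos u, (if letterAt u ((nextPos u).symm c) = (g, false) ∧ letterAt u c = z
        then 1 else 0) := by
    rw [Nat.card_eq_fintype_card, Fintype.card_subtype, Finset.card_filter,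
      ← Finset.sum_add_distrib]
    refine Finset.sum_congr rfl fun c _ => ?_
    unfold Inc
    rw [hinv]
    by_cases e1 : letterAt u c = (g, true)
    · simp [e1, hne c e1, hzg]
    · by_cases e2 : letterAt u ((nextPos u).symm c) = (g, false)
      · simp [e1, e2, hzg']
      · simp [e1, e2]
  have h7 : Nat.card {c : Pos u // Inc c (g, true)} =
      ∑ c : Pos u, (if letterAt u c = (g, true) then 1 else 0) +
      ∑ c : Pos u, (if letterAt u ((nextPos u).symm c) = (g, false) then 1 else 0) := by
    rw [Nat.card_eq_fintype_card, Fintype.card_subtype, Finset.card_filter,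
      ← Finset.sum_add_distrib]
    refine Finset.sum_congr rfl fun c _ => ?_
    unfold Inc
    rw [hinv]
    by_cases e1 : letterAt u c = (g, true)
    · simp [e1, hne c e1]
    · simp [e1]
  have h8 : ∑ c : Pos u, 1 = ∑ j, (u j).norm := by
    rw [← card_pos_eq_sum_norm, Finset.sum_const, Finset.card_univ, smul_eq_mul, mul_one]
  rw [h5, h8] at h3
  have h9 := h1.trans h2
  simp only [D, F] at h9
  omega

end Whitehead

/-! ### Diskbusting lists and the end of the proof -/

theorem isInternalFreeProduct_zpowers {n : ℕ} (gen : Bool ≃ Fin n) :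
    IsInternalFreeProduct (Subgroup.zpowers (FreeGroup.of (gen false)))
      (Subgroup.zpowers (FreeGroup.of (gen true))) := by
  let ψ : FreeGroup (Fin n) →* Monoid.Coprod (Subgroup.zpowers (FreeGroup.of (gen false)))
      (Subgroup.zpowers (FreeGroup.of (gen true))) := FreeGroup.lift fun i =>
    if gen.symm i then .inr ⟨_, Subgroup.mem_zpowers _⟩ else .inl ⟨_, Subgroup.mem_zpowers _⟩
  have h0 : ψ (FreeGroup.of (gen false)) = .inl ⟨_, Subgroup.mem_zpowers _⟩ := by simp [ψ]
  have h1 : ψ (FreeGroup.of (gen true)) = .inr ⟨_, Subgroup.mem_zpowers _⟩ := by simp [ψ]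
  refine Function.bijective_iff_has_inverse.2 ⟨ψ, fun x => ?_, fun x => ?_⟩
  · refine DFunLike.congr_fun (f := ψ.comp (Monoid.Coprod.lift (Subgroup.subtype _)
      (Subgroup.subtype _))) (g := MonoidHom.id _) ?_ x
    refine Monoid.Coprod.hom_ext (MonoidHom.ext ?_) (MonoidHom.ext ?_)
    · rintro ⟨_, k, rfl⟩
      simp only [MonoidHom.comp_apply, Monoid.Coprod.lift_apply_inl, Subgroup.subtype_apply,
        MonoidHom.id_apply]
      rw [map_zpow, h0, ← map_zpow]
      rfl
    · rintro ⟨_, k, rfl⟩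
      simp only [MonoidHom.comp_apply, Monoid.Coprod.lift_apply_inr, Subgroup.subtype_apply,
        MonoidHom.id_apply]
      rw [map_zpow, h1, ← map_zpow]
      rfl
  · refine DFunLike.congr_fun (f := (Monoid.Coprod.lift (Subgroup.subtype _)
      (Subgroup.subtype _)).comp ψ) (g := MonoidHom.id _) ?_ x
    refine FreeGroup.ext_hom _ _ fun i => ?_
    obtain ⟨b, rfl⟩ := gen.surjective i
    cases b
    · rw [MonoidHom.comp_apply, h0]
      simp
    · rw [MonoidHom.comp_apply, h1]
      simp

section RankTwo

variable {n r : ℕ} {u : Fin r → FreeGroup (Fin n)}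

theorem exists_nextPos_iterate_eq (j : Fin r) (k l : Fin (u j).toWord.length) :
    ∃ m, (nextPos u)^[m] ⟨j, k⟩ = ⟨j, l⟩ := by
  refine ⟨l + (u j).toWord.length - k, ?_⟩
  rw [nextPos_iterate]
  refine Sigma.ext rfl (heq_of_eq (Fin.ext ?_))
  change (k + (l + (u j).toWord.length - k)) % _ = (l : ℕ)
  rw [show (k : ℕ) + (l + (u j).toWord.length - k) = l + (u j).toWord.length by omega,
    Nat.add_mod_right, Nat.mod_eq_of_lt l.2]

theorem forall_of_nextPos_closed {p : Pos u → Prop} (hp : ∀ c, p c → p (nextPos u c)) {j : Fin r}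
    {k : Fin (u j).toWord.length} (hk : p ⟨j, k⟩) (l : Fin (u j).toWord.length) : p ⟨j, l⟩ := by
  obtain ⟨m, hm⟩ := exists_nextPos_iterate_eq j k l
  rw [← hm]
  clear hm
  induction m with
  | zero => exact hk
  | succ m ih =>
    rw [Function.iterate_succ_apply']
    exact hp _ ih

theorem mem_zpowers_of_letters (g : Fin n) (w : FreeGroup (Fin n))
    (h : ∀ k, (w.toWord.get k).1 = g) : w ∈ Subgroup.zpowers (FreeGroup.of g) := by
  rw [FreeGroup.eq_prod_ofFn w]
  refine Subgroup.list_prod_mem _ fun x hx => ?_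
  obtain ⟨k, rfl⟩ := List.mem_ofFn.1 hx
  have hk := h k
  rcases hx : w.toWord.get k with ⟨i, s⟩
  rw [hx] at hk
  obtain rfl : i = g := hk
  cases s
  · rw [Letter.elem_false]
    exact inv_mem (Subgroup.mem_zpowers _)
  · exact Subgroup.mem_zpowers _

variable (gen : Bool ≃ Fin n)

theorem zpowers_of_ne_bot (g : Fin n) : Subgroup.zpowers (FreeGroup.of g) ≠ ⊥ := by
  rw [Ne, Subgroup.zpowers_eq_bot]
  exact FreeGroup.of_ne_one g

/-- Otherwise a⁻¹ can only be followed by a⁻¹, and a only be preceded by a. Each word is then a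
power of a or of b, contradicting the splitting ⟨a⟩ * ⟨b⟩. -/
theorem card_joining_pos (hcyc : ∀ j, FreeGroup.IsCyclicallyReduced (u j).toWord)
    (hdisk : IsDiskbusting u) : 0 < Nat.card (Joining u (gen false, true) (gen true, true)) +
      Nat.card (Joining u (gen false, true) (gen true, false)) := by
  by_contra hpos
  obtain ⟨hx, hy⟩ := Nat.add_eq_zero_iff.1 (Nat.eq_zero_of_not_pos hpos)
  have hx := (Nat.card_eq_zero.1 hx).resolve_right (not_infinite_iff_finite.2 inferInstance)
  have hy := (Nat.card_eq_zero.1 hy).resolve_right (not_infinite_iff_finite.2 inferInstance)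
  have key : ∀ c : Pos u, Inc c (gen false, true) → ∀ d, Inc c d → d.1 = gen false := by
    rintro c hc ⟨i, s⟩ hd
    obtain ⟨b, rfl⟩ := gen.surjective i
    cases b
    · rfl
    · cases s
      · exact (hy.false ⟨c, hc, hd⟩).elim
      · exact (hx.false ⟨c, hc, hd⟩).elim
  have hneg : ∀ c, letterAt u c = (gen false, false) → letterAt u (nextPos u c) =
      (gen false, false) := by
    intro c hc
    have h1 := inc_nextPos c
    rw [hc] at h1
    have h2 := key _ h1 _ (inc_letterAt _)
    have h3 := letterAt_nextPos_ne hcyc c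
    rw [hc] at h3
    rcases h : letterAt u (nextPos u c) with ⟨i, _ | _⟩ <;> rw [h] at h2 h3
    · exact Prod.ext h2 rfl
    · exact (h3 (Prod.ext h2 rfl)).elim
  have hposi : ∀ c, letterAt u c ≠ (gen false, true) → letterAt u (nextPos u c) ≠
      (gen false, true) := by
    intro c hc h
    have h2 := key (nextPos u c) (Or.inl h) _ (inc_nextPos c)
    have h3 := letterAt_nextPos_ne hcyc c
    rw [h] at h3
    rcases h4 : letterAt u c with ⟨i, _ | _⟩ <;> rw [h4] at h2 h3 hc
    · exact h3 (Prod.ext h2.symm rfl)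
    · exact hc (Prod.ext h2 rfl)
  refine hdisk ⟨_, _, zpowers_of_ne_bot (gen false), zpowers_of_ne_bot (gen true),
    isInternalFreeProduct_zpowers gen, fun j => ⟨u j, IsConj.refl _, ?_⟩⟩
  by_cases h1 : ∃ k, letterAt u ⟨j, k⟩ = (gen false, false)
  · obtain ⟨k, hk⟩ := h1
    exact Or.inl (mem_zpowers_of_letters _ _ fun l =>
      congrArg Prod.fst (forall_of_nextPos_closed hneg hk l))
  · by_cases h2 : ∃ k, letterAt u ⟨j, k⟩ ≠ (gen false, true)
    · obtain ⟨k, hk⟩ := h2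
      refine Or.inr (mem_zpowers_of_letters _ _ fun l => ?_)
      have h3 : letterAt u ⟨j, l⟩ ≠ _ := forall_of_nextPos_closed hposi hk l
      have h4 : letterAt u ⟨j, l⟩ ≠ _ := fun h => h1 ⟨l, h⟩
      change (letterAt u ⟨j, l⟩).1 = gen true
      rcases h5 : letterAt u ⟨j, l⟩ with ⟨i, s⟩
      rw [h5] at h3 h4
      obtain ⟨b, rfl⟩ := gen.surjective i
      cases b
      · cases s
        exacts [absurd rfl h4, absurd rfl h3]
      · rfl
    · push Not at h2
      exact Or.inl (mem_zpowers_of_letters _ _ fun l => congrArg Prod.fst (h2 l))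

open Corner in
theorem card_inc_eq (hcyc : ∀ j, FreeGroup.IsCyclicallyReduced (u j).toWord) :
    Nat.card {c : Pos u // Inc c (gen false, true)} =
      Nat.card (Joining u (gen false, true) (gen false, false)) +
      (Nat.card (Joining u (gen false, true) (gen true, true)) +
      Nat.card (Joining u (gen false, true) (gen true, false))) := by
  rw [← Nat.card_sum, ← Nat.card_sum]
  exact Nat.card_congr (((cornerEquiv gen hcyc).subtypeEquiv fun k =>
    (inc_cornerEquiv gen hcyc k false true).symm).symm.trans
      (equivOfRange start_injective range_start).symm)

/-- There are p + x + y corners at a⁺, and minimality gives 2x ≤ p + x + y. -/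
theorem card_joining_le (hcyc : ∀ j, FreeGroup.IsCyclicallyReduced (u j).toWord)
    (hmin : IsMinimalList u) : Nat.card (Joining u (gen false, true) (gen true, true)) ≤
      Nat.card (Joining u (gen false, true) (gen false, false)) +
      Nat.card (Joining u (gen false, true) (gen true, false)) := by
  have h := two_mul_card_joining_le hcyc hmin (g := gen false) (z := (gen true, true)) (by simp)
  rw [card_inc_eq gen hcyc] at h
  omega

theorem card_joining_le' (hcyc : ∀ j, FreeGroup.IsCyclicallyReduced (u j).toWord)
    (hmin : IsMinimalList u) : Nat.card (Joining u (gen false, true) (gen true, false)) ≤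
      Nat.card (Joining u (gen false, true) (gen false, false)) +
      Nat.card (Joining u (gen false, true) (gen true, true)) := by
  have h := two_mul_card_joining_le hcyc hmin (g := gen false) (z := (gen true, false)) (by simp)
  rw [card_inc_eq gen hcyc] at h
  omega

/-- The Tiling Conjecture in rank two. -/
theorem isPolygonal_of_equiv_bool (gen : Bool ≃ Fin n)
    (hcyc : ∀ j, FreeGroup.IsCyclicallyReduced (u j).toWord)
    (hmin : IsMinimalList u) (hdisk : IsDiskbusting u) : IsPolygonal u := by
  rcases le_total (Nat.card (Joining u (gen false, true) (gen false, false)))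
    (Nat.card (Joining u (gen true, true) (gen true, false))) with h | h
  · exact isPolygonal_of_card_le gen hcyc (card_joining_le gen hcyc hmin)
      (card_joining_le' gen hcyc hmin) h (card_joining_pos gen hcyc hdisk)
  -- Interchanging the generators interchanges p and q.
  · exact isPolygonal_of_card_le (Equiv.boolNot.trans gen) hcyc (card_joining_le _ hcyc hmin)
      (card_joining_le' _ hcyc hmin) h (card_joining_pos _ hcyc hdisk)

end RankTwo

theorem mainTheorem12 {n r : ℕ} (hn : 1 < n) (u : Fin r → FreeGroup (Fin n))
    (hnontriv : ∀ j, u j ≠ 1)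
    (hcyc : ∀ j, FreeGroup.IsCyclicallyReduced (u j).toWord)
    (hmin : IsMinimalList u) (hdisk : IsDiskbusting u)
    (h : TilingConjecture ∨ n = 2) :
    ∃ (S : PolygonalSurface u) (Q : S.WordPartition) (d : ℕ),
      0 < d ∧ ∀ j, Q.positiveDegree j = d := by
  refine IsPolygonal.exists_equal_degrees u hnontriv hcyc ?_
  rcases h with h | rfl
  · exact h n r u hn hnontriv hcyc hmin hdisk
  · exact isPolygonal_of_equiv_bool finTwoEquiv.symm hcyc hmin hdisk
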